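/- Let $n\ge 1$, $M=(M_1,\dots,M_n)\in\mathbb N^n$, $a=(a_1,\dots,a_n)\in(\mathbb C^*)^n$, and write $\mathbf x^M=\prod_i x_i^{M_i}$ and $\langle a,M\rangle=\sum_i a_iM_i$. Let $f$ be (a representative of) a germ of biholomorphism of $(\mathbb C^n,0)$ of the form $$f(x)=\Big(x_1\big(1+\mathbf x^M(a_1+A_1(x))\big),\dots,x_n\big(1+\mathbf x^M(a_n+A_n(x))\big)\Big),$$ where $A_i:(\mathbb C^n,0)\to(\mathbb C,0)$ are germs of holomorphic functions. Assume $\langle a,M\rangle\neq0$ and $\operatorname{Re}\big(a_i/\langle a,M\rangle\big)>0$ for all $i$. Put $d=\gcd(M_1,\dots,M_n)$, $m_i=M_i/d$, $\bar m=\#\{i: m_i=0\}$, and $T_j(z_1,\dots,z_n)=(z_1-j,z_2,\dots,z_n)$ for $j\in\mathbb Z$. Near the origin the fixed point set of $f$ is $\{\mathbf x^M=0\}$, and in every neighbourhood of the origin there exist $d$ pairwise disjoint connected open sets $\Omega^+_0,\dots,\Omega^+_{d-1}$ and $d$ pairwise disjoint connected open sets $\Omega^-_0,\dots,\Omega^-_{d-1}$,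 with $0\in\partial\Omega^+_k$ and $0\in\partial\Omega^-_k$ for all $k$, such that: 1. for every $k$, $f$ is defined on $\Omega^+_k$, $f(\Omega^+_k)\subset\Omega^+_k$ and $f^{\circ j}\to0$ as $j\to+\infty$ uniformly on compact subsets of $\Omega^+_k$; and $f^{-1}$ is defined on $\Omega^-_k$, $f^{-1}(\Omega^-_k)\subset\Omega^-_k$ and $f^{\circ -j}\to0$ as $j\to+\infty$ uniformly on compact subsets of $\Omega^-_k$; 2. the union of $\Omega^+_0,\dots,\Omega^+_{d-1},\Omega^-_0,\dots,\Omega^-_{d-1}$ and $\{\mathbf x^M=0\}$ is a neighbourhood of the origin; 3. for every $k$ there are open sets $W^\pm_k\subset\mathbb C^n$ and biholomorphisms $\phi^\pm_k:\Omega^\pm_k\to W^\pm_k$ that conjugate $f$ to the translation $\tau:(z,w_1,\dots,w_{n-1})\mapsto(z+1,w_1,\dots,w_{n-1})$, that is, $\phi^+_k\circ f=\tau\circ\phi^+_k$ on $\Omega^+_k$ and $\phi^-_k=\tau\circ\phi^-_k\circ f^{-1}$ on $\Omega^-_k$, and such that $$\bigcup_{j\in\mathbb N}T_j(W^+_k)=\bigcup_{j\in\mathbb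 N}T_{-j}(W^-_k)=\mathbb C\times(\mathbb C^*)^{n-\bar m-1}\times\mathbb C^{\bar m}.$$ -/

import Mathlib

open Filter Set Topology

namespace ParabolicGerm

/-- The monomial `x^M = x₁^{M₁} ⋯ xₙ^{Mₙ}`. -/
def mon {n : ℕ} (M : Fin n → ℕ) (x : Fin n → ℂ) : ℂ := ∏ i, x i ^ M i

/-- The (bilinear) pairing `⟨a, M⟩ = a₁ M₁ + ⋯ + aₙ Mₙ`. -/
def pairing {n : ℕ} (a : Fin n → ℂ) (M : Fin n → ℕ) : ℂ := ∑ i, a i * (M i : ℂ)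

/-- `d = gcd (M₁, …, Mₙ)`. -/
def expGcd {n : ℕ} (M : Fin n → ℕ) : ℕ := Finset.univ.gcd M

/-- `mᵢ = Mᵢ / d` (an exact division). -/
def redExp {n : ℕ} (M : Fin n → ℕ) (i : Fin n) : ℕ := M i / expGcd M

/-- `m̄ = #{i : mᵢ = 0}`. -/
def numZero {n : ℕ} (M : Fin n → ℕ) : ℕ := (Finset.univ.filter fun i => redExp M i = 0).card

/-- `f` is a local biholomorphism of `(ℂⁿ, 0)`, represented by a homeomorphism between two open
neighbourhoods of the origin, whose germ at `0` is
`x ↦ (xᵢ (1 + x^M (aᵢ + Aᵢ(x))))ᵢ` with `aᵢ ≠ 0` and `Aᵢ : (ℂⁿ, 0) → (ℂ, 0)` germs of holomorphic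
functions. Its inverse is `f.symm`. (The formula forces `f 0 = 0`, and that `f` and `f.symm` are
holomorphic near `0`.) -/
structure HasForm {n : ℕ} (M : Fin n → ℕ) (a : Fin n → ℂ)
    (f : OpenPartialHomeomorph (Fin n → ℂ) (Fin n → ℂ)) : Prop where
  zero_mem : (0 : Fin n → ℂ) ∈ f.source
  coeff_ne_zero : ∀ i, a i ≠ 0
  form : ∃ A : Fin n → (Fin n → ℂ) → ℂ, (∀ i, AnalyticAt ℂ (A i) 0) ∧ (∀ i, A i 0 = 0) ∧
    ∀ᶠ x in 𝓝 (0 : Fin n → ℂ), ∀ i, f x i = x i * (1 + mon M x * (a i + A i x))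

/-- `Ω` is a connected open set (contained in the domain of definition `D` of `g`) with `0` on its
boundary, invariant by `g`, on which the iterates of `g` tend to `0` uniformly on compact sets. -/
structure IsAttractingDomain {n : ℕ} (g : (Fin n → ℂ) → (Fin n → ℂ)) (D Ω : Set (Fin n → ℂ)) :
    Prop where
  isOpen : IsOpen Ω
  isConnected : IsConnected Ω
  subset_dom : Ω ⊆ D
  zero_mem_frontier : (0 : Fin n → ℂ) ∈ frontier Ω
  invariant : MapsTo g Ω Ω
  tendsto_zero : ∀ K ⊆ Ω, IsCompact K →
    TendstoUniformlyOn (fun j : ℕ => g^[j]) (fun _ => 0) atTop K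

/-- `φ` restricts to a biholomorphism from the open set `Ω ⊆ ℂⁿ` onto the open set `W ⊆ ℂⁿ`. -/
def IsBiholomorphism {n : ℕ} (φ : (Fin n → ℂ) → (Fin n → ℂ)) (Ω W : Set (Fin n → ℂ)) : Prop :=
  IsOpen Ω ∧ IsOpen W ∧ DifferentiableOn ℂ φ Ω ∧ BijOn φ Ω W ∧
    ∃ ψ : (Fin n → ℂ) → (Fin n → ℂ), DifferentiableOn ℂ ψ W ∧ InvOn ψ φ Ω W

/-- The map `(z, w₁, …, wₙ₋₁) ↦ (z + 1, w₁, …, wₙ₋₁)`. -/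
def shift {n : ℕ} [NeZero n] (z : Fin n → ℂ) : Fin n → ℂ := Function.update z 0 (z 0 + 1)

/-- The map `T_j (z₁, …, zₙ) = (z₁ - j, z₂, …, zₙ)`. -/
def T {n : ℕ} [NeZero n] (j : ℤ) (z : Fin n → ℂ) : Fin n → ℂ :=
  Function.update z 0 (z 0 - (j : ℂ))

/-- `ℂ × (ℂ*)^{n - m̄ - 1} × ℂ^{m̄}` as a subset of `ℂⁿ`: the coordinates number
`1, …, n - m̄ - 1` (counted from `0`) are nonzero. -/
def model (n mbar : ℕ) : Set (Fin n → ℂ) :=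
  {z | ∀ i : Fin n, 1 ≤ (i : ℕ) → (i : ℕ) < n - mbar → z i ≠ 0}

end ParabolicGerm

open ParabolicGerm

/-! Put β = ⟨a,M⟩ and α_i = a_i/β, so that ⟨α,M⟩ = 1 and Re α_i > 0. In exponential form f is x_i ↦
x_i exp(x^M b_i(x)) with b_i(0) = βα_i. The function Z = -1/(β x^M) satisfies Z∘f ≈ Z + 1, while x_i
is multiplied by about exp(-α_i/Z). Along an orbit x_i therefore behaves like Z^(-α_i), which tends
to 0.

Attracting domains. Over the sector |arg Z| < 3π/4, write θ = arg Z. The weight log|x_i| + Bθ²/2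
does not increase once B is large: where cos θ is too small for |x_i| to decrease, θ itself turns
towards 0 (`mon_mul_b_add_arg_le`). The product ω x^m Z^(1/d), with ω^d = -β, is a d-th root of
unity constant along orbits; requiring it to be 1 gives one domain for each of the d roots ω. In
logarithmic coordinates each domain is the image of a convex set, hence connected.

Decay. Every orbit enters a narrow sector about the positive axis, where ‖x‖ |Z|^δ does not increase
(`H_g_le`), so ‖x‖ = O(|Z|^(-δ)) there and functions of size O(|Z|^(-1-δ)) are summable along
orbits.

Fatou coordinates. The functions x_i Z^(α_i) are invariant up to a summable error and are corrected
to exact invariants w. The Abel equation φ∘f = φ + 1 is first solved to high order by Z(1 + P(x, log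
Z)) with P a polynomial (`exists_normalization`): on x^γ (log Z)^j the linearized equation acts like
d/dZ on Z^(1-s) (log Z)^j with s = ⟨α,γ⟩, which can be solved order by order, with one more
logarithm when s = 1. Summing the remaining defect gives φ. The approximate invariants satisfy w^m =
1/ω; a unimodular monomial change of variables μ with first coordinate w^m leaves n-1 free
invariants, and φ takes the place of the first one.

Biholomorphism and image. With the first coordinate divided by j, the resulting map Φ differs from
explicit coordinates by o(1) on fixed balls (`exists_ball_chart`). A holomorphic map close to the
identity is invertible, and Φ commutes with the dynamics; this gives injectivity, holomorphic
inverses, and the union of the translates of the image.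

Repelling side. f⁻¹ has the same form with -a; the ratios α_i are unchanged and Z becomes -Z. The
sectors for Z and -Z cover ℂ*. -/

namespace ParabolicGerm

/-! ### Cauchy estimates, series of holomorphic functions, maps close to the identity -/

section ComplexAnalysis

variable {E F : Type*} [NormedAddCommGroup E] [NormedSpace ℂ E]
  [NormedAddCommGroup F] [NormedSpace ℂ F]

/-- Cauchy's estimate for the first derivative on a ball of a normed space. -/
theorem norm_fderiv_le_of_norm_le_ball {f : E → F} {c : E} {R C : ℝ} (hR : 0 < R)
    (hd : DifferentiableOn ℂ f (Metric.ball c R)) (hC : ∀ x ∈ Metric.ball c R, ‖f x‖ ≤ C) :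
    ‖fderiv ℂ f c‖ ≤ 2 * C / R := by
  refine Complex.norm_fderiv_le_div_of_mapsTo_ball hd (fun x hx => ?_) hR
  rw [Metric.mem_closedBall, dist_eq_norm]
  have h1 := hC x hx
  have h2 := hC c (Metric.mem_ball_self hR)
  linarith [norm_sub_le (f x) (f c)]

/-- A series of holomorphic functions dominated by a summable sequence has a holomorphic sum. -/
theorem differentiableAt_tsum_of_norm_le [CompleteSpace F] {f : ℕ → E → F} {x : E} {r : ℝ}
    {v : ℕ → ℝ}
    (hr : 0 < r) (hv : Summable v) (hd : ∀ j, DifferentiableOn ℂ (f j) (Metric.ball x r))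
    (hb : ∀ j, ∀ y ∈ Metric.ball x r, ‖f j y‖ ≤ v j) :
    DifferentiableAt ℂ (fun y => ∑' j, f j y) x := by
  have hv' : Summable fun j => 2 * v j / (r / 2) := (hv.mul_left 2).div_const _
  have hsub : ∀ y ∈ Metric.ball x (r / 2), Metric.ball y (r / 2) ⊆ Metric.ball x r := by
    intro y hy
    refine Metric.ball_subset_ball' ?_
    have := Metric.mem_ball.1 hy
    linarith
  have hcx : x ∈ Metric.ball x (r / 2) := Metric.mem_ball_self (half_pos hr)
  let : NormedSpace ℝ E := NormedSpace.restrictScalars ℝ ℂ E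
  refine (hasFDerivAt_tsum_of_isPreconnected (f' := fun j y => fderiv ℂ (f j) y) hv'
    Metric.isOpen_ball (convex_ball x (r / 2)).isPreconnected (fun j y hy => ?_) (fun j y hy => ?_)
    hcx ?_ hcx).differentiableAt
  · refine ((hd j).differentiableAt (Metric.isOpen_ball.mem_nhds ?_)).hasFDerivAt
    exact hsub y hy (Metric.mem_ball_self (half_pos hr))
  · exact norm_fderiv_le_of_norm_le_ball (half_pos hr) ((hd j).mono (hsub y hy))
      (fun z hz => hb j z (hsub y hy hz))
  · exact Summable.of_norm_bounded hv (fun j => hb j x (Metric.mem_ball_self hr))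

/-- A holomorphic map uniformly close to the identity on a ball restricts to a biholomorphism
whose image contains a smaller concentric ball. -/
theorem exists_openPartialHomeomorph_of_near_id [CompleteSpace E] {h : E → E} {p : E} {r : ℝ}
    (hr : 0 < r) (hd : DifferentiableOn ℂ h (Metric.ball p r))
    (hb : ∀ x ∈ Metric.ball p r, ‖h x - x‖ ≤ r / 16) :
    ∃ e : OpenPartialHomeomorph E E, (e : E → E) = h ∧ e.source = Metric.ball p (r / 2) ∧
      Metric.ball p (r / 8) ⊆ e.target ∧ DifferentiableOn ℂ e.symm e.target := by
  rcases subsingleton_or_nontrivial E with hE | hE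
  · refine ⟨OpenPartialHomeomorph.ofSet (Metric.ball p (r / 2)) Metric.isOpen_ball, ?_, rfl, ?_, ?_⟩
    · ext x
      exact Subsingleton.elim _ _
    · exact Metric.ball_subset_ball (by linarith)
    · intro x _
      exact differentiableWithinAt_id
  let : NormedSpace ℝ E := NormedSpace.restrictScalars ℝ ℂ E
  have hsub : ∀ y ∈ Metric.ball p (r / 2), Metric.ball y (r / 2) ⊆ Metric.ball p r := by
    intro y hy
    refine Metric.ball_subset_ball' ?_
    have := Metric.mem_ball.1 hy
    linarith
  have hder : ∀ y ∈ Metric.ball p (r / 2), DifferentiableAt ℂ h y := fun y hy =>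
    hd.differentiableAt (Metric.isOpen_ball.mem_nhds
      (hsub y hy (Metric.mem_ball_self (half_pos hr))))
  -- Cauchy's estimate on balls of radius r/2 for a function bounded by r/16 gives 2·(r/16)/(r/2) =
  -- 1/4, a contraction constant.
  have hbd : ∀ y ∈ Metric.ball p (r / 2),
      ‖fderiv ℂ (fun x => h x - x) y‖ ≤ 1 / 4 := by
    intro y hy
    have := norm_fderiv_le_of_norm_le_ball (f := fun x => h x - x) (half_pos hr)
      ((hd.sub differentiableOn_id).mono (hsub y hy)) (C := r / 16)
      (fun z hz => hb z (hsub y hy hz))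
    have h2 : 2 * (r / 16) / (r / 2) = 1 / 4 := by field_simp; norm_num
    linarith
  have hN : ‖((ContinuousLinearEquiv.refl ℂ E).symm : E →L[ℂ] E)‖₊ = 1 := by
    have : ((ContinuousLinearEquiv.refl ℂ E).symm : E →L[ℂ] E) = ContinuousLinearMap.id ℂ E := rfl
    rw [this]
    ext
    simp
  have hap : ApproximatesLinearOn h ((ContinuousLinearEquiv.refl ℂ E : E ≃L[ℂ] E) : E →L[ℂ] E)
      (Metric.ball p (r / 2)) (1 / 4 : NNReal) := by
    intro x hx y hy
    have := (convex_ball p (r / 2)).norm_image_sub_le_of_norm_fderiv_le (𝕜 := ℂ)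
      (f := fun x => h x - x) (fun z hz => (hder z hz).sub differentiableAt_id) hbd hy hx
    have h3 : h x - h y - (((ContinuousLinearEquiv.refl ℂ E : E ≃L[ℂ] E) : E →L[ℂ] E)) (x - y)
      = h x - x - (h y - y) := by
      change h x - h y - (x - y) = _
      abel
    rw [h3]
    simpa using this
  have hc : Subsingleton E ∨ (1 / 4 : NNReal) <
      ‖((ContinuousLinearEquiv.refl ℂ E).symm : E →L[ℂ] E)‖₊⁻¹ := by
    right
    rw [hN, inv_one, ← NNReal.coe_lt_coe]
    norm_num
  refine ⟨hap.toOpenPartialHomeomorph h _ hc Metric.isOpen_ball, rfl, rfl, ?_, ?_⟩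
  -- The target contains the closed ball of radius (1 - 1/4)·r/3 = r/4 about h p. Since h p is
  -- within r/16 of p and r/8 + r/16 < r/4, the ball of radius r/8 about p fits inside.
  · have h1 := hap.closedBall_subset_target hc Metric.isOpen_ball (b := p) (ε := r / 3)
      (by linarith) (Metric.closedBall_subset_ball (by linarith))
    refine Subset.trans (fun y hy => ?_) h1
    rw [hN]
    have h2 := hb p (Metric.mem_ball_self hr)
    rw [Metric.mem_ball] at hy
    rw [Metric.mem_closedBall]
    have h4 : dist p (h p) ≤ r / 16 := by rwa [dist_comm, dist_eq_norm]
    have h5 := dist_triangle y p (h p)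
    push_cast
    linarith
  · intro y hy
    set e := hap.toOpenPartialHomeomorph h _ hc Metric.isOpen_ball with he
    have hx : e.symm y ∈ Metric.ball p (r / 2) := e.map_target hy
    have hnorm : ‖ContinuousLinearMap.id ℂ E - fderiv ℂ h (e.symm y)‖ < 1 := by
      have h1 := hbd _ hx
      have h2 : fderiv ℂ (fun x => h x - x) (e.symm y)
          = fderiv ℂ h (e.symm y) - ContinuousLinearMap.id ℂ E := by
        have := ((hder _ hx).hasFDerivAt.sub (hasFDerivAt_id (𝕜 := ℂ) (e.symm y))).fderiv
        exact this
      rw [h2, norm_sub_rev] at h1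
      linarith
    have hu : IsUnit (fderiv ℂ h (e.symm y)) := by
      have h1 := isUnit_one_sub_of_norm_lt_one (R := E →L[ℂ] E) hnorm
      have h2 : (1 : E →L[ℂ] E) - (ContinuousLinearMap.id ℂ E - fderiv ℂ h (e.symm y))
          = fderiv ℂ h (e.symm y) := by
        change ContinuousLinearMap.id ℂ E - (ContinuousLinearMap.id ℂ E - _) = _
        abel
      rwa [h2] at h1
    obtain ⟨v, hv⟩ := hu
    have hfd : HasFDerivAt e ((ContinuousLinearEquiv.unitsEquiv ℂ E v : E ≃L[ℂ] E) : E →L[ℂ] E)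
        (e.symm y) := by
      have h3 : ((ContinuousLinearEquiv.unitsEquiv ℂ E v : E ≃L[ℂ] E) : E →L[ℂ] E)
          = fderiv ℂ h (e.symm y) := by
        rw [← hv]
        rfl
      rw [h3]
      exact (hder _ hx).hasFDerivAt
    exact (e.hasFDerivAt_symm hy hfd).differentiableAt.differentiableWithinAt

end ComplexAnalysis

/-- An injective holomorphic map with holomorphic local right inverses is a biholomorphism onto
its image. -/
theorem isBiholomorphism_image_of_local_inverse {n : ℕ} {φ : (Fin n → ℂ) → (Fin n → ℂ)}
    {Ω : Set (Fin n → ℂ)} (hΩ : IsOpen Ω) (hd : DifferentiableOn ℂ φ Ω) (hinj : InjOn φ Ω)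
    (hloc : ∀ x ∈ Ω, ∃ ψ : (Fin n → ℂ) → (Fin n → ℂ), ∀ᶠ z in 𝓝 (φ x),
      DifferentiableAt ℂ ψ z ∧ ψ z ∈ Ω ∧ φ (ψ z) = z) :
    IsBiholomorphism φ Ω (φ '' Ω) := by
  refine ⟨hΩ, ?_, hd, hinj.bijOn_image, Function.invFunOn φ Ω, ?_, ?_, ?_⟩
  · rw [isOpen_iff_mem_nhds]
    rintro _ ⟨x, hx, rfl⟩
    obtain ⟨ψ, hψ⟩ := hloc x hx
    filter_upwards [hψ] with z hz
    exact ⟨ψ z, hz.2.1, hz.2.2⟩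
  · rintro _ ⟨x, hx, rfl⟩
    obtain ⟨ψ, hψ⟩ := hloc x hx
    have heq : Function.invFunOn φ Ω =ᶠ[𝓝 (φ x)] ψ := by
      filter_upwards [hψ] with z hz
      have hz' : z ∈ φ '' Ω := ⟨ψ z, hz.2.1, hz.2.2⟩
      exact hinj (Function.invFunOn_mem hz') hz.2.1
        ((Function.invFunOn_eq hz').trans hz.2.2.symm)
    exact (heq.differentiableAt_iff.2 hψ.self_of_nhds.1).differentiableWithinAt
  · exact hinj.leftInvOn_invFunOn
  · intro z hz
    exact Function.invFunOn_eq hz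


theorem differentiableAt_finset_prod {E ι : Type*} [NormedAddCommGroup E] [NormedSpace ℂ E]
    {s : Finset ι} {f : ι → E → ℂ} {x : E} (hf : ∀ i ∈ s, DifferentiableAt ℂ (f i) x) :
    DifferentiableAt ℂ (fun y => ∏ i ∈ s, f i y) x := by
  induction s using Finset.cons_induction with
  | empty => simp
  | cons a s ha ih =>
    simp only [Finset.prod_cons]
    exact (hf a (Finset.mem_cons_self a s)).mul
      (ih fun i hi => hf i (Finset.mem_cons_of_mem hi))

/-! ### Unimodular integer matrices and monomial changes of variables -/

section Unimodular

variable {n : ℕ}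

/-- The transvection `v ↦ v + v i • e_j` of `ℤⁿ`. -/
def transvectionEquiv (i j : Fin n) (hij : i ≠ j) : (Fin n → ℤ) ≃ₗ[ℤ] (Fin n → ℤ) where
  toFun v := Function.update v j (v j + v i)
  invFun v := Function.update v j (v j - v i)
  map_add' v w := by
    ext k
    by_cases hk : k = j
    · subst hk; simp; ring
    · simp [hk]
  map_smul' c v := by
    ext k
    by_cases hk : k = j
    · subst hk; simp; ring
    · simp [hk]
  left_inv v := by
    ext k
    by_cases hk : k = j
    · subst hk; simp [hij]
    · simp [hk]
  right_inv v := by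
    ext k
    by_cases hk : k = j
    · subst hk; simp [hij]
    · simp [hk]

theorem transvectionEquiv_apply (i j : Fin n) (hij : i ≠ j) (v : Fin n → ℤ) :
    transvectionEquiv i j hij v = Function.update v j (v j + v i) := rfl

/-- A permutation of `Fin n` sending `S` onto an initial segment and a point `j₀ ∈ S` to `0`. -/
theorem exists_perm_initial [NeZero n] (S : Finset (Fin n)) {j₀ : Fin n} (hj₀ : j₀ ∈ S) :
    ∃ τ : Equiv.Perm (Fin n), (∀ k, (τ k : ℕ) < S.card ↔ k ∈ S) ∧ τ j₀ = 0 := by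
  have hn : S.card ≤ n := by simpa using S.card_le_univ
  have hcard : Fintype.card {k // k ∈ S} = Fintype.card {i : Fin n // (i : ℕ) < S.card} := by
    rw [Fintype.card_coe, Fintype.card_subtype, Fin.card_filter_val_lt, min_eq_right hn]
  let e := Fintype.equivOfCardEq hcard
  let τ₀ : Equiv.Perm (Fin n) := e.extendSubtype
  have h0 : ∀ k, (τ₀ k : ℕ) < S.card ↔ k ∈ S := by
    intro k
    constructor
    · intro h
      by_contra hk
      exact e.extendSubtype_not_mem k hk h
    · intro h
      exact e.extendSubtype_mem k h
  refine ⟨τ₀.trans (Equiv.swap (τ₀ j₀) 0), fun k => ?_, by simp⟩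
  rw [← h0, Equiv.trans_apply]
  have hpos : 0 < S.card := Finset.card_pos.2 ⟨j₀, hj₀⟩
  have hj := (h0 j₀).2 hj₀
  by_cases h1 : τ₀ k = τ₀ j₀
  · rw [h1, Equiv.swap_apply_left]
    simpa [hpos] using hj
  · by_cases h2 : τ₀ k = 0
    · rw [h2, Equiv.swap_apply_right]
      simpa [hpos] using hj
    · rw [Equiv.swap_apply_of_ne_of_ne h1 h2]

/-- A primitive integer vector is the first row of a unimodular matrix, which can moreover be
chosen to be a permutation matrix off a given set containing the support of the vector. -/
theorem exists_linearEquiv_of_gcd_eq_one [NeZero n] (S : Finset (Fin n)) (N : ℕ) :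
    ∀ m : Fin n → ℕ, ∑ k, m k = N → (∀ k ∉ S, m k = 0) → Finset.univ.gcd m = 1 →
    ∃ (τ : Equiv.Perm (Fin n)) (e : (Fin n → ℤ) ≃ₗ[ℤ] (Fin n → ℤ)),
      (∀ k, (τ k : ℕ) < S.card ↔ k ∈ S) ∧ (∀ v, e v 0 = ∑ k, (m k : ℤ) * v k) ∧
      ∀ k ∉ S, e (Pi.single k 1) = Pi.single (τ k) 1 := by
  induction N using Nat.strong_induction_on with
  | _ N ih =>
  intro m hN hS hg
  -- Euclid's algorithm: subtracting the entry m_j from m_i lowers the sum and keeps the gcd, and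
  -- adding v_i to v_j compensates in the linear form: m'·v' = m·v.
  by_cases hex : ∃ i j, i ≠ j ∧ 0 < m j ∧ m j ≤ m i
  · obtain ⟨i, j, hij, hj, hji⟩ := hex
    set m' := Function.update m i (m i - m j) with hm'
    have hm'j : m' j = m j := by simp [hm', hij.symm]
    have hm'i : m' i = m i - m j := by simp [hm']
    have hiS : i ∈ S := by
      by_contra h
      have := hS i h
      omega
    have hjS : j ∈ S := by
      by_contra h
      have := hS j h
      omega
    have hsum : ∑ k, m' k < N := by
      rw [← hN]
      refine Finset.sum_lt_sum (fun k _ => ?_) ⟨i, Finset.mem_univ _, ?_⟩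
      · by_cases hk : k = i
        · rw [hk, hm'i]; omega
        · simp [hm', hk]
      · rw [hm'i]; omega
    have hS' : ∀ k ∉ S, m' k = 0 := by
      intro k hk
      have : k ≠ i := by
        rintro rfl
        exact hk hiS
      simp [hm', this, hS k hk]
    have hg' : Finset.univ.gcd m' = 1 := by
      rw [← Nat.dvd_one, ← hg]
      refine Finset.dvd_gcd fun k _ => ?_
      by_cases hk : k = i
      · have h1 : Finset.univ.gcd m' ∣ m' i := Finset.gcd_dvd (Finset.mem_univ _)
        have h2 : Finset.univ.gcd m' ∣ m' j := Finset.gcd_dvd (Finset.mem_univ _)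
        have h3 := Nat.dvd_add h1 h2
        rw [hm'i, hm'j, Nat.sub_add_cancel hji] at h3
        rwa [hk]
      · have h1 : Finset.univ.gcd m' ∣ m' k := Finset.gcd_dvd (Finset.mem_univ _)
        simpa [hm', hk] using h1
    obtain ⟨τ, e, h1, h2, h3⟩ := ih _ hsum m' rfl hS' hg'
    refine ⟨τ, (transvectionEquiv i j hij).trans e, h1, fun v => ?_, fun k hk => ?_⟩
    · rw [LinearEquiv.trans_apply, h2, transvectionEquiv_apply]
      have ha : ∀ k, (m' k : ℤ) * Function.update v j (v j + v i) k
          = (m k : ℤ) * v k + ((if k = j then (m j : ℤ) * v i else 0)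
            - (if k = i then (m j : ℤ) * v i else 0)) := by
        intro k
        by_cases hkj : k = j
        · subst hkj
          simp [hm'j, hij.symm]
          ring
        · by_cases hki : k = i
          · subst hki
            rw [hm'i]
            simp [hij, Nat.cast_sub hji]
            ring
          · simp [hkj, hki, hm']
      simp_rw [ha]
      rw [Finset.sum_add_distrib, Finset.sum_sub_distrib]
      simp
    · rw [LinearEquiv.trans_apply, transvectionEquiv_apply, ← h3 k hk]
      congr 1
      have hki : i ≠ k := by
        rintro rfl
        exact hk hiS
      rw [Pi.single_eq_of_ne hki, add_zero, Function.update_eq_self]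
  -- Two positive entries would always be comparable, so only one entry is nonzero and the gcd makes
  -- it 1. A permutation matrix then suffices.
  · push Not at hex
    obtain ⟨j₀, hj₀⟩ : ∃ j, m j ≠ 0 := by
      by_contra! h
      rw [Finset.gcd_eq_zero_iff.2 (fun k _ => h k)] at hg
      exact zero_ne_one hg
    have hother : ∀ k, k ≠ j₀ → m k = 0 := by
      intro k hk
      by_contra h
      have h1 := hex k j₀ hk (Nat.pos_of_ne_zero hj₀)
      have h2 := hex j₀ k hk.symm (Nat.pos_of_ne_zero h)
      omega
    have hone : m j₀ = 1 := by
      rw [← Nat.dvd_one, ← hg]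
      refine Finset.dvd_gcd fun k _ => ?_
      by_cases hk : k = j₀
      · rw [hk]
      · rw [hother k hk]
        exact dvd_zero _
    have hjS : j₀ ∈ S := by
      by_contra h
      exact hj₀ (hS _ h)
    obtain ⟨τ, h1, h2⟩ := exists_perm_initial S hjS
    refine ⟨τ, LinearEquiv.funCongrLeft ℤ ℤ τ.symm, h1, fun v => ?_, fun k hk => ?_⟩
    · have : τ.symm 0 = j₀ := by rw [← h2, Equiv.symm_apply_apply]
      rw [LinearEquiv.funCongrLeft_apply, LinearMap.funLeft_apply, this,
        Finset.sum_eq_single j₀]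
      · simp [hone]
      · intro k _ hk
        simp [hother k hk]
      · simp
    · ext i
      rw [LinearEquiv.funCongrLeft_apply, LinearMap.funLeft_apply, Pi.single_apply,
        Pi.single_apply]
      congr 1
      exact propext (Equiv.symm_apply_eq τ)

/-- The Laurent monomial map of `ℂⁿ` with exponent matrix `Q`. -/
noncomputable def zmon (Q : Fin n → Fin n → ℤ) (w : Fin n → ℂ) (i : Fin n) : ℂ :=
  ∏ j, w j ^ Q i j

/-- Composition of monomial maps multiplies the exponent matrices. Adding exponents needs w_k ≠ 0,
except when column k of Q is a unit vector: then only one factor carries a nontrivial exponent and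
w_k may vanish. -/
theorem zmon_zmon {Q Q' : Fin n → Fin n → ℤ}
    (hQ : ∀ i k, ∑ j, Q' i j * Q j k = if i = k then 1 else 0)
    {w : Fin n → ℂ} (hw : ∀ k, w k ≠ 0 ∨ ∃ l, ∀ j, Q j k = if j = l then 1 else 0) :
    zmon Q' (zmon Q w) = w := by
  ext i
  have h1 : zmon Q' (zmon Q w) i = ∏ k, ∏ j, w k ^ (Q j k * Q' i j) := by
    unfold zmon
    rw [Finset.prod_comm]
    refine Finset.prod_congr rfl fun j _ => ?_
    rw [← Finset.prod_zpow]
    exact Finset.prod_congr rfl fun k _ => (zpow_mul _ _ _).symm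
  have h2 : ∀ k, ∏ j, w k ^ (Q j k * Q' i j) = w k ^ (∑ j, Q' i j * Q j k) := by
    intro k
    rcases hw k with h | ⟨l, hl⟩
    · have : ∀ s : Finset (Fin n),
          ∏ j ∈ s, w k ^ (Q j k * Q' i j) = w k ^ (∑ j ∈ s, Q' i j * Q j k) := by
        intro s
        induction s using Finset.induction_on with
        | empty => simp
        | insert a s ha ih =>
          rw [Finset.prod_insert ha, Finset.sum_insert ha, ih, zpow_add₀ h, mul_comm (Q a k)]
      exact this _
    · rw [Finset.prod_eq_single l, Finset.sum_eq_single l, mul_comm]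
      · intro j _ hj
        simp [hl, hj]
      · simp
      · intro j _ hj
        simp [hl, hj]
      · simp
  rw [h1]
  simp_rw [h2, hQ]
  rw [Finset.prod_eq_single i]
  · simp
  · intro k _ hk
    simp [hk.symm]
  · simp

theorem zmon_mul_exp (Q : Fin n → Fin n → ℤ) (w s : Fin n → ℂ) (i : Fin n) :
    zmon Q (fun j => w j * Complex.exp (s j)) i
      = zmon Q w i * Complex.exp (∑ j, (Q i j : ℂ) * s j) := by
  unfold zmon
  rw [Complex.exp_sum, ← Finset.prod_mul_distrib]
  refine Finset.prod_congr rfl fun j _ => ?_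
  rw [mul_zpow, Complex.exp_int_mul]

theorem differentiableAt_zmon {Q : Fin n → Fin n → ℤ} {w : Fin n → ℂ}
    (hw : ∀ k, w k ≠ 0 ∨ ∀ i, 0 ≤ Q i k) : DifferentiableAt ℂ (zmon Q) w := by
  rw [differentiableAt_pi]
  intro i
  unfold zmon
  refine differentiableAt_finset_prod fun j _ => ?_
  refine DifferentiableAt.zpow (by fun_prop) ?_
  rcases hw j with h | h
  · exact Or.inl h
  · exact Or.inr (h i)

/-- Data of a monomial automorphism `μ` of `(ℂ*)^p × ℂ^{n-p}` (up to a permutation of the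
coordinates of the source) with first coordinate `x^m`, with inverse `ν`. -/
structure MonomialChart [NeZero n] (m : Fin n → ℕ) (p : ℕ)
    (μ ν : (Fin n → ℂ) → (Fin n → ℂ)) : Prop where
  zero_eq : ∀ w, μ w 0 = mon m w
  mem : ∀ w, (∀ k, m k ≠ 0 → w k ≠ 0) → ∀ i : Fin n, (i : ℕ) < p → μ w i ≠ 0
  left_inv : ∀ w, (∀ k, m k ≠ 0 → w k ≠ 0) → ν (μ w) = w
  right_inv : ∀ t, (∀ i : Fin n, (i : ℕ) < p → t i ≠ 0) → μ (ν t) = t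
  diff : ∀ w, (∀ k, m k ≠ 0 → w k ≠ 0) → DifferentiableAt ℂ μ w
  diff_symm : ∀ t, (∀ i : Fin n, (i : ℕ) < p → t i ≠ 0) → DifferentiableAt ℂ ν t
  mul_exp : ∃ Q : Fin n → Fin n → ℤ, ∀ (w s : Fin n → ℂ) (i : Fin n),
    μ (fun j => w j * Complex.exp (s j)) i = μ w i * Complex.exp (∑ j, (Q i j : ℂ) * s j)

/-- The exponent matrix is unimodular with first row m, and its columns off the support of m are
unit vectors. The variables absent from x^m thus occur only as plain coordinates, placed last, and
may vanish both in the source and in the target. -/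
theorem exists_monomialChart [NeZero n] {m : Fin n → ℕ} (hg : Finset.univ.gcd m = 1) :
    ∃ μ ν, MonomialChart m (n - (Finset.univ.filter fun i => m i = 0).card) μ ν := by
  set S : Finset (Fin n) := Finset.univ.filter fun i => m i ≠ 0 with hS
  have hmem : ∀ k, k ∈ S ↔ m k ≠ 0 := by simp [hS]
  have hcard : n - (Finset.univ.filter fun i => m i = 0).card = S.card := by
    have := Finset.card_filter_add_card_filter_not (s := (Finset.univ : Finset (Fin n)))
      (fun i => m i = 0)
    simp only [Finset.card_univ, Fintype.card_fin] at this
    have h2 : S.card = (Finset.univ.filter fun i => ¬ m i = 0).card := rfl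
    omega
  rw [hcard]
  obtain ⟨τ, e, h1, h2, h3⟩ := exists_linearEquiv_of_gcd_eq_one S _ m rfl
    (fun k hk => by simpa [hS] using hk) hg
  have hexp : ∀ v : Fin n → ℤ, v = ∑ j, v j • (Pi.single j 1 : Fin n → ℤ) := by
    intro v
    ext i
    simp [Finset.sum_apply, Pi.single_apply]
  have hmat : ∀ (g : (Fin n → ℤ) ≃ₗ[ℤ] (Fin n → ℤ)) (v : Fin n → ℤ) (i : Fin n),
      g v i = ∑ j, g (Pi.single j 1) i * v j := by
    intro g v i
    conv_lhs => rw [hexp v, map_sum]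
    rw [Finset.sum_apply]
    refine Finset.sum_congr rfl fun j _ => ?_
    rw [map_zsmul, Pi.smul_apply, smul_eq_mul, mul_comm]
  set Q : Fin n → Fin n → ℤ := fun i j => e (Pi.single j 1) i with hQ
  set Q' : Fin n → Fin n → ℤ := fun i j => e.symm (Pi.single j 1) i with hQ'
  have hQ'Q : ∀ i k, ∑ j, Q' i j * Q j k = if i = k then 1 else 0 := by
    intro i k
    have := hmat e.symm (e (Pi.single k 1)) i
    rw [LinearEquiv.symm_apply_apply, Pi.single_apply] at this
    exact this.symm
  have hQQ' : ∀ i k, ∑ j, Q i j * Q' j k = if i = k then 1 else 0 := by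
    intro i k
    have := hmat e (e.symm (Pi.single k 1)) i
    rw [LinearEquiv.apply_symm_apply, Pi.single_apply] at this
    exact this.symm
  have hQ0 : ∀ j, Q 0 j = m j := by
    intro j
    simp only [hQ]
    rw [h2, Finset.sum_eq_single j]
    · simp
    · intro k _ hk
      simp [hk]
    · simp
  have hQu : ∀ k, m k = 0 → ∀ i, Q i k = if i = τ k then 1 else 0 := by
    intro k hk i
    simp only [hQ]
    rw [h3 k (by simpa [hS] using hk), Pi.single_apply]
  have hQu' : ∀ k, m k = 0 → ∀ i, Q' i (τ k) = if i = k then 1 else 0 := by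
    intro k hk i
    simp only [hQ']
    rw [← h3 k (by simpa [hS] using hk), LinearEquiv.symm_apply_apply, Pi.single_apply]
  have hτ : ∀ i : Fin n, ¬ (i : ℕ) < S.card → m (τ.symm i) = 0 := by
    intro i hi
    have := h1 (τ.symm i)
    rw [Equiv.apply_symm_apply, hmem] at this
    tauto
  have hw : ∀ w : Fin n → ℂ, (∀ k, m k ≠ 0 → w k ≠ 0) →
      ∀ k, w k ≠ 0 ∨ ∃ l, ∀ j, Q j k = if j = l then 1 else 0 := by
    intro w hw k
    by_cases hk : m k = 0
    · exact Or.inr ⟨τ k, hQu k hk⟩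
    · exact Or.inl (hw k hk)
  have ht : ∀ t : Fin n → ℂ, (∀ i : Fin n, (i : ℕ) < S.card → t i ≠ 0) →
      ∀ i, t i ≠ 0 ∨ ∃ l, ∀ j, Q' j i = if j = l then 1 else 0 := by
    intro t ht i
    by_cases hi : (i : ℕ) < S.card
    · exact Or.inl (ht i hi)
    · refine Or.inr ⟨τ.symm i, fun j => ?_⟩
      have := hQu' _ (hτ i hi) j
      rwa [Equiv.apply_symm_apply] at this
  have hnn : ∀ {R : Fin n → Fin n → ℤ} {k : Fin n},
      (∃ l, ∀ j, R j k = if j = l then 1 else 0) → ∀ i, 0 ≤ R i k := by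
    rintro R k ⟨l, hl⟩ i
    rw [hl]
    split_ifs <;> simp
  refine ⟨zmon Q, zmon Q', ?_, ?_, ?_, ?_, ?_, ?_, ?_⟩
  · intro w
    simp [zmon, mon, hQ0]
  · intro w hw' i hi
    unfold zmon
    rw [Finset.prod_ne_zero_iff]
    intro k _
    by_cases hk : m k = 0
    · have hne : i ≠ τ k := by
        rintro rfl
        have := (h1 k).1 hi
        rw [hmem] at this
        exact this hk
      rw [hQu k hk, if_neg hne, zpow_zero]
      exact one_ne_zero
    · exact zpow_ne_zero _ (hw' k hk)
  · intro w hw'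
    exact zmon_zmon hQ'Q (hw w hw')
  · intro t ht'
    exact zmon_zmon hQQ' (ht t ht')
  · intro w hw'
    exact differentiableAt_zmon fun k => (hw w hw' k).imp_right hnn
  · intro t ht'
    exact differentiableAt_zmon fun k => (ht t ht' k).imp_right hnn
  · exact ⟨Q, fun w s i => zmon_mul_exp Q w s i⟩

end Unimodular


/-! ### Monomials under multiplication by exponentials -/

section Monomials

variable {n : ℕ}

theorem mon_mul_exp (M : Fin n → ℕ) (x c : Fin n → ℂ) :
    mon M (fun i => x i * Complex.exp (c i)) = mon M x * Complex.exp (pairing c M) := by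
  unfold mon pairing
  rw [Complex.exp_sum, ← Finset.prod_mul_distrib]
  refine Finset.prod_congr rfl fun i _ => ?_
  rw [mul_pow, ← Complex.exp_nat_mul, mul_comm (M i : ℂ)]

theorem pairing_mul_left (M : Fin n → ℕ) (c : ℂ) (v : Fin n → ℂ) :
    pairing (fun i => c * v i) M = c * pairing v M := by
  unfold pairing
  rw [Finset.mul_sum]
  exact Finset.sum_congr rfl fun i _ => mul_assoc _ _ _

theorem mon_ne_zero_iff {M : Fin n → ℕ} {x : Fin n → ℂ} :
    mon M x ≠ 0 ↔ ∀ i, M i ≠ 0 → x i ≠ 0 := by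
  unfold mon
  rw [Finset.prod_ne_zero_iff]
  refine ⟨fun h i hi => ?_, fun h i _ => ?_⟩
  · have := h i (Finset.mem_univ i)
    rw [pow_ne_zero_iff hi] at this
    exact this
  · by_cases hi : M i = 0
    · simp [hi]
    · exact pow_ne_zero _ (h i hi)

theorem differentiable_mon (M : Fin n → ℕ) : Differentiable ℂ (mon M) := by
  intro x
  unfold mon
  exact differentiableAt_finset_prod fun i _ => by fun_prop

theorem mon_mul_pow {m M : Fin n → ℕ} {d : ℕ} (h : ∀ i, M i = d * m i) (x : Fin n → ℂ) :
    mon M x = mon m x ^ d := by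
  unfold mon
  rw [← Finset.prod_pow]
  exact Finset.prod_congr rfl fun i _ => by rw [h, mul_comm, pow_mul]

end Monomials

/-! ### Polar coordinates and the sector Re z + |Im z| > 0 -/

section PolarCoordinates

theorem inv_re_eq (z : ℂ) : (z⁻¹).re = ‖z‖⁻¹ * Real.cos z.arg := by
  rcases eq_or_ne z 0 with rfl | hz
  · simp
  · rw [Complex.cos_arg hz, Complex.inv_re, Complex.normSq_eq_norm_sq]
    have : ‖z‖ ≠ 0 := norm_ne_zero_iff.2 hz
    field_simp

theorem inv_im_eq (z : ℂ) : (z⁻¹).im = -(‖z‖⁻¹ * Real.sin z.arg) := by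
  rcases eq_or_ne z 0 with rfl | hz
  · simp
  · rw [Complex.sin_arg, Complex.inv_im, Complex.normSq_eq_norm_sq]
    have : ‖z‖ ≠ 0 := norm_ne_zero_iff.2 hz
    field_simp

theorem abs_arg_lt_of_pos {z : ℂ} (hz : 0 < z.re + |z.im|) : |z.arg| < 3 * Real.pi / 4 := by
  by_contra! h
  have hpi := Complex.abs_arg_le_pi z
  have hpos := Real.pi_pos
  have hr : z.re = ‖z‖ * Real.cos |z.arg| := by rw [Real.cos_abs, Complex.norm_mul_cos_arg]
  have hi : |z.im| = ‖z‖ * Real.sin |z.arg| := by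
    rw [← Complex.norm_mul_sin_arg, abs_mul, abs_norm, Real.abs_sin_eq_sin_abs_of_abs_le_pi hpi]
  have h1 : Real.sin |z.arg| ≤ Real.sin (Real.pi / 4) := by
    rw [← Real.sin_pi_sub]
    exact Real.sin_le_sin_of_le_of_le_pi_div_two (by linarith) (by linarith) (by linarith)
  have h2 : Real.cos |z.arg| ≤ - Real.cos (Real.pi / 4) := by
    rw [← Real.cos_pi_sub]
    exact Real.cos_le_cos_of_nonneg_of_le_pi (by linarith) hpi (by linarith)
  rw [Real.sin_pi_div_four] at h1
  rw [Real.cos_pi_div_four] at h2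
  rw [hr, hi, ← mul_add] at hz
  have := mul_nonneg (norm_nonneg z) (by linarith : (0 : ℝ) ≤
    -(Real.cos |z.arg| + Real.sin |z.arg|))
  linarith

end PolarCoordinates

/-! ### The exponential normal form and the constants of the construction -/

/-- The map `x ↦ (xᵢ exp (x^M bᵢ(x)))ᵢ`. -/
noncomputable def expMap {n : ℕ} (M : Fin n → ℕ) (b : Fin n → (Fin n → ℂ) → ℂ) (x : Fin n → ℂ) :
    Fin n → ℂ := fun i => x i * Complex.exp (mon M x * b i x)

/-- The coordinate `-1 / (β x^M)`. -/
noncomputable def zc {n : ℕ} (β : ℂ) (M : Fin n → ℕ) (x : Fin n → ℂ) : ℂ := -(β * mon M x)⁻¹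

/-- The logarithmic increment of `zc` under `expMap`. -/
noncomputable def lam {n : ℕ} (M : Fin n → ℕ) (b : Fin n → (Fin n → ℂ) → ℂ) (x : Fin n → ℂ) : ℂ :=
  -(mon M x * pairing (fun i => b i x) M)

theorem mon_expMap {n : ℕ} (M : Fin n → ℕ) (b : Fin n → (Fin n → ℂ) → ℂ) (x : Fin n → ℂ) :
    mon M (expMap M b x) = mon M x * Complex.exp (-lam M b x) := by
  unfold expMap lam
  rw [mon_mul_exp, pairing_mul_left, neg_neg]

theorem zc_expMap {n : ℕ} (β : ℂ) (M : Fin n → ℕ) (b : Fin n → (Fin n → ℂ) → ℂ)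
    (x : Fin n → ℂ) : zc β M (expMap M b x) = zc β M x * Complex.exp (lam M b x) := by
  unfold zc
  rw [mon_expMap, ← mul_assoc, mul_inv, Complex.exp_neg, inv_inv, neg_mul]

/-- A parabolic map in exponential form near the origin, together with all the constants that
enter in the construction of its attracting domains and of its Fatou coordinates. -/
structure Petal (n : ℕ) where
  (M m : Fin n → ℕ)
  d : ℕ
  β : ℂ
  α : Fin n → ℂ
  b : Fin n → (Fin n → ℂ) → ℂ
  (g h : (Fin n → ℂ) → (Fin n → ℂ))
  P : (Fin n → ℂ) × ℂ → ℂ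
  (ε A B κ δ η C : ℝ)
  (N K : ℕ)
  d_pos : 0 < d
  M_eq : ∀ i, M i = d * m i
  β_ne : β ≠ 0
  sum_α : pairing α M = 1
  ε_pos : 0 < ε
  B_nonneg : 0 ≤ B
  κ_pos : 0 < κ
  κ_le : κ ≤ 1
  δ_pos : 0 < δ
  δ_le : ∀ i, δ ≤ (α i).re
  η_pos : 0 < η
  η_le : η ≤ κ / 4
  -- `η` is the relative error of the first-order expansions. This bound and the next keep the
  -- accumulated errors below the margins provided by `turn` and `sector`.
  η_le_turn : η * (1 + 6 * B) ≤ A / 2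
  η_le_sector : η * (1 + δ) ≤ A / 4
  C_nonneg : 0 ≤ C
  -- Turns ‖x‖^N into |Z|^(-(1+2δ)): one δ is spent on the powers of log Z, the other ensures
  -- summability.
  N_ge : 1 + 2 * δ ≤ N * δ
  -- `turn` makes log|x_i| + B(arg Z)²/2 decrease over the wide sector; `sector` makes |x_i| |Z|^δ
  -- decrease over the narrow one.
  turn : ∀ i θ, |θ| ≤ Real.pi → 0 < Real.cos θ + |Real.sin θ| →
    A / 2 ≤ (α i).re * Real.cos θ + (α i).im * Real.sin θ + B * (θ * Real.sin θ)
  sector : ∀ i c s, 0 ≤ c → |s| ≤ κ * c → c ^ 2 + s ^ 2 = 1 →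
    A / 4 ≤ ((α i).re - δ) * c + (α i).im * s
  diff_P : Differentiable ℂ P
  diff_b : ∀ x, ‖x‖ < ε → ∀ i, DifferentiableAt ℂ (b i) x
  g_eq : ∀ x, ‖x‖ < ε → g x = expMap M b x
  h_g : ∀ x, ‖x‖ < ε → h (g x) = x
  h_near : ∀ x, ‖x‖ < ε → ∀ᶠ z in 𝓝 (g x), DifferentiableAt ℂ h z ∧ g (h z) = z
  norm_b_sub : ∀ x, ‖x‖ < ε → ∀ i, ‖b i x - β * α i‖ ≤ C * ‖x‖
  norm_lam_sub : ∀ x, ‖x‖ < ε → mon M x ≠ 0 → ‖lam M b x - (zc β M x)⁻¹‖ ≤ η * ‖zc β M x‖⁻¹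
  norm_mon_mul_b : ∀ x, ‖x‖ < ε → mon M x ≠ 0 → ∀ i,
    ‖mon M x * b i x + α i * (zc β M x)⁻¹‖ ≤ η * ‖zc β M x‖⁻¹
  norm_zc_sub : ∀ x, ‖x‖ < ε → mon M x ≠ 0 →
    ‖zc β M x * Complex.exp (lam M b x) - (zc β M x + 1)‖ ≤ η
  norm_zc_inv : ∀ x, ‖x‖ < ε → mon M x ≠ 0 → ‖zc β M x‖⁻¹ ≤ η
  norm_P : ∀ x, ‖x‖ < ε → ∀ l, ‖P (x, l)‖ ≤ C * ‖x‖ * (1 + ‖l‖) ^ K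
  norm_abel : ∀ x, ‖x‖ < ε → mon M x ≠ 0 → ∀ l,
    ‖zc β M (expMap M b x) * (1 + P (expMap M b x, l + lam M b x)) - zc β M x * (1 + P (x, l)) - 1‖
      ≤ C * ‖x‖ ^ N * (1 + ‖l‖) ^ K

/-! ### The attracting domains: invariance and openness -/

namespace Petal

variable {n : ℕ} (D : Petal n)

/-- The approximate Fatou coordinate. -/
noncomputable def Z (x : Fin n → ℂ) : ℂ := zc D.β D.M x

/-- The logarithm of the approximate Fatou coordinate. -/
noncomputable def L (x : Fin n → ℂ) : ℂ := Complex.log (D.Z x)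

/-- The attracting domain attached to a `d`-th root `ω` of `-β`. -/
def Ω (ω : ℂ) : Set (Fin n → ℂ) :=
  {x | mon D.M x ≠ 0 ∧ 0 < (D.Z x).re + |(D.Z x).im| ∧
    -- The weight replaces the plain bound ‖x i‖ < ε, which need not be invariant where Re Z is not
    -- dominant. The last condition selects one of the d values of the root of unity ω x^m Z^(1/d).
    (∀ i, ‖x i‖ * Real.exp (D.B * (D.Z x).arg ^ 2 / 2) < D.ε) ∧
    ω * mon D.m x * Complex.exp (D.L x / D.d) = 1}

theorem Z_ne {x : Fin n → ℂ} (hx : mon D.M x ≠ 0) : D.Z x ≠ 0 :=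
  neg_ne_zero.2 (inv_ne_zero (mul_ne_zero D.β_ne hx))

theorem mon_eq {x : Fin n → ℂ} : mon D.M x = -(D.β * D.Z x)⁻¹ := by
  unfold Z zc
  have := D.β_ne
  rw [mul_neg, mul_inv, inv_neg, neg_neg, mul_inv, mul_inv, inv_inv, inv_inv,
    inv_mul_cancel_left₀ this]

theorem differentiableAt_Z {x : Fin n → ℂ} (hx : mon D.M x ≠ 0) : DifferentiableAt ℂ D.Z x := by
  unfold Z zc
  refine DifferentiableAt.neg (DifferentiableAt.inv ?_ (mul_ne_zero D.β_ne hx))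
  exact (differentiable_mon D.M x).const_mul _

variable {D} {ω : ℂ} {x : Fin n → ℂ}

theorem mem_slitPlane_of_pos {z : ℂ} (hz : 0 < z.re + |z.im|) : z ∈ Complex.slitPlane := by
  rw [Complex.mem_slitPlane_iff]
  by_contra! h
  rw [h.2, abs_zero, add_zero] at hz
  linarith [h.1]

theorem Z_mem_slitPlane (hx : x ∈ D.Ω ω) : D.Z x ∈ Complex.slitPlane :=
  mem_slitPlane_of_pos hx.2.1

theorem differentiableAt_L (hx : x ∈ D.Ω ω) : DifferentiableAt ℂ D.L x :=
  (D.differentiableAt_Z hx.1).clog (Z_mem_slitPlane hx)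

theorem norm_apply_lt (hx : x ∈ D.Ω ω) (i : Fin n) : ‖x i‖ < D.ε := by
  refine lt_of_le_of_lt ?_ (hx.2.2.1 i)
  refine le_mul_of_one_le_right (norm_nonneg _) (Real.one_le_exp ?_)
  have := D.B_nonneg
  positivity

theorem norm_lt (hx : x ∈ D.Ω ω) : ‖x‖ < D.ε := by
  rw [pi_norm_lt_iff D.ε_pos]
  exact norm_apply_lt hx

theorem one_le_norm_Z (hx : x ∈ D.Ω ω) : 4 ≤ ‖D.Z x‖ := by
  have h1 := D.norm_zc_inv x (norm_lt hx) hx.1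
  have h2 : D.η ≤ 1 / 4 := by linarith [D.η_le, D.κ_le]
  have h3 : 0 < ‖D.Z x‖ := norm_pos_iff.2 (D.Z_ne hx.1)
  have h4 : ‖D.Z x‖⁻¹ ≤ 1 / 4 := h1.trans h2
  rw [inv_le_comm₀ h3 (by norm_num)] at h4
  linarith

theorem g_eq' (hx : x ∈ D.Ω ω) : D.g x = expMap D.M D.b x := D.g_eq x (norm_lt hx)

theorem Z_g (hx : x ∈ D.Ω ω) : D.Z (D.g x) = D.Z x * Complex.exp (lam D.M D.b x) := by
  rw [g_eq' hx]
  exact zc_expMap _ _ _ _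

theorem norm_Z_g_sub (hx : x ∈ D.Ω ω) : ‖D.Z (D.g x) - (D.Z x + 1)‖ ≤ D.η := by
  rw [Z_g hx]
  exact D.norm_zc_sub x (norm_lt hx) hx.1

theorem norm_lam_le (hx : x ∈ D.Ω ω) : ‖lam D.M D.b x‖ ≤ 2 * ‖D.Z x‖⁻¹ := by
  have h1 := D.norm_lam_sub x (norm_lt hx) hx.1
  have h2 : ‖lam D.M D.b x‖ ≤ ‖lam D.M D.b x - (D.Z x)⁻¹‖ + ‖(D.Z x)⁻¹‖ := by
    simpa using norm_add_le (lam D.M D.b x - (D.Z x)⁻¹) (D.Z x)⁻¹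
  have h3 : D.η ≤ 1 := by linarith [D.η_le, D.κ_le]
  have h4 : 0 ≤ ‖D.Z x‖⁻¹ := by positivity
  have h5 : D.η * ‖D.Z x‖⁻¹ ≤ 1 * ‖D.Z x‖⁻¹ := by gcongr
  rw [norm_inv] at h2
  unfold Z at *
  linarith

/-- No branch of the logarithm is crossed: |arg Z| < 3π/4 and |Im λ| ≤ 1/2 < π/4. -/
theorem L_g (hx : x ∈ D.Ω ω) : D.L (D.g x) = D.L x + lam D.M D.b x := by
  unfold L
  rw [Z_g hx]
  have h1 := abs_arg_lt_of_pos hx.2.1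
  have h2 := norm_lam_le hx
  have h3 := one_le_norm_Z hx
  have h4 : |(lam D.M D.b x).im| ≤ 1 / 2 := by
    refine (Complex.abs_im_le_norm _).trans (h2.trans ?_)
    have : ‖D.Z x‖⁻¹ ≤ 1 / 4 := by
      rw [inv_le_comm₀ (by linarith) (by norm_num)]
      linarith
    linarith
  have hpi := Real.pi_gt_three
  rw [abs_lt] at h1
  rw [abs_le] at h4
  conv_lhs => rw [← Complex.exp_log (D.Z_ne hx.1), ← Complex.exp_add]
  rw [Complex.log_exp]
  · rw [Complex.add_im, Complex.log_im]
    linarith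
  · rw [Complex.add_im, Complex.log_im]
    linarith

theorem arg_g (hx : x ∈ D.Ω ω) :
    (D.Z (D.g x)).arg = (D.Z x).arg + (lam D.M D.b x).im := by
  have := congrArg Complex.im (L_g hx)
  rwa [Complex.add_im, L, L, Complex.log_im, Complex.log_im] at this

theorem g_apply (hx : x ∈ D.Ω ω) (i : Fin n) :
    D.g x i = x i * Complex.exp (mon D.M x * D.b i x) := by
  rw [g_eq' hx]
  rfl

theorem norm_g_apply (hx : x ∈ D.Ω ω) (i : Fin n) :
    ‖D.g x i‖ = ‖x i‖ * Real.exp (mon D.M x * D.b i x).re := by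
  rw [g_apply hx, norm_mul, Complex.norm_exp]

theorem mon_mul_b_re_le (hx : x ∈ D.Ω ω) (i : Fin n) :
    (mon D.M x * D.b i x).re ≤ ‖D.Z x‖⁻¹ * (D.η -
      ((D.α i).re * Real.cos (D.Z x).arg + (D.α i).im * Real.sin (D.Z x).arg)) := by
  have h1 := (Complex.re_le_norm _).trans (D.norm_mon_mul_b x (norm_lt hx) hx.1 i)
  rw [Complex.add_re, Complex.mul_re (D.α i), inv_re_eq, inv_im_eq] at h1
  unfold Z
  linarith

theorem abs_lam_im_add_le (hx : x ∈ D.Ω ω) :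
    |(lam D.M D.b x).im + ‖D.Z x‖⁻¹ * Real.sin (D.Z x).arg| ≤ D.η * ‖D.Z x‖⁻¹ := by
  have h1 := (Complex.abs_im_le_norm _).trans (D.norm_lam_sub x (norm_lt hx) hx.1)
  rw [Complex.sub_im, inv_im_eq, sub_neg_eq_add] at h1
  exact h1

theorem abs_lam_re_sub_le (hx : x ∈ D.Ω ω) :
    |(lam D.M D.b x).re - ‖D.Z x‖⁻¹ * Real.cos (D.Z x).arg| ≤ D.η * ‖D.Z x‖⁻¹ := by
  have h1 := (Complex.abs_re_le_norm _).trans (D.norm_lam_sub x (norm_lt hx) hx.1)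
  rw [Complex.sub_re, inv_re_eq] at h1
  exact h1

theorem cos_add_abs_sin_pos {z : ℂ} (hz : 0 < z.re + |z.im|) :
    0 < Real.cos z.arg + |Real.sin z.arg| := by
  have h0 : z ≠ 0 := by
    rintro rfl
    simp at hz
  have h1 : 0 < ‖z‖ := norm_pos_iff.2 h0
  rw [← Complex.norm_mul_cos_arg, ← Complex.norm_mul_sin_arg, abs_mul, abs_norm, ← mul_add] at hz
  exact (mul_pos_iff_of_pos_left h1).1 hz

/-- With ρ = 1/|Z| and θ = arg Z, to first order log|x_i| moves by -ρ(Re α_i cos θ + Im α_i sin θ)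
and θ by -ρ sin θ. The weight log|x_i| + Bθ²/2 thus moves by -ρ times the quantity bounded below in
`turn`, and the errors are at most ρη(1 + 6B). -/
theorem mon_mul_b_add_arg_le (hx : x ∈ D.Ω ω) (i : Fin n) :
    (mon D.M x * D.b i x).re + D.B * (D.Z (D.g x)).arg ^ 2 / 2 ≤ D.B * (D.Z x).arg ^ 2 / 2 := by
  have h1 := mon_mul_b_re_le hx i
  have h2 := abs_lam_im_add_le hx
  have h3 := D.turn i _ (Complex.abs_arg_le_pi _) (cos_add_abs_sin_pos hx.2.1)
  have h4 := abs_arg_lt_of_pos hx.2.1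
  have h5 := (Complex.abs_im_le_norm _).trans (norm_lam_le hx)
  have h6 := D.norm_zc_inv x (norm_lt hx) hx.1
  have hη := D.η_le_turn
  have hB := D.B_nonneg
  have hη0 := D.η_pos
  rw [arg_g hx]
  change ‖D.Z x‖⁻¹ ≤ D.η at h6
  have hρ : 0 ≤ ‖D.Z x‖⁻¹ := by positivity
  generalize ‖D.Z x‖⁻¹ = ρ at *
  generalize (D.Z x).arg = θ at *
  generalize (lam D.M D.b x).im = ι at *
  generalize (mon D.M x * D.b i x).re = r at *
  generalize Real.sin θ = s at *
  generalize Real.cos θ = c at *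
  have hθ : |θ| ≤ 4 := by linarith [Real.pi_lt_four]
  have hA : θ * ι ≤ -(ρ * (θ * s)) + 4 * (D.η * ρ) := by
    have : θ * (ι + ρ * s) ≤ |θ| * |ι + ρ * s| := by
      rw [← abs_mul]
      exact le_abs_self _
    have h7 : |θ| * |ι + ρ * s| ≤ 4 * (D.η * ρ) := by gcongr
    linarith
  have hC : ι ^ 2 ≤ 4 * (D.η * ρ) := by
    have : ι ^ 2 ≤ (2 * ρ) ^ 2 := by
      rw [← sq_abs]
      gcongr
    have h8 : ρ * ρ ≤ D.η * ρ := by gcongr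
    nlinarith
  have hD : D.B * (θ * ι + ι ^ 2 / 2) ≤ D.B * (-(ρ * (θ * s)) + 6 * (D.η * ρ)) :=
    mul_le_mul_of_nonneg_left (by linarith) hB
  have hE : ρ * (D.A / 2) ≤
      ρ * ((D.α i).re * c + (D.α i).im * s + D.B * (θ * s)) := by gcongr
  have hF : ρ * (D.η * (1 + 6 * D.B)) ≤ ρ * (D.A / 2) := by gcongr
  nlinarith

theorem mapsTo_Ω : MapsTo D.g (D.Ω ω) (D.Ω ω) := by
  intro x hx
  refine ⟨?_, ?_, fun i => ?_, ?_⟩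
  · rw [g_eq' hx, mon_expMap]
    exact mul_ne_zero hx.1 (Complex.exp_ne_zero _)
  -- Re Z grows by at least 3/4 and |Im Z| drops by at most 1/4.
  · have h1 := norm_Z_g_sub hx
    have h2 := (Complex.abs_re_le_norm _).trans h1
    have h3 := (Complex.abs_im_le_norm _).trans h1
    have h4 : D.η ≤ 1 / 4 := by linarith [D.η_le, D.κ_le]
    have h5 := hx.2.1
    simp only [Complex.sub_re, Complex.sub_im, Complex.add_re, Complex.add_im, Complex.one_re,
      Complex.one_im, add_zero] at h2 h3
    have h6 := abs_sub_abs_le_abs_sub (D.Z x).im (D.Z (D.g x)).im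
    rw [abs_sub_comm] at h6
    rw [abs_le] at h2
    linarith
  · refine lt_of_le_of_lt ?_ (hx.2.2.1 i)
    rw [norm_g_apply hx, mul_assoc, ← Real.exp_add]
    gcongr
    exact mon_mul_b_add_arg_le hx i
  -- The branch condition is exactly preserved: x^m gains exp(x^M⟨b,m⟩), exp(L/d) gains exp(λ/d),
  -- and λ = -d x^M⟨b,m⟩.
  · rw [L_g hx, ← hx.2.2.2]
    have h1 : mon D.m (D.g x)
        = mon D.m x * Complex.exp (mon D.M x * pairing (fun i => D.b i x) D.m) := by
      rw [g_eq' hx]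
      unfold expMap
      rw [mon_mul_exp, pairing_mul_left]
    have h2 : pairing (fun i => D.b i x) D.M = D.d * pairing (fun i => D.b i x) D.m := by
      unfold pairing
      rw [Finset.mul_sum]
      refine Finset.sum_congr rfl fun i _ => ?_
      rw [D.M_eq]
      push_cast
      ring
    have h3 : (D.d : ℂ) ≠ 0 := Nat.cast_ne_zero.2 D.d_pos.ne'
    rw [h1, lam, h2, ← mul_assoc, mul_assoc _ (Complex.exp _), ← Complex.exp_add]
    congr 2
    field_simp
    ring

theorem iterate_mem (hx : x ∈ D.Ω ω) (j : ℕ) : D.g^[j] x ∈ D.Ω ω := mapsTo_Ω.iterate j hx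

theorem differentiableAt_mon_mul_b (hx : x ∈ D.Ω ω) (i : Fin n) :
    DifferentiableAt ℂ (fun y => mon D.M y * D.b i y) x :=
  (differentiable_mon D.M x).mul (D.diff_b x (norm_lt hx) i)

theorem differentiableAt_lam (hx : x ∈ D.Ω ω) : DifferentiableAt ℂ (lam D.M D.b) x := by
  unfold lam pairing
  refine ((differentiable_mon D.M x).mul (DifferentiableAt.fun_sum fun i _ => ?_)).neg
  exact (D.diff_b x (norm_lt hx) i).mul_const _

theorem differentiableAt_g (hx : x ∈ D.Ω ω) : DifferentiableAt ℂ D.g x := by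
  have h1 : D.g =ᶠ[𝓝 x] expMap D.M D.b := by
    filter_upwards [(isOpen_lt continuous_norm continuous_const).mem_nhds (norm_lt hx)] with y hy
    exact D.g_eq y hy
  refine h1.differentiableAt_iff.2 ?_
  rw [differentiableAt_pi]
  intro i
  exact (by fun_prop : DifferentiableAt ℂ (fun y : Fin n → ℂ => y i) x).mul
    (differentiableAt_mon_mul_b hx i).cexp

theorem differentiableAt_iterate (hx : x ∈ D.Ω ω) (j : ℕ) : DifferentiableAt ℂ (D.g^[j]) x := by
  induction j with
  | zero => exact differentiableAt_id
  | succ j ih =>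
    rw [Function.iterate_succ']
    exact (differentiableAt_g (iterate_mem hx j)).comp x ih

/-- Since -β x^M Z = 1, the branch condition compares two d-th roots of unity. It is therefore a
discrete choice, hence an open condition. -/
theorem root_pow (hω : ω ^ D.d = -D.β) (hx : mon D.M x ≠ 0) :
    (ω * mon D.m x * Complex.exp (D.L x / D.d)) ^ D.d = 1 := by
  have h3 : (D.d : ℂ) ≠ 0 := Nat.cast_ne_zero.2 D.d_pos.ne'
  rw [mul_pow, mul_pow, hω, ← Complex.exp_nat_mul, mul_div_cancel₀ _ h3, ← mon_mul_pow D.M_eq, L,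
    Complex.exp_log (D.Z_ne hx), Z, zc, neg_mul, neg_mul_neg,
    mul_inv_cancel₀ (mul_ne_zero D.β_ne hx)]

theorem isOpen_Ω (hω : ω ^ D.d = -D.β) : IsOpen (D.Ω ω) := by
  rw [isOpen_iff_mem_nhds]
  intro x hx
  have hmon : ContinuousAt (mon D.M) x := (differentiable_mon D.M x).continuousAt
  have hmon' : ContinuousAt (mon D.m) x := (differentiable_mon D.m x).continuousAt
  have hZ : ContinuousAt D.Z x := (D.differentiableAt_Z hx.1).continuousAt
  have hL : ContinuousAt D.L x := (differentiableAt_L hx).continuousAt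
  have harg : ContinuousAt (fun y => (D.Z y).arg) x :=
    (Complex.continuousAt_arg (Z_mem_slitPlane hx)).comp hZ
  have e1 : ∀ᶠ y in 𝓝 x, mon D.M y ≠ 0 := hmon.eventually_ne hx.1
  have e2 : ∀ᶠ y in 𝓝 x, 0 < (D.Z y).re + |(D.Z y).im| :=
    continuousAt_const.eventually_lt ((Complex.continuous_re.continuousAt.comp hZ).add
      (Complex.continuous_im.continuousAt.comp hZ).abs) hx.2.1
  have e3 : ∀ᶠ y in 𝓝 x, ∀ i, ‖y i‖ * Real.exp (D.B * (D.Z y).arg ^ 2 / 2) < D.ε := by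
    rw [eventually_all]
    intro i
    have : ContinuousAt (fun y : Fin n → ℂ => ‖y i‖ * Real.exp (D.B * (D.Z y).arg ^ 2 / 2)) x := by
      refine ContinuousAt.mul (continuous_apply i).norm.continuousAt
        (Real.continuous_exp.continuousAt.comp ?_)
      exact ((harg.pow 2).const_mul _).div_const _
    exact this.eventually_lt continuousAt_const (hx.2.2.1 i)
  have hcont : ContinuousAt (fun y => ω * mon D.m y * Complex.exp (D.L y / D.d)) x := by
    fun_prop
  have hfin : {c : ℂ | c ^ D.d = 1 ∧ c ≠ 1}.Finite := by
    refine (Polynomial.nthRootsFinset D.d (1 : ℂ)).finite_toSet.subset fun c hc => ?_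
    rw [Finset.mem_coe, Polynomial.mem_nthRootsFinset D.d_pos]
    exact hc.1
  have e4 : ∀ᶠ y in 𝓝 x, ω * mon D.m y * Complex.exp (D.L y / D.d) ∉
      {c : ℂ | c ^ D.d = 1 ∧ c ≠ 1} := by
    refine hcont.eventually (hfin.isClosed.isOpen_compl.mem_nhds ?_)
    simp [hx.2.2.2]
  filter_upwards [e1, e2, e3, e4] with y h1 h2 h3 h4
  refine ⟨h1, h2, h3, ?_⟩
  by_contra hne
  exact h4 ⟨root_pow hω h1, hne⟩

end Petal

/-! ### The narrow sector, decay of orbits and convergence to the origin -/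

namespace Petal

variable {n : ℕ} (D : Petal n)

/-- The part of an attracting domain lying over a narrow sector around the positive axis. -/
def G (ω : ℂ) : Set (Fin n → ℂ) := {x | x ∈ D.Ω ω ∧ |(D.Z x).im| < D.κ * (D.Z x).re}

/-- The size of `x` relative to `‖Z‖ ^ (-δ)`. -/
noncomputable def H (x : Fin n → ℂ) : ℝ := ‖x‖ * ‖D.Z x‖ ^ D.δ

/-- The sum of a function along an orbit. -/
noncomputable def S (q : (Fin n → ℂ) → ℂ) (x : Fin n → ℂ) : ℂ := ∑' j, q (D.g^[j] x)

theorem H_nonneg (x : Fin n → ℂ) : 0 ≤ D.H x :=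
  mul_nonneg (norm_nonneg _) (Real.rpow_nonneg (norm_nonneg _) _)

variable {D} {ω : ℂ} {x : Fin n → ℂ}

theorem isOpen_G (hω : ω ^ D.d = -D.β) : IsOpen (D.G ω) := by
  rw [isOpen_iff_mem_nhds]
  intro x hx
  have hZ : ContinuousAt D.Z x := (D.differentiableAt_Z hx.1.1).continuousAt
  have h1 : ContinuousAt (fun y => |(D.Z y).im|) x :=
    (Complex.continuous_im.continuousAt.comp hZ).abs
  have h2 : ContinuousAt (fun y => D.κ * (D.Z y).re) x :=
    (Complex.continuous_re.continuousAt.comp hZ).const_mul _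
  filter_upwards [(isOpen_Ω hω).mem_nhds hx.1, h1.eventually_lt h2 hx.2] with y hy1 hy2
  exact ⟨hy1, hy2⟩

theorem re_Z_g (hx : x ∈ D.Ω ω) : (D.Z x).re + 3 / 4 ≤ (D.Z (D.g x)).re := by
  have h2 := (Complex.abs_re_le_norm _).trans (norm_Z_g_sub hx)
  rw [Complex.sub_re, Complex.add_re, Complex.one_re, abs_le] at h2
  linarith [D.η_le, D.κ_le]

theorem abs_im_Z_g (hx : x ∈ D.Ω ω) : |(D.Z (D.g x)).im| ≤ |(D.Z x).im| + D.η := by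
  have h2 := (Complex.abs_im_le_norm _).trans (norm_Z_g_sub hx)
  rw [Complex.sub_im, Complex.add_im, Complex.one_im, add_zero] at h2
  linarith [abs_sub_abs_le_abs_sub (D.Z (D.g x)).im (D.Z x).im]

theorem re_Z_iterate (hx : x ∈ D.Ω ω) (j : ℕ) :
    (D.Z x).re + 3 / 4 * j ≤ (D.Z (D.g^[j] x)).re := by
  induction j with
  | zero => simp
  | succ j ih =>
    rw [Function.iterate_succ_apply']
    have := re_Z_g (iterate_mem hx j)
    push_cast
    linarith

theorem abs_im_Z_iterate (hx : x ∈ D.Ω ω) (j : ℕ) :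
    |(D.Z (D.g^[j] x)).im| ≤ |(D.Z x).im| + j * D.η := by
  induction j with
  | zero => simp
  | succ j ih =>
    rw [Function.iterate_succ_apply']
    have := abs_im_Z_g (iterate_mem hx j)
    push_cast
    linarith

/-- One step raises κ Re Z by at least 3κ/4 and |Im Z| by at most η ≤ κ/4. -/
theorem mapsTo_G : MapsTo D.g (D.G ω) (D.G ω) := by
  intro x hx
  refine ⟨mapsTo_Ω hx.1, ?_⟩
  have h1 := re_Z_g hx.1
  have h2 := abs_im_Z_g hx.1
  have h3 := hx.2
  have h4 : D.κ * ((D.Z x).re + 3 / 4) ≤ D.κ * (D.Z (D.g x)).re :=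
    mul_le_mul_of_nonneg_left h1 D.κ_pos.le
  linarith [D.η_le, D.κ_pos]

theorem iterate_mem_G (hx : x ∈ D.G ω) (j : ℕ) : D.g^[j] x ∈ D.G ω := mapsTo_G.iterate j hx

theorem exists_iterate_mem_G (hx : x ∈ D.Ω ω) : ∃ J, D.g^[J] x ∈ D.G ω := by
  -- Each iteration increases κ Re Z - |Im Z| by at least 3κ/4 - κ/4 = κ/2.
  obtain ⟨J, hJ⟩ := exists_nat_gt ((|(D.Z x).im| - D.κ * (D.Z x).re) / (D.κ / 2))
  have hκ := D.κ_pos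
  rw [div_lt_iff₀ (by linarith)] at hJ
  refine ⟨J, iterate_mem hx J, ?_⟩
  have h1 := mul_le_mul_of_nonneg_left (re_Z_iterate hx J) hκ.le
  have h2 := abs_im_Z_iterate hx J
  have h3 : (J : ℝ) * D.η ≤ J * (D.κ / 4) := by
    gcongr
    exact D.η_le
  linarith

theorem two_le_re_Z (hx : x ∈ D.G ω) : 2 ≤ (D.Z x).re := by
  have h1 := one_le_norm_Z hx.1
  have h2 := Complex.norm_le_abs_re_add_abs_im (D.Z x)
  have h3 := hx.2
  have h4 : 0 < (D.Z x).re := pos_of_mul_pos_right ((abs_nonneg _).trans_lt h3) D.κ_pos.le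
  rw [abs_of_pos h4] at h2
  have h5 : D.κ * (D.Z x).re ≤ 1 * (D.Z x).re := mul_le_mul_of_nonneg_right D.κ_le h4.le
  linarith

theorem norm_Z_g (hx : x ∈ D.Ω ω) :
    ‖D.Z (D.g x)‖ = ‖D.Z x‖ * Real.exp (lam D.M D.b x).re := by
  rw [Z_g hx, norm_mul, Complex.norm_exp]

/-- The left side is the increment of log(|x_i| |Z|^δ). With ρ = 1/|Z|, c = cos arg Z and s = sin
arg Z it is at most -ρ((Re α_i - δ)c + Im α_i s) + ρη(1 + δ), which `sector` makes nonpositive. -/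
theorem mon_mul_b_re_add_lam_re_le (hx : x ∈ D.G ω) (i : Fin n) :
    (mon D.M x * D.b i x).re + (lam D.M D.b x).re * D.δ ≤ 0 := by
  have h1 := mon_mul_b_re_le hx.1 i
  have h2 := abs_lam_re_sub_le hx.1
  have hZ0 : D.Z x ≠ 0 := D.Z_ne hx.1.1
  have hZ : 0 < ‖D.Z x‖ := norm_pos_iff.2 hZ0
  have h3 := hx.2
  have h4 := two_le_re_Z hx
  rw [← Complex.norm_mul_cos_arg] at h4
  rw [← Complex.norm_mul_cos_arg, ← Complex.norm_mul_sin_arg, abs_mul, abs_norm,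
    mul_left_comm, mul_lt_mul_iff_right₀ hZ] at h3
  have hc : 0 ≤ Real.cos (D.Z x).arg := by
    by_contra! hneg
    have := mul_neg_of_pos_of_neg hZ hneg
    linarith
  have h5 := D.sector i _ _ hc h3.le (Real.cos_sq_add_sin_sq _)
  have hρ : 0 ≤ ‖D.Z x‖⁻¹ := by positivity
  have hη := D.η_le_sector
  have hδ := D.δ_pos
  generalize ‖D.Z x‖⁻¹ = ρ at *
  generalize Real.cos (D.Z x).arg = c at *
  generalize Real.sin (D.Z x).arg = s at *
  have h6 : (lam D.M D.b x).re * D.δ ≤ (ρ * c + D.η * ρ) * D.δ := by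
    refine mul_le_mul_of_nonneg_right ?_ hδ.le
    rw [abs_le] at h2
    linarith
  have h7 := mul_le_mul_of_nonneg_left (hη.trans h5) hρ
  nlinarith

theorem H_g_le (hx : x ∈ D.G ω) : D.H (D.g x) ≤ D.H x := by
  unfold H
  have hp : 0 < ‖D.Z x‖ ^ D.δ := Real.rpow_pos_of_pos (norm_pos_iff.2 (D.Z_ne hx.1.1)) _
  rw [norm_Z_g hx.1, Real.mul_rpow (norm_nonneg _) (Real.exp_pos _).le, ← Real.exp_mul]
  have h1 : ‖D.g x‖ ≤ ‖x‖ * Real.exp (-((lam D.M D.b x).re * D.δ)) := by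
    rw [pi_norm_le_iff_of_nonneg (by positivity)]
    intro i
    rw [norm_g_apply hx.1]
    gcongr
    · exact norm_le_pi_norm x i
    · linarith [mon_mul_b_re_add_lam_re_le hx i]
  calc ‖D.g x‖ * (‖D.Z x‖ ^ D.δ * Real.exp ((lam D.M D.b x).re * D.δ))
      ≤ ‖x‖ * Real.exp (-((lam D.M D.b x).re * D.δ)) *
        (‖D.Z x‖ ^ D.δ * Real.exp ((lam D.M D.b x).re * D.δ)) := by gcongr
    _ = ‖x‖ * ‖D.Z x‖ ^ D.δ := by
        rw [Real.exp_neg]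
        field_simp

theorem H_iterate_le (hx : x ∈ D.G ω) (j : ℕ) : D.H (D.g^[j] x) ≤ D.H x := by
  induction j with
  | zero => exact le_rfl
  | succ j ih =>
    rw [Function.iterate_succ_apply']
    exact (H_g_le (iterate_mem_G hx j)).trans ih

theorem norm_eq_H_mul (hx : mon D.M x ≠ 0) : ‖x‖ = D.H x * ‖D.Z x‖ ^ (-D.δ) := by
  have hp : 0 < ‖D.Z x‖ := norm_pos_iff.2 (D.Z_ne hx)
  unfold H
  rw [mul_assoc, ← Real.rpow_add hp, add_neg_cancel, Real.rpow_zero, mul_one]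

theorem continuousAt_H (hx : mon D.M x ≠ 0) : ContinuousAt D.H x := by
  unfold H
  have hZ : ContinuousAt D.Z x := (D.differentiableAt_Z hx).continuousAt
  exact continuous_norm.continuousAt.mul (hZ.norm.rpow_const (Or.inl
    (norm_ne_zero_iff.2 (D.Z_ne hx))))

theorem one_add_le_norm_Z (hx : x ∈ D.G ω) (j : ℕ) :
    (D.Z x).re + (j : ℝ) / 2 ≤ ‖D.Z (D.g^[j] x)‖ := by
  have h1 := re_Z_iterate hx.1 j
  have h2 := Complex.re_le_norm (D.Z (D.g^[j] x))
  have h3 : (0 : ℝ) ≤ j := Nat.cast_nonneg j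
  linarith

theorem norm_iterate_le (hx : x ∈ D.G ω) (j : ℕ) :
    ‖D.g^[j] x‖ ≤ D.H x * (1 + (j : ℝ) / 2) ^ (-D.δ) := by
  rw [norm_eq_H_mul (iterate_mem hx.1 j).1]
  have h1 := one_add_le_norm_Z hx j
  have h2 := two_le_re_Z hx
  have h3 : (0 : ℝ) ≤ j := Nat.cast_nonneg j
  have h4 : ‖D.Z (D.g^[j] x)‖ ^ (-D.δ) ≤ (1 + (j : ℝ) / 2) ^ (-D.δ) :=
    Real.rpow_le_rpow_of_nonpos (by positivity) (by linarith) (by linarith [D.δ_pos])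
  exact mul_le_mul (H_iterate_le hx j) h4 (Real.rpow_nonneg (norm_nonneg _) _) (D.H_nonneg x)

theorem continuousAt_iterate (hx : x ∈ D.Ω ω) (j : ℕ) : ContinuousAt (D.g^[j]) x :=
  (differentiableAt_iterate hx j).continuousAt

/-- The entrance time and the bound on `H` can be taken uniform near a given point; this is what
upgrades pointwise decay to uniform convergence on compact sets. -/
theorem eventually_iterate_mem_G (hω : ω ^ D.d = -D.β) (hx : x ∈ D.Ω ω) :
    ∃ J, ∀ᶠ y in 𝓝 x, D.g^[J] y ∈ D.G ω ∧ D.H (D.g^[J] y) < D.H (D.g^[J] x) + 1 := by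
  obtain ⟨J, hJ⟩ := exists_iterate_mem_G hx
  refine ⟨J, ?_⟩
  have h1 : ∀ᶠ z in 𝓝 (D.g^[J] x), z ∈ D.G ω ∧ D.H z < D.H (D.g^[J] x) + 1 :=
    ((isOpen_G hω).eventually_mem hJ).and
      ((continuousAt_H hJ.1.1).eventually_lt continuousAt_const (by simp))
  exact (continuousAt_iterate hx J).eventually h1

theorem tendsto_one_add_div_rpow :
    Tendsto (fun j : ℕ => (1 + (j : ℝ) / 2) ^ (-D.δ)) atTop (𝓝 0) := by
  refine (tendsto_rpow_neg_atTop D.δ_pos).comp ?_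
  refine tendsto_atTop_add_const_left _ _ ?_
  exact tendsto_natCast_atTop_atTop.atTop_div_const (by norm_num)

theorem tendsto_iterate_uniformly (hω : ω ^ D.d = -D.β) {Kc : Set (Fin n → ℂ)} (hK : Kc ⊆ D.Ω ω)
    (hc : IsCompact Kc) : TendstoUniformlyOn (fun j : ℕ => D.g^[j]) (fun _ => 0) atTop Kc := by
  refine (tendstoLocallyUniformlyOn_iff_forall_isCompact (isOpen_Ω hω)).1 ?_ Kc hK hc
  rw [Metric.tendstoLocallyUniformlyOn_iff]
  intro e he x hx
  obtain ⟨J, hJ⟩ := eventually_iterate_mem_G hω hx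
  refine ⟨_, mem_nhdsWithin_of_mem_nhds hJ, ?_⟩
  have h1 :
      Tendsto (fun j : ℕ => (D.H (D.g^[J] x) + 1) * (1 + (j : ℝ) / 2) ^ (-D.δ)) atTop (𝓝 0) := by
    simpa using tendsto_one_add_div_rpow.const_mul (D.H (D.g^[J] x) + 1)
  obtain ⟨j₀, hj₀⟩ := eventually_atTop.1 (h1.eventually_lt_const he)
  filter_upwards [eventually_ge_atTop (J + j₀)] with j hj y hy
  obtain ⟨k, rfl⟩ := Nat.exists_eq_add_of_le (le_trans (Nat.le_add_right J j₀) hj)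
  rw [dist_zero_left, add_comm, Function.iterate_add_apply]
  refine (norm_iterate_le hy.1 k).trans_lt (lt_of_le_of_lt ?_ (hj₀ k (by omega)))
  exact mul_le_mul_of_nonneg_right hy.2.le (Real.rpow_nonneg (by positivity) _)

/-! ### Sums of holomorphic functions along orbits -/

section Sums

/-- A holomorphic function on an attracting domain with a bound which makes it summable along
orbits. -/
structure IsSummand (D : Petal n) (ω : ℂ) (q : (Fin n → ℂ) → ℂ) (c : ℝ) (k : ℕ) : Prop where
  nonneg : 0 ≤ c
  diff : ∀ x ∈ D.Ω ω, DifferentiableAt ℂ q x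
  bound : ∀ x ∈ D.G ω, ‖q x‖ ≤ c * (1 + D.H x) ^ k * ‖D.Z x‖ ^ (-(1 + D.δ))

variable {q : (Fin n → ℂ) → ℂ} {c : ℝ} {k : ℕ}

theorem summable_majorant (D : Petal n) :
    Summable fun j : ℕ => (1 + (j : ℝ) / 2) ^ (-(1 + D.δ / 2)) := by
  have h1 :
      Summable fun j : ℕ => (2 : ℝ) ^ (1 + D.δ / 2) * ((j + 1 : ℕ) : ℝ) ^ (-(1 + D.δ / 2)) := by
    refine Summable.mul_left _ ?_
    exact (summable_nat_add_iff 1).2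
      (Real.summable_nat_rpow.2 (by linarith [D.δ_pos] : -(1 + D.δ / 2) < -1))
  refine Summable.of_nonneg_of_le (fun j => by positivity) (fun j => ?_) h1
  have h2 : (2 : ℝ) ^ (1 + D.δ / 2) * ((j + 1 : ℕ) : ℝ) ^ (-(1 + D.δ / 2))
      = (((j + 1 : ℕ) : ℝ) / 2) ^ (-(1 + D.δ / 2)) := by
    rw [Real.div_rpow (by positivity) (by norm_num), Real.rpow_neg (by norm_num : (0:ℝ) ≤ 2)]
    field_simp
  rw [h2]
  refine Real.rpow_le_rpow_of_nonpos (by positivity) ?_ (by linarith [D.δ_pos])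
  push_cast
  linarith

/-- The exponent 1 + δ is split: 1 + δ/2 is enough for summability in j, and the other δ/2 survives
as decay of the whole sum when Re Z tends to infinity. -/
theorem IsSummand.norm_iterate_le (hq : IsSummand D ω q c k) (hx : x ∈ D.G ω) (j : ℕ) :
    ‖q (D.g^[j] x)‖ ≤ c * (1 + D.H x) ^ k * (D.Z x).re ^ (-(D.δ / 2))
      * (1 + (j : ℝ) / 2) ^ (-(1 + D.δ / 2)) := by
  refine (hq.bound _ (iterate_mem_G hx j)).trans ?_
  have h0 := hq.nonneg
  have h1 := one_add_le_norm_Z hx j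
  have h2 := two_le_re_Z hx
  have h3 : (0 : ℝ) ≤ j := Nat.cast_nonneg j
  have hδ := D.δ_pos
  have hH := D.H_nonneg (D.g^[j] x)
  have hp : 0 < ‖D.Z (D.g^[j] x)‖ := by linarith
  have h4 : ‖D.Z (D.g^[j] x)‖ ^ (-(1 + D.δ))
      = ‖D.Z (D.g^[j] x)‖ ^ (-(D.δ / 2)) * ‖D.Z (D.g^[j] x)‖ ^ (-(1 + D.δ / 2)) := by
    rw [← Real.rpow_add hp]
    congr 1
    ring
  rw [h4, mul_assoc _ ((D.Z x).re ^ _)]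
  have h5 : ‖D.Z (D.g^[j] x)‖ ^ (-(D.δ / 2)) ≤ (D.Z x).re ^ (-(D.δ / 2)) :=
    Real.rpow_le_rpow_of_nonpos (by linarith) (by linarith) (by linarith)
  have h6 : ‖D.Z (D.g^[j] x)‖ ^ (-(1 + D.δ / 2)) ≤ (1 + (j : ℝ) / 2) ^ (-(1 + D.δ / 2)) :=
    Real.rpow_le_rpow_of_nonpos (by linarith) (by linarith) (by linarith)
  have h7 := H_iterate_le hx j
  have h8 : 0 ≤ (D.Z x).re ^ (-(D.δ / 2)) := Real.rpow_nonneg (by linarith) _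
  have h9 := D.H_nonneg x
  gcongr

theorem IsSummand.summable_of_mem_G (hq : IsSummand D ω q c k) (hx : x ∈ D.G ω) :
    Summable fun j => q (D.g^[j] x) :=
  Summable.of_norm_bounded ((summable_majorant D).mul_left _) (hq.norm_iterate_le hx)

theorem IsSummand.norm_S_le (hq : IsSummand D ω q c k) (hx : x ∈ D.G ω) :
    ‖D.S q x‖ ≤ c * (1 + D.H x) ^ k * (D.Z x).re ^ (-(D.δ / 2))
      * ∑' j : ℕ, (1 + (j : ℝ) / 2) ^ (-(1 + D.δ / 2)) := by
  rw [← tsum_mul_left]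
  exact tsum_of_norm_bounded ((summable_majorant D).mul_left _).hasSum (hq.norm_iterate_le hx)

theorem IsSummand.summable (hq : IsSummand D ω q c k) (hx : x ∈ D.Ω ω) :
    Summable fun j => q (D.g^[j] x) := by
  obtain ⟨J, hJ⟩ := exists_iterate_mem_G hx
  rw [← summable_nat_add_iff J]
  refine (hq.summable_of_mem_G hJ).congr fun j => ?_
  rw [Function.iterate_add_apply]

theorem IsSummand.S_eq_sum_add (hq : IsSummand D ω q c k) (hx : x ∈ D.Ω ω) (J : ℕ) :
    D.S q x = ∑ j ∈ Finset.range J, q (D.g^[j] x) + D.S q (D.g^[J] x) := by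
  unfold S
  rw [← (hq.summable hx).sum_add_tsum_nat_add J]
  simp only [Function.iterate_add_apply]

theorem IsSummand.S_eq (hq : IsSummand D ω q c k) (hx : x ∈ D.Ω ω) :
    D.S q x = q x + D.S q (D.g x) := by
  simpa using hq.S_eq_sum_add hx 1

theorem IsSummand.differentiableAt_S_of_mem_G (hω : ω ^ D.d = -D.β) (hq : IsSummand D ω q c k)
    (hx : x ∈ D.G ω) : DifferentiableAt ℂ (D.S q) x := by
  have h1 : ∀ᶠ y in 𝓝 x, y ∈ D.G ω ∧ D.H y < D.H x + 1 :=
    ((isOpen_G hω).eventually_mem hx).and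
      ((continuousAt_H hx.1.1).eventually_lt continuousAt_const (by simp))
  obtain ⟨r, hr, hball⟩ := Metric.eventually_nhds_iff_ball.1 h1
  unfold S
  refine differentiableAt_tsum_of_norm_le hr
    ((summable_majorant D).mul_left (c * (1 + (D.H x + 1)) ^ k * 1)) (fun j y hy => ?_)
    (fun j y hy => (hq.norm_iterate_le (hball y hy).1 j).trans ?_)
  · have hy' := (hball y hy).1.1
    exact ((hq.diff _ (iterate_mem hy' j)).comp y
      (differentiableAt_iterate hy' j)).differentiableWithinAt
  · have h0 := hq.nonneg
    have h2 := two_le_re_Z (hball y hy).1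
    have h3 := D.H_nonneg y
    have h4 := (hball y hy).2
    have h5 : (D.Z y).re ^ (-(D.δ / 2)) ≤ 1 :=
      Real.rpow_le_one_of_one_le_of_nonpos (by linarith) (by linarith [D.δ_pos])
    have h6 : (0 : ℝ) ≤ (1 + (j : ℝ) / 2) ^ (-(1 + D.δ / 2)) :=
      Real.rpow_nonneg (by positivity) _
    have h7 := D.H_nonneg x
    gcongr

/-- Locally the sum is a finite sum plus a tail that starts in the narrow sector. -/
theorem IsSummand.differentiableAt_S (hω : ω ^ D.d = -D.β) (hq : IsSummand D ω q c k)
    (hx : x ∈ D.Ω ω) : DifferentiableAt ℂ (D.S q) x := by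
  obtain ⟨J, hJ⟩ := exists_iterate_mem_G hx
  have h1 : D.S q =ᶠ[𝓝 x]
      fun y => ∑ j ∈ Finset.range J, q (D.g^[j] y) + D.S q (D.g^[J] y) := by
    filter_upwards [(isOpen_Ω hω).mem_nhds hx] with y hy
    exact hq.S_eq_sum_add hy J
  refine h1.differentiableAt_iff.2
    (DifferentiableAt.add (DifferentiableAt.fun_sum fun j _ => ?_) ?_)
  · exact (hq.diff _ (iterate_mem hx j)).comp x (differentiableAt_iterate hx j)
  · exact (hq.differentiableAt_S_of_mem_G hω hJ).comp x (differentiableAt_iterate hx J)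

end Sums

end Petal
-- Invariants and Fatou coordinate
namespace Petal

variable {n : ℕ} (D : Petal n)

/-- The increment along `g` of the logarithm of the approximate invariant `xᵢ Z ^ αᵢ`. -/
noncomputable def σ (i : Fin n) (x : Fin n → ℂ) : ℂ :=
  mon D.M x * D.b i x + D.α i * lam D.M D.b x

/-- The approximate invariants `xᵢ Z ^ αᵢ`. -/
noncomputable def w₀ (x : Fin n → ℂ) (i : Fin n) : ℂ := x i * Complex.exp (D.α i * D.L x)

/-- The invariants of `g`. -/
noncomputable def w (x : Fin n → ℂ) (i : Fin n) : ℂ := D.w₀ x i * Complex.exp (D.S (D.σ i) x)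

/-- The corrected approximate Fatou coordinate. -/
noncomputable def φ₀ (x : Fin n → ℂ) : ℂ := D.Z x * (1 + D.P (x, D.L x))

/-- The defect of the Abel equation for `φ₀`. -/
noncomputable def abelDefect (x : Fin n → ℂ) : ℂ := D.φ₀ (D.g x) - D.φ₀ x - 1

/-- The Fatou coordinate. -/
noncomputable def φ (x : Fin n → ℂ) : ℂ := D.φ₀ x + D.S D.abelDefect x

theorem exists_one_add_norm_log_pow_le {s : ℝ} (hs : 0 < s) (k : ℕ) :
    ∃ c : ℝ, 0 ≤ c ∧ ∀ z : ℂ, 1 ≤ ‖z‖ → (1 + ‖Complex.log z‖) ^ k ≤ c * ‖z‖ ^ s := by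
  -- Each of the k logarithms may cost |z|^t; the `+ 1` avoids dividing by zero when k = 0 and keeps
  -- t·k ≤ s.
  set t : ℝ := s / (k + 1) with ht
  have ht0 : 0 < t := by positivity
  have hpi := Real.pi_pos
  refine ⟨(1 + Real.pi + 1 / t) ^ k, by positivity, fun z hz => ?_⟩
  have h1 : ‖Complex.log z‖ ≤ Real.log ‖z‖ + Real.pi := by
    refine (Complex.norm_le_abs_re_add_abs_im _).trans ?_
    rw [Complex.log_re, Complex.log_im, abs_of_nonneg (Real.log_nonneg hz)]
    linarith [Complex.abs_arg_le_pi z]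
  have h2 : Real.log ‖z‖ ≤ ‖z‖ ^ t / t := Real.log_le_rpow_div (norm_nonneg _) ht0
  have h3 : 1 ≤ ‖z‖ ^ t := Real.one_le_rpow hz ht0.le
  have h4 : 1 + ‖Complex.log z‖ ≤ (1 + Real.pi + 1 / t) * ‖z‖ ^ t := by
    have h5 : 1 / t * ‖z‖ ^ t = ‖z‖ ^ t / t := by ring
    have h6 : (1 + Real.pi) * 1 ≤ (1 + Real.pi) * ‖z‖ ^ t := by gcongr
    rw [add_mul, h5]
    linarith
  calc (1 + ‖Complex.log z‖) ^ k ≤ ((1 + Real.pi + 1 / t) * ‖z‖ ^ t) ^ k := by gcongr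
    _ = (1 + Real.pi + 1 / t) ^ k * ‖z‖ ^ (t * k) := by
      rw [mul_pow, ← Real.rpow_natCast (‖z‖ ^ t), ← Real.rpow_mul (norm_nonneg _)]
    _ ≤ (1 + Real.pi + 1 / t) ^ k * ‖z‖ ^ s := by
      gcongr
      rw [ht, div_mul_eq_mul_div, div_le_iff₀ (by positivity)]
      gcongr
      linarith

variable {D} {ω : ℂ} {x : Fin n → ℂ}

theorem norm_mon : ‖mon D.M x‖ = ‖D.β‖⁻¹ * ‖D.Z x‖⁻¹ := by
  rw [D.mon_eq, norm_neg, norm_inv, norm_mul, mul_inv]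

/-- Substituting b = βα gives x^M β(α_i - α_i⟨α,M⟩) = 0, so only x^M·O(‖x‖) remains, which is
O(|Z|^(-1-δ)) in the narrow sector. -/
theorem isSummand_σ (i : Fin n) :
    IsSummand D ω (D.σ i) (‖D.β‖⁻¹ * (D.C * (1 + ‖D.α i‖ * ∑ j, (D.M j : ℝ)))) 1 := by
  have hC := D.C_nonneg
  refine ⟨by positivity, fun x hx => ?_, fun x hx => ?_⟩
  · exact (differentiableAt_mon_mul_b hx i).add ((differentiableAt_lam hx).const_mul _)
  · have hb := D.norm_b_sub x (norm_lt hx.1)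
    have hZ : 0 < ‖D.Z x‖ := norm_pos_iff.2 (D.Z_ne hx.1.1)
    have h1 : D.σ i x = mon D.M x * ((D.b i x - D.β * D.α i)
        - D.α i * ∑ j, (D.b j x - D.β * D.α j) * D.M j) := by
      have h2 : ∑ j, (D.b j x - D.β * D.α j) * D.M j
          = pairing (fun i => D.b i x) D.M - D.β * pairing D.α D.M := by
        unfold pairing
        rw [Finset.mul_sum, ← Finset.sum_sub_distrib]
        exact Finset.sum_congr rfl fun j _ => by ring
      rw [h2, D.sum_α, σ, lam]
      ring
    have h3 : ‖∑ j, (D.b j x - D.β * D.α j) * D.M j‖ ≤ D.C * ‖x‖ * ∑ j, (D.M j : ℝ) := by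
      rw [Finset.mul_sum]
      refine norm_sum_le_of_le _ fun j _ => ?_
      rw [norm_mul, Complex.norm_natCast]
      gcongr
      exact hb j
    have h4 : ‖(D.b i x - D.β * D.α i) - D.α i * ∑ j, (D.b j x - D.β * D.α j) * D.M j‖
        ≤ D.C * ‖x‖ * (1 + ‖D.α i‖ * ∑ j, (D.M j : ℝ)) := by
      refine (norm_sub_le _ _).trans ?_
      rw [norm_mul]
      have := mul_le_mul_of_nonneg_left h3 (norm_nonneg (D.α i))
      linarith [hb i]
    have h5 : ‖x‖ ≤ (1 + D.H x) * ‖D.Z x‖ ^ (-D.δ) := by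
      rw [norm_eq_H_mul hx.1.1]
      gcongr
      linarith
    rw [h1, norm_mul, norm_mon, pow_one, neg_add, Real.rpow_add hZ, Real.rpow_neg_one]
    calc ‖D.β‖⁻¹ * ‖D.Z x‖⁻¹ * _
        ≤ ‖D.β‖⁻¹ * ‖D.Z x‖⁻¹ * (D.C * ((1 + D.H x) * ‖D.Z x‖ ^ (-D.δ))
          * (1 + ‖D.α i‖ * ∑ j, (D.M j : ℝ))) := by
          refine mul_le_mul_of_nonneg_left (h4.trans ?_) (by positivity)
          gcongr
      _ = _ := by ring

theorem differentiableAt_φ₀ (hx : x ∈ D.Ω ω) : DifferentiableAt ℂ D.φ₀ x := by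
  unfold φ₀
  refine (D.differentiableAt_Z hx.1).mul (DifferentiableAt.const_add _ ?_)
  exact (D.diff_P _).comp x (differentiableAt_id.prodMk (differentiableAt_L hx))

theorem norm_abelDefect_le (hx : x ∈ D.Ω ω) :
    ‖D.abelDefect x‖ ≤ D.C * ‖x‖ ^ D.N * (1 + ‖D.L x‖) ^ D.K := by
  have := D.norm_abel x (norm_lt hx) hx.1 (D.L x)
  rw [← g_eq' hx, ← L_g hx] at this
  exact this

/-- The defect is O(‖x‖^N) up to powers of log Z; ‖x‖^N is at most a constant times |Z|^(-Nδ) and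
the logarithms cost at most |Z|^δ, which `N_ge` allows. -/
theorem exists_isSummand_abelDefect (D : Petal n) :
    ∃ c, ∀ ω, IsSummand D ω D.abelDefect c D.N := by
  obtain ⟨c, hc, hlog⟩ := exists_one_add_norm_log_pow_le D.δ_pos D.K
  have hC := D.C_nonneg
  refine ⟨D.C * c, fun ω => ⟨by positivity, fun x hx => ?_, fun x hx => ?_⟩⟩
  · exact (((differentiableAt_φ₀ (mapsTo_Ω hx)).comp x (differentiableAt_g hx)).sub
      (differentiableAt_φ₀ hx)).sub_const 1
  · have hZ1 := one_le_norm_Z hx.1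
    have hZ : 0 < ‖D.Z x‖ := by linarith
    have hH := D.H_nonneg x
    have h1 := hlog (D.Z x) (by linarith)
    refine (norm_abelDefect_le hx.1).trans ?_
    have h2 : ‖x‖ ^ D.N ≤ (1 + D.H x) ^ D.N * ‖D.Z x‖ ^ (-(D.N * D.δ)) := by
      have : ‖D.Z x‖ ^ (-(D.N * D.δ)) = (‖D.Z x‖ ^ (-D.δ)) ^ D.N := by
        rw [← Real.rpow_natCast, ← Real.rpow_mul hZ.le]
        congr 1
        ring
      rw [this, ← mul_pow, norm_eq_H_mul hx.1.1]
      gcongr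
      linarith
    calc D.C * ‖x‖ ^ D.N * (1 + ‖D.L x‖) ^ D.K
        ≤ D.C * ((1 + D.H x) ^ D.N * ‖D.Z x‖ ^ (-(D.N * D.δ))) * (c * ‖D.Z x‖ ^ D.δ) := by
          gcongr
          exact h1
      _ = D.C * c * (1 + D.H x) ^ D.N * ‖D.Z x‖ ^ (-(D.N * D.δ) + D.δ) := by
          rw [Real.rpow_add hZ]
          ring
      _ ≤ D.C * c * (1 + D.H x) ^ D.N * ‖D.Z x‖ ^ (-(1 + D.δ)) := by
          gcongr
          · linarith
          · linarith [D.N_ge]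

theorem φ_g (hx : x ∈ D.Ω ω) : D.φ (D.g x) = D.φ x + 1 := by
  obtain ⟨c, hc⟩ := D.exists_isSummand_abelDefect
  have h1 := (hc ω).S_eq hx
  unfold φ
  rw [h1, abelDefect]
  ring

theorem φ_iterate (hx : x ∈ D.Ω ω) (j : ℕ) : D.φ (D.g^[j] x) = D.φ x + j := by
  induction j with
  | zero => simp
  | succ j ih =>
    rw [Function.iterate_succ_apply', φ_g (iterate_mem hx j), ih]
    push_cast
    ring

theorem differentiableAt_φ (hω : ω ^ D.d = -D.β) (hx : x ∈ D.Ω ω) : DifferentiableAt ℂ D.φ x := by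
  obtain ⟨c, hc⟩ := D.exists_isSummand_abelDefect
  exact (differentiableAt_φ₀ hx).add ((hc ω).differentiableAt_S hω hx)

theorem w₀_g (hx : x ∈ D.Ω ω) (i : Fin n) :
    D.w₀ (D.g x) i = D.w₀ x i * Complex.exp (D.σ i x) := by
  unfold w₀ σ
  rw [g_apply hx, L_g hx, mul_assoc, mul_assoc, ← Complex.exp_add, ← Complex.exp_add]
  congr 2
  ring

theorem w_g (hx : x ∈ D.Ω ω) : D.w (D.g x) = D.w x := by
  ext i
  unfold w
  rw [w₀_g hx, (isSummand_σ i).S_eq hx, mul_assoc, ← Complex.exp_add]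

theorem w_iterate (hx : x ∈ D.Ω ω) (j : ℕ) : D.w (D.g^[j] x) = D.w x := by
  induction j with
  | zero => rfl
  | succ j ih => rw [Function.iterate_succ_apply', w_g (iterate_mem hx j), ih]

theorem differentiableAt_w (hω : ω ^ D.d = -D.β) (hx : x ∈ D.Ω ω) : DifferentiableAt ℂ D.w x := by
  rw [differentiableAt_pi]
  intro i
  refine DifferentiableAt.mul (DifferentiableAt.mul (by fun_prop) ?_) ?_
  · exact ((differentiableAt_L hx).const_mul _).cexp
  · exact ((isSummand_σ i).differentiableAt_S hω hx).cexp

theorem apply_ne_zero (hx : x ∈ D.Ω ω) {i : Fin n} (hi : D.m i ≠ 0) : x i ≠ 0 :=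
  mon_ne_zero_iff.1 hx.1 i (by rw [D.M_eq]; exact mul_ne_zero D.d_pos.ne' hi)

theorem w₀_ne_zero (hx : x ∈ D.Ω ω) {i : Fin n} (hi : D.m i ≠ 0) : D.w₀ x i ≠ 0 :=
  mul_ne_zero (apply_ne_zero hx hi) (Complex.exp_ne_zero _)

theorem w_ne_zero (hx : x ∈ D.Ω ω) {i : Fin n} (hi : D.m i ≠ 0) : D.w x i ≠ 0 :=
  mul_ne_zero (w₀_ne_zero hx hi) (Complex.exp_ne_zero _)

theorem d_mul_pairing (D : Petal n) (v : Fin n → ℂ) : D.d * pairing v D.m = pairing v D.M := by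
  unfold pairing
  rw [Finset.mul_sum]
  refine Finset.sum_congr rfl fun i _ => ?_
  rw [D.M_eq]
  push_cast
  ring

theorem pairing_α (D : Petal n) : pairing D.α D.m = (D.d : ℂ)⁻¹ := by
  have h := D.d_mul_pairing D.α
  rw [D.sum_α] at h
  exact eq_inv_of_mul_eq_one_right h

theorem pairing_mul_right (m : Fin n → ℕ) (v : Fin n → ℂ) (c : ℂ) :
    pairing (fun i => v i * c) m = pairing v m * c := by
  rw [mul_comm, ← pairing_mul_left]
  simp only [mul_comm]

/-- As ⟨α,m⟩ = 1/d, this is the branch condition defining `Ω`. The first coordinate of μ(w₀) is thus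
a constant, carries no information, and its slot is free for the Fatou coordinate. -/
theorem mon_w₀ (hx : x ∈ D.Ω ω) : mon D.m (D.w₀ x) = ω⁻¹ := by
  unfold w₀
  rw [mon_mul_exp, pairing_mul_right, pairing_α, inv_mul_eq_div]
  have := hx.2.2.2
  rw [mul_assoc] at this
  exact eq_inv_of_mul_eq_one_right this

/-- Asymptotics of the invariants and of the Fatou coordinate. -/
theorem exists_asymptotics (D : Petal n) (H₀ : ℝ) (hH₀ : 0 ≤ H₀) :
    ∃ T : ℝ, 0 ≤ T ∧ ∀ ω x, x ∈ D.G ω → D.H x ≤ H₀ →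
      (∀ i, ‖D.S (D.σ i) x‖ ≤ T * (D.Z x).re ^ (-(D.δ / 2))) ∧
      ‖D.φ x - D.Z x‖ ≤ T * ‖D.Z x‖ * (D.Z x).re ^ (-(D.δ / 2)) := by
  obtain ⟨c₁, hc₁⟩ := D.exists_isSummand_abelDefect
  obtain ⟨c₂, hc₂, hlog⟩ := exists_one_add_norm_log_pow_le (half_pos D.δ_pos) D.K
  have hc₁' : 0 ≤ c₁ := (hc₁ 0).nonneg
  have hC := D.C_nonneg
  have hδ := D.δ_pos
  set s₀ : ℝ := ∑' j : ℕ, (1 + (j : ℝ) / 2) ^ (-(1 + D.δ / 2)) with hs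
  have hs₀ : 0 ≤ s₀ := tsum_nonneg fun j => Real.rpow_nonneg (by positivity) _
  set a : Fin n → ℝ := fun i => ‖D.β‖⁻¹ * (D.C * (1 + ‖D.α i‖ * ∑ j, (D.M j : ℝ))) with ha
  have ha0 : ∀ i, 0 ≤ a i := fun i => (isSummand_σ (D := D) (ω := 0) i).nonneg
  refine ⟨(∑ i, a i) * (1 + H₀) * s₀ + (D.C * H₀ * c₂ + c₁ * (1 + H₀) ^ D.N * s₀), ?_, ?_⟩
  · have := Finset.sum_nonneg fun i (_ : i ∈ Finset.univ) => ha0 i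
    positivity
  intro ω x hx hH
  have hre := two_le_re_Z hx
  have hZ1 : 2 ≤ ‖D.Z x‖ := hre.trans (Complex.re_le_norm _)
  have hpos : 0 ≤ (D.Z x).re ^ (-(D.δ / 2)) := Real.rpow_nonneg (by linarith) _
  have hHx := D.H_nonneg x
  have hsum := Finset.sum_nonneg fun i (_ : i ∈ Finset.univ) => ha0 i
  have hR : 0 ≤ D.C * H₀ * c₂ + c₁ * (1 + H₀) ^ D.N * s₀ := by positivity
  have hL : 0 ≤ (∑ i, a i) * (1 + H₀) * s₀ := by positivity
  refine ⟨fun i => ?_, ?_⟩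
  · refine ((isSummand_σ i).norm_S_le hx).trans ?_
    have h1 : a i ≤ ∑ i, a i := Finset.single_le_sum (fun i _ => ha0 i) (Finset.mem_univ i)
    calc a i * (1 + D.H x) ^ 1 * (D.Z x).re ^ (-(D.δ / 2)) * s₀
        ≤ (∑ i, a i) * (1 + H₀) ^ 1 * (D.Z x).re ^ (-(D.δ / 2)) * s₀ := by gcongr
      _ = ((∑ i, a i) * (1 + H₀) * s₀ + 0) * (D.Z x).re ^ (-(D.δ / 2)) := by ring
      _ ≤ _ := by gcongr
  · have h1 : D.φ x - D.Z x = D.Z x * D.P (x, D.L x) + D.S D.abelDefect x := by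
      unfold φ φ₀
      ring
    have h2 : ‖D.P (x, D.L x)‖ ≤ D.C * H₀ * c₂ * (D.Z x).re ^ (-(D.δ / 2)) := by
      refine (D.norm_P x (norm_lt hx.1) _).trans ?_
      have h3 := hlog (D.Z x) (by linarith)
      have h4 : ‖x‖ ≤ H₀ * ‖D.Z x‖ ^ (-D.δ) := by
        rw [norm_eq_H_mul hx.1.1]
        gcongr
      calc D.C * ‖x‖ * (1 + ‖D.L x‖) ^ D.K
          ≤ D.C * (H₀ * ‖D.Z x‖ ^ (-D.δ)) * (c₂ * ‖D.Z x‖ ^ (D.δ / 2)) := by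
            gcongr
            exact h3
        _ = D.C * H₀ * c₂ * (‖D.Z x‖ ^ (-D.δ + D.δ / 2)) := by
            rw [Real.rpow_add (by linarith)]
            ring
        _ ≤ D.C * H₀ * c₂ * (D.Z x).re ^ (-(D.δ / 2)) := by
            have h5 : -D.δ + D.δ / 2 = -(D.δ / 2) := by ring
            rw [h5]
            refine mul_le_mul_of_nonneg_left ?_ (by positivity)
            exact Real.rpow_le_rpow_of_nonpos (by linarith) (Complex.re_le_norm _) (by linarith)
    have h3 := (hc₁ ω).norm_S_le hx
    rw [h1]
    refine (norm_add_le _ _).trans ?_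
    rw [norm_mul]
    have h4 : ‖D.S D.abelDefect x‖
        ≤ ‖D.Z x‖ * (c₁ * (1 + H₀) ^ D.N * (D.Z x).re ^ (-(D.δ / 2)) * s₀) := by
      refine h3.trans ?_
      refine le_trans ?_ (le_mul_of_one_le_left (by positivity) (by linarith))
      gcongr
    calc ‖D.Z x‖ * ‖D.P (x, D.L x)‖ + ‖D.S D.abelDefect x‖
        ≤ ‖D.Z x‖ * (D.C * H₀ * c₂ * (D.Z x).re ^ (-(D.δ / 2)))
          + ‖D.Z x‖ * (c₁ * (1 + H₀) ^ D.N * (D.Z x).re ^ (-(D.δ / 2)) * s₀) := by gcongr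
      _ = (0 + (D.C * H₀ * c₂ + c₁ * (1 + H₀) ^ D.N * s₀)) * ‖D.Z x‖
          * (D.Z x).re ^ (-(D.δ / 2)) := by ring
      _ ≤ _ := by gcongr

end Petal

theorem differentiableAt_update {E ι : Type*} [Fintype ι] [DecidableEq ι] [NormedAddCommGroup E]
    [NormedSpace ℂ E] {f : E → ι → ℂ} {g : E → ℂ} {y : E} (i₀ : ι)
    (hf : DifferentiableAt ℂ f y) (hg : DifferentiableAt ℂ g y) :
    DifferentiableAt ℂ (fun z => Function.update (f z) i₀ (g z)) y := by
  rw [differentiableAt_pi] at hf ⊢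
  intro i
  by_cases hi : i = i₀
  · subst hi
    simpa using hg
  · simpa [Function.update_of_ne hi] using hf i

/-! ### The conjugating map and its scaled version in explicit coordinates -/

namespace Petal

variable {n : ℕ} [NeZero n] (D : Petal n)

/-- The map conjugating `g` to the translation. -/
noncomputable def Φ (μ : (Fin n → ℂ) → (Fin n → ℂ)) (x : Fin n → ℂ) : Fin n → ℂ :=
  Function.update (μ (D.w x)) 0 (D.φ x)

/-- The coordinates approximating `Φ`. -/
noncomputable def coord (μ : (Fin n → ℂ) → (Fin n → ℂ)) (j : ℕ) (x : Fin n → ℂ) : Fin n → ℂ :=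
  Function.update (μ (D.w₀ x)) 0 (D.Z x / j)

/-- The inverse of `coord`. -/
noncomputable def chart (ν : (Fin n → ℂ) → (Fin n → ℂ)) (ω : ℂ) (j : ℕ) (p : Fin n → ℂ) :
    Fin n → ℂ :=
  fun i => ν (Function.update p 0 ω⁻¹) i * Complex.exp (-(D.α i * Complex.log (j * p 0)))

/-- The map `Φ` in the coordinates `coord`, with the first coordinate scaled by `1 / j`. -/
noncomputable def scaled (μ ν : (Fin n → ℂ) → (Fin n → ℂ)) (ω : ℂ) (j : ℕ) (p : Fin n → ℂ) :
    Fin n → ℂ :=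
  Function.update (μ (D.w (D.chart ν ω j p))) 0 (D.φ (D.chart ν ω j p) / j)

variable {D} {ω : ℂ} {x : Fin n → ℂ} {μ ν : (Fin n → ℂ) → (Fin n → ℂ)} {p : ℕ}

theorem differentiableAt_Φ (hμ : MonomialChart D.m p μ ν) (hω : ω ^ D.d = -D.β)
    (hx : x ∈ D.Ω ω) : DifferentiableAt ℂ (D.Φ μ) x :=
  differentiableAt_update 0 ((hμ.diff _ fun _ hk => w_ne_zero hx hk).comp x
    (differentiableAt_w hω hx)) (differentiableAt_φ hω hx)

theorem Φ_g (hx : x ∈ D.Ω ω) : D.Φ μ (D.g x) = shift (D.Φ μ x) := by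
  unfold Φ shift
  rw [w_g hx, φ_g hx, Function.update_idem, Function.update_self]

theorem Φ_iterate (hx : x ∈ D.Ω ω) (j : ℕ) :
    D.Φ μ (D.g^[j] x) = Function.update (D.Φ μ x) 0 (D.Φ μ x 0 + j) := by
  unfold Φ
  rw [w_iterate hx, φ_iterate hx, Function.update_idem, Function.update_self]

/-- Overwriting the first coordinate of μ(w₀) loses nothing, since it always equals ω⁻¹; dividing by
Z^(α_i) then recovers x_i from w₀. -/
theorem chart_coord (hμ : MonomialChart D.m p μ ν) (hx : x ∈ D.Ω ω) {j : ℕ} (hj : j ≠ 0) :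
    D.chart ν ω j (D.coord μ j x) = x := by
  have hj' : (j : ℂ) ≠ 0 := Nat.cast_ne_zero.2 hj
  ext i
  unfold chart coord
  rw [Function.update_idem, Function.update_self, mul_div_cancel₀ _ hj']
  have h1 : Function.update (μ (D.w₀ x)) 0 ω⁻¹ = μ (D.w₀ x) := by
    rw [← mon_w₀ hx, ← hμ.zero_eq, Function.update_eq_self]
  rw [h1, hμ.left_inv _ fun _ hk => w₀_ne_zero hx hk]
  unfold w₀ L
  rw [mul_assoc, ← Complex.exp_add, add_neg_cancel, Complex.exp_zero, mul_one]

theorem Φ_mem_model (hμ : MonomialChart D.m p μ ν) (hx : x ∈ D.Ω ω) (i : Fin n)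
    (hi : 1 ≤ (i : ℕ)) (hip : (i : ℕ) < p) : D.Φ μ x i ≠ 0 := by
  have h0 : i ≠ 0 := by
    rintro rfl
    simp at hi
  rw [Φ, Function.update_of_ne h0]
  exact hμ.mem _ (fun _ hk => w_ne_zero hx hk) i hip

theorem mon_chart (hμ : MonomialChart D.m p μ ν) {y : Fin n → ℂ}
    (hy : ∀ i : Fin n, (i : ℕ) < p → Function.update y 0 ω⁻¹ i ≠ 0) (j : ℕ) :
    mon D.m (D.chart ν ω j y) = ω⁻¹ * Complex.exp (-(Complex.log (j * y 0) / D.d)) := by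
  unfold chart
  rw [mon_mul_exp]
  have h1 : mon D.m (ν (Function.update y 0 ω⁻¹)) = ω⁻¹ := by
    rw [← hμ.zero_eq, hμ.right_inv _ hy, Function.update_self]
  have h2 : pairing (fun i => -(D.α i * Complex.log (j * y 0))) D.m
      = -(Complex.log (j * y 0) / D.d) := by
    have : (fun i => -(D.α i * Complex.log (j * y 0)))
        = fun i => D.α i * (-Complex.log (j * y 0)) := by
      ext i
      ring
    rw [this, pairing_mul_right, pairing_α]
    ring
  rw [h1, h2]

theorem Z_chart (hμ : MonomialChart D.m p μ ν) (hω : ω ^ D.d = -D.β) {y : Fin n → ℂ}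
    (hy : ∀ i : Fin n, (i : ℕ) < p → Function.update y 0 ω⁻¹ i ≠ 0) {j : ℕ} (hj : j ≠ 0)
    (hy0 : y 0 ≠ 0) : mon D.M (D.chart ν ω j y) ≠ 0 ∧ D.Z (D.chart ν ω j y) = j * y 0 := by
  have hd : (D.d : ℂ) ≠ 0 := Nat.cast_ne_zero.2 D.d_pos.ne'
  have hne : (j : ℂ) * y 0 ≠ 0 := mul_ne_zero (Nat.cast_ne_zero.2 hj) hy0
  have h1 : mon D.M (D.chart ν ω j y) = (-D.β)⁻¹ * (j * y 0)⁻¹ := by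
    rw [mon_mul_pow D.M_eq, mon_chart hμ hy, mul_pow, inv_pow, hω, ← Complex.exp_nat_mul,
      mul_neg, mul_div_cancel₀ _ hd, Complex.exp_neg, Complex.exp_log hne]
  refine ⟨?_, ?_⟩
  · rw [h1]
    exact mul_ne_zero (inv_ne_zero (neg_ne_zero.2 D.β_ne)) (inv_ne_zero hne)
  · unfold Z zc
    have := D.β_ne
    rw [h1, ← mul_inv, mul_inv D.β, inv_inv, neg_mul, mul_neg, neg_neg, inv_mul_cancel_left₀ this]

/-- The modulus of ζ^(-α_i) is |ζ|^(-Re α_i) exp(Im α_i · arg ζ), with Re α_i ≥ δ and |arg ζ| ≤ π.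
The bound on ‖x‖ |Z|^δ is therefore independent of j. -/
theorem norm_chart_le {y : Fin n → ℂ} {cw : ℝ} (hcw : ‖ν (Function.update y 0 ω⁻¹)‖ ≤ cw) {j : ℕ}
    (h1 : 1 ≤ ‖(j : ℂ) * y 0‖) :
    ‖D.chart ν ω j y‖ ≤ cw * Real.exp (‖D.α‖ * Real.pi) * ‖(j : ℂ) * y 0‖ ^ (-D.δ) := by
  have hcw0 : 0 ≤ cw := (norm_nonneg _).trans hcw
  rw [pi_norm_le_iff_of_nonneg (by positivity)]
  intro i
  rw [chart, norm_mul, Complex.norm_exp, mul_assoc]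
  have hlog := Real.log_nonneg h1
  have h2 : Real.exp (-(D.α i * Complex.log (j * y 0))).re
      ≤ Real.exp (‖D.α‖ * Real.pi) * ‖(j : ℂ) * y 0‖ ^ (-D.δ) := by
    rw [Real.rpow_def_of_pos (by linarith), ← Real.exp_add, Real.exp_le_exp, Complex.neg_re,
      Complex.mul_re, Complex.log_re, Complex.log_im]
    have h3 : (D.α i).im * ((j : ℂ) * y 0).arg ≤ ‖D.α‖ * Real.pi := by
      refine (le_abs_self _).trans ?_
      rw [abs_mul]
      have := (Complex.abs_im_le_norm (D.α i)).trans (norm_le_pi_norm D.α i)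
      gcongr
      exact Complex.abs_arg_le_pi _
    have h4 := mul_le_mul_of_nonneg_right (D.δ_le i) hlog
    linarith
  gcongr
  exact (norm_le_pi_norm _ i).trans hcw

theorem differentiableAt_chart (hμ : MonomialChart D.m p μ ν) {y : Fin n → ℂ}
    (hy : ∀ i : Fin n, (i : ℕ) < p → Function.update y 0 ω⁻¹ i ≠ 0) {j : ℕ}
    (h0 : (j : ℂ) * y 0 ∈ Complex.slitPlane) :
    DifferentiableAt ℂ (D.chart ν ω j) y := by
  have h1 : DifferentiableAt ℂ (fun z : Fin n → ℂ => ν (Function.update z 0 ω⁻¹)) y :=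
    (hμ.diff_symm _ hy).comp y (differentiableAt_update 0 differentiableAt_id
      (differentiableAt_const _))
  rw [differentiableAt_pi] at h1 ⊢
  intro i
  have h2 : DifferentiableAt ℂ (fun z : Fin n → ℂ => Complex.log (j * z 0)) y :=
    (by fun_prop : DifferentiableAt ℂ (fun z : Fin n → ℂ => (j : ℂ) * z 0) y).clog h0
  exact (h1 i).mul (h2.const_mul _).neg.cexp

theorem w_chart (hω : ω ^ D.d = -D.β) (hμ : MonomialChart D.m p μ ν) {y : Fin n → ℂ}
    (hy : ∀ i : Fin n, (i : ℕ) < p → Function.update y 0 ω⁻¹ i ≠ 0) {j : ℕ} (hj : j ≠ 0)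
    (hy0 : y 0 ≠ 0) : D.w (D.chart ν ω j y)
      = fun i => ν (Function.update y 0 ω⁻¹) i * Complex.exp (D.S (D.σ i) (D.chart ν ω j y)) := by
  ext i
  rw [w, w₀, L, (Z_chart hμ hω hy hj hy0).2]
  conv_lhs => rw [chart]
  rw [mul_assoc (ν _ i), ← Complex.exp_add, neg_add_cancel, Complex.exp_zero, mul_one]

/-- Collects by continuity the bounds that are uniform in j. The one by κ/4 places j·y₀ in the
narrow sector: |Im y₀| ≤ κ/4 < 3κ/4 ≤ κ Re y₀. -/
theorem exists_ball_bounds (hμ : MonomialChart D.m p μ ν) (hω0 : ω ≠ 0) {z : Fin n → ℂ}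
    (hz : ∀ i : Fin n, 1 ≤ (i : ℕ) → (i : ℕ) < p → z i ≠ 0) :
    ∃ r cw R : ℝ, 0 < r ∧ 0 ≤ cw ∧ 0 ≤ R ∧ ∀ y ∈ Metric.ball (Function.update z 0 1) r,
      ((‖ν (Function.update y 0 ω⁻¹)‖ < cw ∧
        ∀ i : Fin n, (i : ℕ) < p → Function.update y 0 ω⁻¹ i ≠ 0) ∧ ‖y 0 - 1‖ < D.κ / 4) ∧
        ‖y‖ < R := by
  have hpos : ∀ i : Fin n, i ≠ 0 → 1 ≤ (i : ℕ) := by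
    intro i hi
    by_contra h
    exact hi (Fin.ext (by simpa using h))
  generalize hz' : Function.update z 0 1 = z'
  have hz0 : z' 0 = 1 := by rw [← hz', Function.update_self]
  have hne' : ∀ i : Fin n, (i : ℕ) < p → Function.update z' 0 ω⁻¹ i ≠ 0 := by
    intro i hi
    by_cases h0 : i = 0
    · subst h0
      simpa using hω0
    · rw [Function.update_of_ne h0, ← hz', Function.update_of_ne h0]
      exact hz i (hpos i h0) hi
  have hupd : Continuous fun y : Fin n → ℂ => Function.update y 0 ω⁻¹ :=
    continuous_id.update 0 continuous_const
  have e1 : ∀ᶠ y in 𝓝 z', ‖ν (Function.update y 0 ω⁻¹)‖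
      < ‖ν (Function.update z' 0 ω⁻¹)‖ + 1 := by
    have h1 : Tendsto ν (𝓝 (Function.update z' 0 ω⁻¹)) (𝓝 (ν (Function.update z' 0 ω⁻¹))) :=
      (hμ.diff_symm _ hne').continuousAt
    have h2 : Tendsto (fun y : Fin n → ℂ => ‖ν (Function.update y 0 ω⁻¹)‖) (𝓝 z')
        (𝓝 ‖ν (Function.update z' 0 ω⁻¹)‖) := (h1.comp (hupd.tendsto z')).norm
    exact h2.eventually_lt_const (by linarith)
  have e2 : ∀ᶠ y in 𝓝 z', ∀ i : Fin n, (i : ℕ) < p → Function.update y 0 ω⁻¹ i ≠ 0 := by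
    rw [eventually_all]
    intro i
    by_cases hi : (i : ℕ) < p
    · have : ContinuousAt (fun y : Fin n → ℂ => Function.update y 0 ω⁻¹ i) z' :=
        ((continuous_apply i).comp hupd).continuousAt
      filter_upwards [this.eventually_ne (hne' i hi)] with y hy _
      exact hy
    · exact Eventually.of_forall fun y h => absurd h hi
  have e3 : ∀ᶠ y in 𝓝 z', ‖y 0 - 1‖ < D.κ / 4 := by
    have : ContinuousAt (fun y : Fin n → ℂ => ‖y 0 - 1‖) z' :=
      ((continuous_apply 0).sub continuous_const).norm.continuousAt
    exact this.eventually_lt continuousAt_const (by simp [hz0, D.κ_pos])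
  have e4 : ∀ᶠ y in 𝓝 z', ‖y‖ < ‖z'‖ + 1 :=
    continuous_norm.continuousAt.eventually_lt continuousAt_const (by simp)
  obtain ⟨r, hr, hball⟩ :=
    Metric.eventually_nhds_iff_ball.1 (((e1.and e2).and e3).and e4)
  exact ⟨r, _, _, hr, by positivity, by positivity, hball⟩

set_option maxHeartbeats 400000 in
/-- Near a point of the model, the inverse coordinates take values far inside the attracting
domain and `Φ` is close to the identity after scaling. -/
theorem exists_ball_chart (hμ : MonomialChart D.m p μ ν) (hω : ω ^ D.d = -D.β) {z : Fin n → ℂ}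
    (hz : ∀ i : Fin n, 1 ≤ (i : ℕ) → (i : ℕ) < p → z i ≠ 0) :
    ∃ r : ℝ, 0 < r ∧ ∀ e > 0, ∀ᶠ j : ℕ in atTop,
      ∀ y ∈ Metric.ball (Function.update z 0 1) r, D.chart ν ω j y ∈ D.Ω ω ∧
        DifferentiableAt ℂ (D.chart ν ω j) y ∧ ‖D.scaled μ ν ω j y - y‖ ≤ e := by
  have hω0 : ω ≠ 0 := by
    rintro rfl
    rw [zero_pow D.d_pos.ne'] at hω
    exact D.β_ne (neg_eq_zero.1 hω.symm)
  obtain ⟨r, cw, R, hr, hcw0, hR0, hball⟩ := exists_ball_bounds hμ hω0 hz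
  generalize Function.update z 0 1 = z' at hball ⊢
  have hκ := D.κ_pos
  have hκ1 := D.κ_le
  refine ⟨r, hr, fun e he => ?_⟩
  set H₀ : ℝ := cw * Real.exp (‖D.α‖ * Real.pi) with hH₀
  have hH₀0 : 0 ≤ H₀ := by positivity
  obtain ⟨T, hT0, hT⟩ := D.exists_asymptotics H₀ hH₀0
  obtain ⟨Q, hQ⟩ := hμ.mul_exp
  have hδ := D.δ_pos
  have htend : ∀ s : ℝ, 0 < s → Tendsto (fun j : ℕ => ((j : ℝ) / 2) ^ (-s)) atTop (𝓝 0) := by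
    intro s hs
    exact (tendsto_rpow_neg_atTop hs).comp
      (tendsto_natCast_atTop_atTop.atTop_div_const (by norm_num))
  set q₀ : ℝ := ∑ i, ∑ l, ‖(Q i l : ℂ)‖ with hq₀
  have hq0 : 0 ≤ q₀ := Finset.sum_nonneg fun i _ => Finset.sum_nonneg fun l _ => norm_nonneg _
  -- Requirements on j: t1 puts the chart inside `Ω`, even with the largest weight exp(Bπ²/2); t2
  -- controls the first coordinate; t3 makes the exponent s at most 1 in modulus, so that |exp s -
  -- 1| ≤ 2|s|; t4 controls the other coordinates.
  have t1 := ((htend _ hδ).const_mul H₀).eventually_lt_const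
    (u := D.ε * Real.exp (-(D.B * Real.pi ^ 2 / 2))) (by
      rw [mul_zero]
      exact mul_pos D.ε_pos (Real.exp_pos _))
  have t2 := ((htend _ (half_pos hδ)).const_mul (2 * T)).eventually_lt_const (u := e) (by simpa)
  have t3 := ((htend _ (half_pos hδ)).const_mul (q₀ * T)).eventually_lt_const (u := 1) (by simp)
  have t4 := ((htend _ (half_pos hδ)).const_mul (R * (2 * (q₀ * T)))).eventually_lt_const
    (u := e) (by simpa)
  filter_upwards [t1, t2, t3, t4, eventually_ge_atTop 4] with j h1 h2 h3 h4 hj y hy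
  obtain ⟨⟨⟨hy1, hy2⟩, hy3⟩, hy4⟩ := hball y hy
  have hj0 : j ≠ 0 := by omega
  have hjR : (4 : ℝ) ≤ j := by exact_mod_cast hj
  have hre := (Complex.abs_re_le_norm _).trans hy3.le
  have him := (Complex.abs_im_le_norm _).trans hy3.le
  rw [Complex.sub_re, Complex.one_re, abs_le] at hre
  rw [Complex.sub_im, Complex.one_im, sub_zero] at him
  have hre' : 3 / 4 ≤ (y 0).re := by linarith
  have hy0 : y 0 ≠ 0 := by
    intro h
    rw [h] at hre'
    norm_num at hre'
  have hnorm2 : ‖y 0‖ ≤ 2 := by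
    have := norm_add_le (y 0 - 1) 1
    rw [sub_add_cancel, norm_one] at this
    linarith
  obtain ⟨hmon, hZ⟩ := Z_chart hμ hω hy2 hj0 hy0
  set x := D.chart ν ω j y with hx
  have hZre : (D.Z x).re = j * (y 0).re := by
    rw [hZ]
    simp
  have hZim : (D.Z x).im = j * (y 0).im := by
    rw [hZ]
    simp
  have hZre2 : (j : ℝ) / 2 ≤ (D.Z x).re := by
    rw [hZre]
    have : (j : ℝ) * (1 / 2) ≤ j * (y 0).re := by gcongr; linarith
    linarith
  have hZn : (j : ℝ) / 2 ≤ ‖D.Z x‖ := hZre2.trans (Complex.re_le_norm _)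
  have hZ1 : 1 ≤ ‖(j : ℂ) * y 0‖ := by
    rw [← hZ]
    linarith
  have hxn : ‖x‖ ≤ H₀ * ‖D.Z x‖ ^ (-D.δ) := by
    rw [hZ]
    exact norm_chart_le hy1.le hZ1
  have hxn' : ‖x‖ ≤ H₀ * ((j : ℝ) / 2) ^ (-D.δ) :=
    hxn.trans (mul_le_mul_of_nonneg_left
      (Real.rpow_le_rpow_of_nonpos (by linarith) hZn (by linarith)) hH₀0)
  have hH : D.H x ≤ H₀ := by
    have hp : 0 < ‖D.Z x‖ := by linarith
    calc D.H x ≤ H₀ * ‖D.Z x‖ ^ (-D.δ) * ‖D.Z x‖ ^ D.δ :=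
          mul_le_mul_of_nonneg_right hxn (Real.rpow_nonneg hp.le _)
      _ = H₀ := by rw [mul_assoc, ← Real.rpow_add hp, neg_add_cancel, Real.rpow_zero, mul_one]
  have hmem : x ∈ D.Ω ω := by
    refine ⟨hmon, ?_, fun i => ?_, ?_⟩
    · have := abs_nonneg (D.Z x).im
      linarith
    · have hB : Real.exp (D.B * (D.Z x).arg ^ 2 / 2) ≤ Real.exp (D.B * Real.pi ^ 2 / 2) := by
        have := D.B_nonneg
        rw [← sq_abs (D.Z x).arg]
        gcongr
        exact Complex.abs_arg_le_pi _
      calc ‖x i‖ * Real.exp (D.B * (D.Z x).arg ^ 2 / 2)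
          ≤ ‖x‖ * Real.exp (D.B * Real.pi ^ 2 / 2) := by
            gcongr
            exact norm_le_pi_norm x i
        _ < D.ε * Real.exp (-(D.B * Real.pi ^ 2 / 2)) * Real.exp (D.B * Real.pi ^ 2 / 2) := by
            gcongr
            linarith
        _ = D.ε := by rw [mul_assoc, ← Real.exp_add, neg_add_cancel, Real.exp_zero, mul_one]
    · rw [hx, mon_chart hμ hy2, ← hx, L, hZ, mul_inv_cancel_left₀ hω0, ← Complex.exp_add,
        neg_add_cancel, Complex.exp_zero]
  have hslit : (j : ℂ) * y 0 ∈ Complex.slitPlane := by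
    rw [← hZ]
    exact Z_mem_slitPlane hmem
  have hG : x ∈ D.G ω := by
    refine ⟨hmem, ?_⟩
    rw [hZre, hZim, abs_mul, Nat.abs_cast, mul_left_comm]
    refine mul_lt_mul_of_pos_left ?_ (by linarith)
    have : D.κ * (3 / 4) ≤ D.κ * (y 0).re := by gcongr
    linarith
  refine ⟨hmem, differentiableAt_chart hμ hy2 hslit, ?_⟩
  obtain ⟨hS, hφ⟩ := hT ω x hG hH
  have hrp : (D.Z x).re ^ (-(D.δ / 2)) ≤ ((j : ℝ) / 2) ^ (-(D.δ / 2)) :=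
    Real.rpow_le_rpow_of_nonpos (by linarith) hZre2 (by linarith)
  rw [pi_norm_le_iff_of_nonneg he.le]
  intro i
  rw [Pi.sub_apply]
  by_cases hi : i = 0
  · subst hi
    rw [scaled, Function.update_self, ← hx]
    have hjC : (j : ℂ) ≠ 0 := Nat.cast_ne_zero.2 hj0
    have h5 : D.φ x / j - y 0 = (D.φ x - D.Z x) / j := by
      rw [hZ]
      field_simp
    rw [h5, norm_div, Complex.norm_natCast, div_le_iff₀ (by linarith)]
    refine hφ.trans ?_
    have h6 : ‖D.Z x‖ ≤ j * 2 := by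
      rw [hZ, norm_mul, Complex.norm_natCast]
      gcongr
    have h7 : 0 ≤ (D.Z x).re ^ (-(D.δ / 2)) := Real.rpow_nonneg (by linarith) _
    calc T * ‖D.Z x‖ * (D.Z x).re ^ (-(D.δ / 2))
        ≤ T * (j * 2) * ((j : ℝ) / 2) ^ (-(D.δ / 2)) := by gcongr
      _ = 2 * T * ((j : ℝ) / 2) ^ (-(D.δ / 2)) * j := by ring
      _ ≤ e * j := by gcongr
  -- Under the monomial map μ the corrections exp(S σ_l) become one factor exp(s) multiplying y_i,
  -- with s a fixed integer combination of the small sums.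
  · rw [scaled, Function.update_of_ne hi, w_chart hω hμ hy2 hj0 hy0, hQ, hμ.right_inv _ hy2,
      Function.update_of_ne hi, ← hx]
    set s : ℂ := ∑ l, (Q i l : ℂ) * D.S (D.σ l) x with hs
    have hs1 : ‖s‖ ≤ q₀ * T * ((j : ℝ) / 2) ^ (-(D.δ / 2)) := by
      calc ‖s‖ ≤ ∑ l, ‖(Q i l : ℂ)‖ * (T * ((j : ℝ) / 2) ^ (-(D.δ / 2))) := by
            refine norm_sum_le_of_le _ fun l _ => ?_
            rw [norm_mul]
            gcongr
            exact (hS l).trans (mul_le_mul_of_nonneg_left hrp hT0)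
        _ = (∑ l, ‖(Q i l : ℂ)‖) * T * ((j : ℝ) / 2) ^ (-(D.δ / 2)) := by
            rw [← Finset.sum_mul, mul_assoc]
        _ ≤ q₀ * T * ((j : ℝ) / 2) ^ (-(D.δ / 2)) := by
            gcongr
            exact Finset.single_le_sum (f := fun i => ∑ l, ‖(Q i l : ℂ)‖)
              (fun i _ => Finset.sum_nonneg fun l _ => norm_nonneg _) (Finset.mem_univ i)
    have hs2 : ‖Complex.exp s - 1‖ ≤ 2 * ‖s‖ := Complex.norm_exp_sub_one_le (hs1.trans h3.le)
    have h5 : y i * Complex.exp s - y i = y i * (Complex.exp s - 1) := by ring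
    rw [h5, norm_mul]
    calc ‖y i‖ * ‖Complex.exp s - 1‖
        ≤ R * (2 * (q₀ * T * ((j : ℝ) / 2) ^ (-(D.δ / 2)))) := by
          gcongr
          · exact (norm_le_pi_norm y i).trans hy4.le
          · linarith
      _ = R * (2 * (q₀ * T)) * ((j : ℝ) / 2) ^ (-(D.δ / 2)) := by ring
      _ ≤ e := h4.le

end Petal
-- Injectivity, holomorphic inverse and image of the conjugating map
namespace Petal

section Iterates

variable {n : ℕ} {D : Petal n} {ω : ℂ} {x : Fin n → ℂ}

theorem tendsto_re_Z_rpow (hx : x ∈ D.Ω ω) {s : ℝ} (hs : 0 < s) :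
    Tendsto (fun j => (D.Z (D.g^[j] x)).re ^ (-s)) atTop (𝓝 0) := by
  refine (tendsto_rpow_neg_atTop hs).comp ?_
  refine tendsto_atTop_mono (re_Z_iterate hx) (tendsto_atTop_add_const_left _ _ ?_)
  exact tendsto_natCast_atTop_atTop.const_mul_atTop (by norm_num)

theorem injOn_g : InjOn D.g (D.Ω ω) := fun x hx y hy h => by
  rw [← D.h_g x (norm_lt hx), h, D.h_g y (norm_lt hy)]

theorem injOn_iterate (j : ℕ) : InjOn (D.g^[j]) (D.Ω ω) := injOn_g.iterate mapsTo_Ω j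

theorem exists_local_inverse_iterate (hx : x ∈ D.Ω ω) (j : ℕ) :
    ∃ k : (Fin n → ℂ) → (Fin n → ℂ), k (D.g^[j] x) = x ∧
      ∀ᶠ z in 𝓝 (D.g^[j] x), DifferentiableAt ℂ k z ∧ D.g^[j] (k z) = z := by
  induction j with
  | zero => exact ⟨id, rfl, Eventually.of_forall fun z => ⟨differentiableAt_id, rfl⟩⟩
  | succ j ih =>
    obtain ⟨k, hk1, hk2⟩ := ih
    have hy := norm_lt (iterate_mem hx j)
    have hh := D.h_near _ hy
    have hhg := D.h_g _ hy
    rw [Function.iterate_succ_apply']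
    refine ⟨k ∘ D.h, by rw [Function.comp_apply, hhg, hk1], ?_⟩
    have hc : ContinuousAt D.h (D.g (D.g^[j] x)) := hh.self_of_nhds.1.continuousAt
    have hk3 : ∀ᶠ z in 𝓝 (D.h (D.g (D.g^[j] x))), DifferentiableAt ℂ k z ∧ D.g^[j] (k z) = z := by
      rw [hhg]
      exact hk2
    have h1 := hc.tendsto.eventually hk3
    filter_upwards [hh, h1] with z hz1 hz2
    refine ⟨hz2.1.comp z hz1.1, ?_⟩
    rw [Function.iterate_succ_apply', Function.comp_apply, hz2.2, hz1.2]

end Iterates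

variable {n : ℕ} [NeZero n] {D : Petal n} {ω : ℂ} {x : Fin n → ℂ}
  {μ ν : (Fin n → ℂ) → (Fin n → ℂ)} {p : ℕ}

theorem scaled_eq (j : ℕ) (y : Fin n → ℂ) : D.scaled μ ν ω j y
    = Function.update (D.Φ μ (D.chart ν ω j y)) 0 (D.Φ μ (D.chart ν ω j y) 0 / j) := by
  unfold scaled Φ
  rw [Function.update_self, Function.update_idem]

/-- Near a point of the model, the scaled map is eventually a biholomorphism. -/
theorem exists_ball_scaled (hμ : MonomialChart D.m p μ ν) (hω : ω ^ D.d = -D.β) {z : Fin n → ℂ}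
    (hz : ∀ i : Fin n, 1 ≤ (i : ℕ) → (i : ℕ) < p → z i ≠ 0) :
    ∃ r : ℝ, 0 < r ∧ ∀ᶠ j : ℕ in atTop, ∃ e : OpenPartialHomeomorph (Fin n → ℂ) (Fin n → ℂ),
      (e : (Fin n → ℂ) → (Fin n → ℂ)) = D.scaled μ ν ω j ∧
      e.source = Metric.ball (Function.update z 0 1) r ∧
      Metric.ball (Function.update z 0 1) (r / 4) ⊆ e.target ∧
      DifferentiableOn ℂ e.symm e.target ∧
      ∀ y ∈ e.source, D.chart ν ω j y ∈ D.Ω ω ∧ DifferentiableAt ℂ (D.chart ν ω j) y := by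
  obtain ⟨r, hr, hball⟩ := exists_ball_chart hμ hω hz
  refine ⟨r / 2, half_pos hr, ?_⟩
  -- r/16 is the closeness needed in `exists_openPartialHomeomorph_of_near_id`, which yields the
  -- source radius r/2 and a target radius r/8 = (r/2)/4.
  filter_upwards [hball (r / 16) (by positivity)] with j hj
  have hd : DifferentiableOn ℂ (D.scaled μ ν ω j) (Metric.ball (Function.update z 0 1) r) := by
    intro y hy
    obtain ⟨h1, h2, -⟩ := hj y hy
    have h3 : DifferentiableAt ℂ (fun y => D.Φ μ (D.chart ν ω j y)) y :=
      (differentiableAt_Φ hμ hω h1).comp y h2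
    have h4 : DifferentiableAt ℂ (fun y => D.Φ μ (D.chart ν ω j y) 0 / j) y := by
      have h5 : DifferentiableAt ℂ (fun y => D.Φ μ (D.chart ν ω j y) 0) y :=
        differentiableAt_pi.1 h3 0
      simpa only [div_eq_mul_inv] using h5.mul_const (j : ℂ)⁻¹
    refine DifferentiableAt.differentiableWithinAt ?_
    have h5 := differentiableAt_update 0 h3 h4
    refine h5.congr_of_eventuallyEq (Eventually.of_forall fun y => scaled_eq j y)
  obtain ⟨e, he1, he2, he3, he4⟩ :=
    exists_openPartialHomeomorph_of_near_id hr hd fun y hy => (hj y hy).2.2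
  refine ⟨e, he1, he2, ?_, he4, fun y hy => ?_⟩
  · rwa [div_div, show (2 : ℝ) * 4 = 8 by norm_num]
  · rw [he2] at hy
    have := hj y (Metric.ball_subset_ball (by linarith) hy)
    exact ⟨this.1, this.2.1⟩

/-- The approximate coordinates of an orbit converge. -/
theorem tendsto_coord (hμ : MonomialChart D.m p μ ν) (hx : x ∈ D.Ω ω) :
    Tendsto (fun j => D.coord μ j (D.g^[j] x)) atTop (𝓝 (Function.update (D.Φ μ x) 0 1)) := by
  obtain ⟨J, hJ⟩ := exists_iterate_mem_G hx
  obtain ⟨T, hT0, hT⟩ := D.exists_asymptotics (D.H (D.g^[J] x)) (D.H_nonneg _)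
  have hasym : ∀ᶠ j in atTop, D.g^[j] x ∈ D.G ω ∧
      (∀ i, ‖D.S (D.σ i) (D.g^[j] x)‖ ≤ T * (D.Z (D.g^[j] x)).re ^ (-(D.δ / 2))) ∧
      ‖D.φ (D.g^[j] x) - D.Z (D.g^[j] x)‖
        ≤ T * ‖D.Z (D.g^[j] x)‖ * (D.Z (D.g^[j] x)).re ^ (-(D.δ / 2)) := by
    filter_upwards [eventually_ge_atTop J] with j hj
    obtain ⟨k, rfl⟩ := Nat.exists_eq_add_of_le hj
    rw [add_comm, Function.iterate_add_apply]
    exact ⟨iterate_mem_G hJ k, hT ω _ (iterate_mem_G hJ k) (H_iterate_le hJ k)⟩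
  have hzero : Tendsto (fun j => T * (D.Z (D.g^[j] x)).re ^ (-(D.δ / 2))) atTop (𝓝 0) := by
    simpa using (tendsto_re_Z_rpow hx (half_pos D.δ_pos)).const_mul T
  have hS : ∀ i, Tendsto (fun j => D.S (D.σ i) (D.g^[j] x)) atTop (𝓝 0) := by
    intro i
    refine squeeze_zero_norm' ?_ hzero
    filter_upwards [hasym] with j hj
    exact hj.2.1 i
  have hφ : Tendsto (fun j => D.φ (D.g^[j] x) / D.Z (D.g^[j] x)) atTop (𝓝 1) := by
    rw [tendsto_iff_norm_sub_tendsto_zero]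
    refine squeeze_zero' (Eventually.of_forall fun _ => norm_nonneg _) ?_ hzero
    filter_upwards [hasym] with j hj
    have hZ : D.Z (D.g^[j] x) ≠ 0 := D.Z_ne hj.1.1.1
    have h1 : D.φ (D.g^[j] x) / D.Z (D.g^[j] x) - 1
        = (D.φ (D.g^[j] x) - D.Z (D.g^[j] x)) / D.Z (D.g^[j] x) := by
      field_simp
    rw [h1, norm_div, div_le_iff₀ (norm_pos_iff.2 hZ)]
    linarith [hj.2.2]
  -- φ grows by exactly 1 at each step, so φ/j → 1; together with φ/Z → 1 this gives Z/j → 1.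
  have hφj : Tendsto (fun j : ℕ => D.φ (D.g^[j] x) / j) atTop (𝓝 1) := by
    have h1 : Tendsto (fun j : ℕ => D.φ x / (j : ℂ) + 1) atTop (𝓝 (0 + 1)) :=
      (tendsto_const_div_atTop_nhds_zero_nat (D.φ x)).add_const 1
    rw [zero_add] at h1
    refine h1.congr' ?_
    filter_upwards [eventually_ne_atTop 0] with j hj
    rw [φ_iterate hx]
    have : (j : ℂ) ≠ 0 := Nat.cast_ne_zero.2 hj
    field_simp
  have hZj : Tendsto (fun j : ℕ => D.Z (D.g^[j] x) / j) atTop (𝓝 1) := by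
    have h1 := hφj.div hφ one_ne_zero
    rw [div_one] at h1
    refine h1.congr' ?_
    filter_upwards [hφ.eventually_ne one_ne_zero] with j hj
    have h2 : D.φ (D.g^[j] x) ≠ 0 := fun h => hj (by rw [h, zero_div])
    have h3 : D.Z (D.g^[j] x) ≠ 0 := fun h => hj (by rw [h, div_zero])
    simp only [Pi.div_apply]
    field_simp
  have hw₀ : Tendsto (fun j => D.w₀ (D.g^[j] x)) atTop (𝓝 (D.w x)) := by
    rw [tendsto_pi_nhds]
    intro i
    have h1 : Tendsto (fun j => D.w x i * Complex.exp (-D.S (D.σ i) (D.g^[j] x))) atTop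
        (𝓝 (D.w x i * Complex.exp (-0))) :=
      ((Complex.continuous_exp.tendsto _).comp (hS i).neg).const_mul _
    rw [neg_zero, Complex.exp_zero, mul_one] at h1
    refine h1.congr fun j => ?_
    rw [← w_iterate hx j, w, mul_assoc, ← Complex.exp_add, add_neg_cancel, Complex.exp_zero,
      mul_one]
  have hμw : Tendsto (fun j => μ (D.w₀ (D.g^[j] x))) atTop (𝓝 (μ (D.w x))) :=
    (hμ.diff _ fun _ hk => w_ne_zero hx hk).continuousAt.tendsto.comp hw₀
  rw [tendsto_pi_nhds] at hμw ⊢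
  intro i
  by_cases hi : i = 0
  · subst hi
    simpa [coord] using hZj
  · simpa [coord, Φ, Function.update_of_ne hi] using hμw i

theorem scaled_coord (hμ : MonomialChart D.m p μ ν) (hx : x ∈ D.Ω ω) {j : ℕ} (hj : j ≠ 0) :
    D.scaled μ ν ω j (D.coord μ j (D.g^[j] x))
      = Function.update (D.Φ μ x) 0 ((D.Φ μ x 0 + j) / j) := by
  rw [scaled_eq, chart_coord hμ (iterate_mem hx j) hj, Φ_iterate hx, Function.update_self,
    Function.update_idem]

/-- If Φ x = Φ y, the coordinates of both orbits converge to the same point and enter a ball where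
the scaled map is injective, with equal scaled values. Hence the j-th iterates of x and y agree, and
g is injective. -/
theorem injOn_Φ (hμ : MonomialChart D.m p μ ν) (hω : ω ^ D.d = -D.β) : InjOn (D.Φ μ) (D.Ω ω) := by
  intro x hx y hy hxy
  obtain ⟨r, hr, hev⟩ := exists_ball_scaled hμ hω (fun i => Φ_mem_model hμ hx i)
  have h1 := (tendsto_coord hμ hx).eventually_mem (Metric.ball_mem_nhds _ hr)
  have h2 := (tendsto_coord hμ hy).eventually_mem (Metric.ball_mem_nhds _ hr)
  obtain ⟨j, ⟨e, he1, he2, -⟩, hj1, hj2, hj⟩ :=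
    (hev.and (h1.and (h2.and (eventually_ne_atTop 0)))).exists
  rw [← hxy, ← he2] at hj2
  rw [← he2] at hj1
  have h3 := e.injOn hj1 hj2 (by rw [he1, scaled_coord hμ hx hj, scaled_coord hμ hy hj, hxy])
  have h4 := congrArg (D.chart ν ω j) h3
  rw [chart_coord hμ (iterate_mem hx j) hj, chart_coord hμ (iterate_mem hy j) hj] at h4
  exact injOn_iterate j hx hy h4

/-- A local inverse of Φ: translate by j and rescale, invert the scaled map, apply the chart, then
return by a local inverse of the j-th iterate of g. -/
theorem isBiholomorphism_Φ (hμ : MonomialChart D.m p μ ν) (hω : ω ^ D.d = -D.β) :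
    IsBiholomorphism (D.Φ μ) (D.Ω ω) (D.Φ μ '' D.Ω ω) := by
  refine isBiholomorphism_image_of_local_inverse (isOpen_Ω hω)
    (fun x hx => (differentiableAt_Φ hμ hω hx).differentiableWithinAt) (injOn_Φ hμ hω) ?_
  intro x hx
  obtain ⟨r, hr, hev⟩ := exists_ball_scaled hμ hω (fun i => Φ_mem_model hμ hx i)
  have h1 := (tendsto_coord hμ hx).eventually_mem (Metric.ball_mem_nhds _ hr)
  obtain ⟨j, ⟨e, he1, he2, -, he3, he4⟩, hj1, hj⟩ :=
    (hev.and (h1.and (eventually_ne_atTop 0))).exists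
  rw [← he2] at hj1
  have hjC : (j : ℂ) ≠ 0 := Nat.cast_ne_zero.2 hj
  obtain ⟨k, hk1, hk2⟩ := exists_local_inverse_iterate hx j
  set s : (Fin n → ℂ) → (Fin n → ℂ) := fun z => Function.update z 0 ((z 0 + j) / j) with hs
  have hsx : s (D.Φ μ x) = e (D.coord μ j (D.g^[j] x)) := by rw [he1, scaled_coord hμ hx hj]
  have hsd : Differentiable ℂ s := fun z =>
    differentiableAt_update 0 differentiableAt_id (by fun_prop)
  have hsx' : e.symm (s (D.Φ μ x)) = D.coord μ j (D.g^[j] x) := by rw [hsx, e.left_inv hj1]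
  have hst : s (D.Φ μ x) ∈ e.target := by
    rw [hsx]
    exact e.map_source hj1
  have hev1 : ∀ᶠ z in 𝓝 (D.Φ μ x), s z ∈ e.target :=
    (hsd.continuous.tendsto _).eventually (e.open_target.mem_nhds hst)
  set c : (Fin n → ℂ) → (Fin n → ℂ) := fun z => D.chart ν ω j (e.symm (s z)) with hc
  have hcd : ∀ z, s z ∈ e.target → DifferentiableAt ℂ c z := by
    intro z hz
    have h3 : DifferentiableAt ℂ (fun z => e.symm (s z)) z :=
      ((he3 _ hz).differentiableAt (e.open_target.mem_nhds hz)).comp z (hsd z)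
    exact (he4 _ (e.map_target hz)).2.comp z h3
  have hcx : c (D.Φ μ x) = D.g^[j] x := by
    simp only [hc]
    rw [hsx', chart_coord hμ (iterate_mem hx j) hj]
  have hcc : Tendsto c (𝓝 (D.Φ μ x)) (𝓝 (D.g^[j] x)) := by
    have := (hcd _ hst).continuousAt.tendsto
    rwa [hcx] at this
  have hkc : Tendsto (fun z => k (c z)) (𝓝 (D.Φ μ x)) (𝓝 x) := by
    have := hk2.self_of_nhds.1.continuousAt.tendsto
    rw [hk1] at this
    exact this.comp hcc
  refine ⟨fun z => k (c z), ?_⟩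
  filter_upwards [hev1, hcc.eventually hk2, hkc.eventually ((isOpen_Ω hω).mem_nhds hx)]
    with z hz1 hz2 hz3
  refine ⟨hz2.1.comp z (hcd z hz1), hz3, ?_⟩
  have h5 : D.scaled μ ν ω j (e.symm (s z)) = s z := by rw [← he1, e.right_inv hz1]
  rw [scaled_eq] at h5
  have h6 : D.Φ μ (c z) = Function.update (D.Φ μ (k (c z))) 0 (D.Φ μ (k (c z)) 0 + j) := by
    rw [← Φ_iterate hz3, hz2.2]
  change Function.update (D.Φ μ (c z)) 0 (D.Φ μ (c z) 0 / j) = s z at h5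
  rw [h6, Function.update_self, Function.update_idem, hs] at h5
  ext i
  have h7 := congrFun h5 i
  by_cases hi : i = 0
  · subst hi
    simp only [Function.update_self] at h7
    field_simp at h7
    simpa using h7
  · simpa [Function.update_of_ne hi] using h7

/-- Translating z by j and dividing its first coordinate by j gives points converging to z with
first coordinate 1. For large j they lie in a ball covered by the scaled map, so the translate of z
by j is in the image of Φ. -/
theorem iUnion_T_image (hμ : MonomialChart D.m p μ ν) (hω : ω ^ D.d = -D.β) :
    (⋃ j : ℕ, T (j : ℤ) '' (D.Φ μ '' D.Ω ω))
      = {z | ∀ i : Fin n, 1 ≤ (i : ℕ) → (i : ℕ) < p → z i ≠ 0} := by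
  ext z
  simp only [mem_iUnion, mem_image, mem_ofPred_eq]
  constructor
  · rintro ⟨j, _, ⟨x, hx, rfl⟩, rfl⟩ i hi hip
    have h0 : i ≠ 0 := by
      rintro rfl
      simp at hi
    rw [T, Function.update_of_ne h0]
    exact Φ_mem_model hμ hx i hi hip
  · intro hz
    obtain ⟨r, hr, hev⟩ := exists_ball_scaled hμ hω hz
    have h1 : Tendsto (fun j : ℕ => Function.update z 0 ((z 0 + j) / j)) atTop
        (𝓝 (Function.update z 0 1)) := by
      have h2 : Tendsto (fun j : ℕ => (z 0 + j) / (j : ℂ)) atTop (𝓝 1) := by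
        have h3 : Tendsto (fun j : ℕ => z 0 / (j : ℂ) + 1) atTop (𝓝 (0 + 1)) :=
          (tendsto_const_div_atTop_nhds_zero_nat (z 0)).add_const 1
        rw [zero_add] at h3
        refine h3.congr' ?_
        filter_upwards [eventually_ne_atTop 0] with j hj
        have : (j : ℂ) ≠ 0 := Nat.cast_ne_zero.2 hj
        field_simp
      exact tendsto_const_nhds.update 0 h2
    obtain ⟨j, ⟨e, he1, he2, he3, -, he4⟩, hj1, hj⟩ :=
      (hev.and ((h1.eventually_mem (Metric.ball_mem_nhds _ (by positivity : 0 < r / 4))).and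
        (eventually_ne_atTop 0))).exists
    have hjC : (j : ℂ) ≠ 0 := Nat.cast_ne_zero.2 hj
    have ht := he3 hj1
    set y := e.symm (Function.update z 0 ((z 0 + j) / j)) with hy
    have hys : y ∈ e.source := e.map_target ht
    refine ⟨j, _, ⟨_, (he4 y hys).1, rfl⟩, ?_⟩
    have h5 : D.scaled μ ν ω j y = Function.update z 0 ((z 0 + j) / j) := by
      rw [← he1, hy, e.right_inv ht]
    rw [scaled_eq] at h5
    ext i
    have h7 := congrFun h5 i
    by_cases hi : i = 0
    · subst hi
      simp only [Function.update_self] at h7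
      field_simp at h7
      simp [T, h7]
    · simpa [T, Function.update_of_ne hi] using h7

end Petal

/-! ### Formal solution of the Abel equation to any finite order -/

section Normalization

variable {n : ℕ}

theorem mon_add (γ ν : Fin n → ℕ) (x : Fin n → ℂ) : mon (γ + ν) x = mon γ x * mon ν x := by
  unfold mon
  rw [← Finset.prod_mul_distrib]
  exact Finset.prod_congr rfl fun i _ => by rw [Pi.add_apply, pow_add]

theorem norm_mon_le (γ : Fin n → ℕ) (x : Fin n → ℂ) : ‖mon γ x‖ ≤ ‖x‖ ^ (∑ i, γ i) := by
  unfold mon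
  rw [norm_prod, ← Finset.prod_pow_eq_pow_sum]
  refine Finset.prod_le_prod (fun i _ => norm_nonneg _) fun i _ => ?_
  rw [norm_pow]
  gcongr
  exact norm_le_pi_norm x i

/-- Polynomials in `x` without constant term. -/
def monSpan (n : ℕ) : Submodule ℂ ((Fin n → ℂ) → ℂ) :=
  Submodule.span ℂ {p | ∃ ν : Fin n → ℕ, 1 ≤ ∑ i, ν i ∧ p = mon ν}

theorem exists_prod_eq_mon {ι : Type*} (s : Finset ι) (r : ι → Fin n) :
    ∃ ν : Fin n → ℕ, ∑ i, ν i = s.card ∧ (fun x : Fin n → ℂ => ∏ j ∈ s, x (r j)) = mon ν := by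
  classical
  induction s using Finset.cons_induction with
  | empty =>
    refine ⟨0, by simp, ?_⟩
    ext x
    simp [mon]
  | cons a s ha ih =>
    obtain ⟨ν, h1, h2⟩ := ih
    refine ⟨Pi.single (r a) 1 + ν, ?_, ?_⟩
    · simp only [Pi.add_apply, Finset.sum_add_distrib, h1, Finset.card_cons]
      rw [Finset.sum_pi_single']
      simp [add_comm]
    · ext x
      rw [mon_add, Finset.prod_cons, ← h2]
      congr 1
      unfold mon
      rw [Finset.prod_eq_single (r a)]
      · simp
      · intro i _ hi
        simp [hi]
      · simp

/-- Taylor's formula with polynomials given by monomials. -/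
theorem exists_taylor {h : (Fin n → ℂ) → ℂ} (hh : AnalyticAt ℂ h 0) (h0 : h 0 = 0) (N : ℕ) :
    ∃ p ∈ monSpan n, (fun x => h x - p x) =O[𝓝 0] fun x => ‖x‖ ^ N := by
  obtain ⟨q, hq⟩ := hh
  refine ⟨fun x => q.partialSum N x, ?_, by simpa using hq.isBigO_sub_partialSum_pow N⟩
  have h1 : (fun x => q.partialSum N x) = ∑ k ∈ Finset.range N, fun x => q k fun _ => x := by
    ext x
    simp [FormalMultilinearSeries.partialSum]
  rw [h1]
  refine Submodule.sum_mem _ fun k _ => ?_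
  rcases Nat.eq_zero_or_pos k with rfl | hk
  · have h2 : (fun x => q 0 fun _ => x) = 0 := by
      ext x
      rw [hq.coeff_zero, h0]
      rfl
    rw [h2]
    exact Submodule.zero_mem _
  · have h2 : (fun x => q k fun _ => x) = ∑ r : Fin k → Fin n,
        (q k fun j => (Pi.single (r j) 1 : Fin n → ℂ)) •
          fun x : Fin n → ℂ => ∏ j, x (r j) := by
      ext x
      have hx : ∀ _ : Fin k, x = ∑ i, x i • (Pi.single i 1 : Fin n → ℂ) := by
        intro _
        ext i
        simp [Finset.sum_apply, Pi.single_apply]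
      have h3 : (q k fun _ => x) = q k fun _ => ∑ i, x i • (Pi.single i 1 : Fin n → ℂ) :=
        congrArg (q k) (funext hx)
      rw [h3]
      have h4 := (q k).toMultilinearMap.map_sum
        (g := fun (_ : Fin k) (i : Fin n) => x i • (Pi.single i 1 : Fin n → ℂ))
      refine h4.trans ?_
      rw [Finset.sum_apply]
      refine Finset.sum_congr rfl fun r _ => ?_
      have h5 := (q k).toMultilinearMap.map_smul_univ (fun j => x (r j))
        (fun j => (Pi.single (r j) 1 : Fin n → ℂ))
      refine h5.trans ?_
      simp [mul_comm]
    rw [h2]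
    refine Submodule.sum_mem _ fun r _ => Submodule.smul_mem _ _ (Submodule.subset_span ?_)
    obtain ⟨ν, hν1, hν2⟩ := exists_prod_eq_mon Finset.univ r
    refine ⟨ν, ?_, hν2⟩
    rw [hν1, Finset.card_univ, Fintype.card_fin]
    exact hk

/-- The monomial `x^γ l^j`. -/
noncomputable def logMon (γ : Fin n → ℕ) (j : ℕ) (y : (Fin n → ℂ) × ℂ) : ℂ := mon γ y.1 * y.2 ^ j

/-- Polynomials in `(x, l)` of order at least `k` in `x`. -/
def polySpan (n k : ℕ) : Submodule ℂ ((Fin n → ℂ) × ℂ → ℂ) :=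
  Submodule.span ℂ {F | ∃ (γ : Fin n → ℕ) (j : ℕ), k ≤ ∑ i, γ i ∧ F = logMon γ j}

/-- Functions of `(x, l)` of size `O(‖x‖ ^ N)`, polynomially in `l`, off the zero set of `x^M`. -/
def errSpan (M : Fin n → ℕ) (N : ℕ) : Submodule ℂ ((Fin n → ℂ) × ℂ → ℂ) where
  carrier := {F | ∃ (C : ℝ) (K : ℕ), 0 ≤ C ∧ ∀ᶠ x in 𝓝 (0 : Fin n → ℂ), mon M x ≠ 0 → ∀ l,
    ‖F (x, l)‖ ≤ C * ‖x‖ ^ N * (1 + ‖l‖) ^ K}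
  zero_mem' := ⟨0, 0, le_rfl, by simp⟩
  add_mem' := by
    rintro F G ⟨C, K, hC, hF⟩ ⟨C', K', hC', hG⟩
    refine ⟨C + C', K + K', add_nonneg hC hC', ?_⟩
    filter_upwards [hF, hG] with x h1 h2 hx l
    have h3 : (1 : ℝ) ≤ 1 + ‖l‖ := by linarith [norm_nonneg l]
    calc ‖F (x, l) + G (x, l)‖ ≤ C * ‖x‖ ^ N * (1 + ‖l‖) ^ K + C' * ‖x‖ ^ N * (1 + ‖l‖) ^ K' :=
          norm_add_le_of_le (h1 hx l) (h2 hx l)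
      _ ≤ C * ‖x‖ ^ N * (1 + ‖l‖) ^ (K + K') + C' * ‖x‖ ^ N * (1 + ‖l‖) ^ (K + K') := by
          gcongr <;> first | exact h3 | omega
      _ = (C + C') * ‖x‖ ^ N * (1 + ‖l‖) ^ (K + K') := by ring
  smul_mem' := by
    rintro c F ⟨C, K, hC, hF⟩
    refine ⟨‖c‖ * C, K, by positivity, ?_⟩
    filter_upwards [hF] with x h1 hx l
    rw [Pi.smul_apply, smul_eq_mul, norm_mul, mul_assoc, mul_assoc, ← mul_assoc C]
    gcongr
    exact h1 hx l

/-- Polynomials in `l` with analytic coefficients vanishing at the origin. -/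
def analyticSpan (n : ℕ) : Submodule ℂ ((Fin n → ℂ) × ℂ → ℂ) :=
  Submodule.span ℂ {F | ∃ (h : (Fin n → ℂ) → ℂ) (j : ℕ), AnalyticAt ℂ h 0 ∧ h 0 = 0 ∧
    F = fun y => h y.1 * y.2 ^ j}

theorem polySpan_anti {k k' : ℕ} (h : k ≤ k') : polySpan n k' ≤ polySpan n k := by
  refine Submodule.span_mono ?_
  rintro F ⟨γ, j, h1, h2⟩
  exact ⟨γ, j, h.trans h1, h2⟩

theorem logMon_mem {k : ℕ} {γ : Fin n → ℕ} (hγ : k ≤ ∑ i, γ i) (j : ℕ) :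
    logMon γ j ∈ polySpan n k := Submodule.subset_span ⟨γ, j, hγ, rfl⟩

theorem differentiable_of_mem_polySpan {k : ℕ} {F : (Fin n → ℂ) × ℂ → ℂ}
    (hF : F ∈ polySpan n k) : Differentiable ℂ F := by
  induction hF using Submodule.span_induction with
  | mem F hF =>
    obtain ⟨γ, j, -, rfl⟩ := hF
    exact ((differentiable_mon γ).comp differentiable_fst).mul (differentiable_snd.pow j)
  | zero => exact differentiable_const 0
  | add F G _ _ h1 h2 => exact h1.add h2
  | smul c F _ h => exact h.const_smul c

theorem norm_le_of_mem_polySpan {k : ℕ} {F : (Fin n → ℂ) × ℂ → ℂ} (hF : F ∈ polySpan n k) :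
    ∃ (C : ℝ) (K : ℕ), 0 ≤ C ∧ ∀ x : Fin n → ℂ, ‖x‖ ≤ 1 → ∀ l,
      ‖F (x, l)‖ ≤ C * ‖x‖ ^ k * (1 + ‖l‖) ^ K := by
  induction hF using Submodule.span_induction with
  | mem F hF =>
    obtain ⟨γ, j, hγ, rfl⟩ := hF
    refine ⟨1, j, zero_le_one, fun x hx l => ?_⟩
    rw [logMon, norm_mul, norm_pow, one_mul]
    have h1 : ‖mon γ x‖ ≤ ‖x‖ ^ k :=
      (norm_mon_le γ x).trans (pow_le_pow_of_le_one (norm_nonneg _) hx hγ)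
    gcongr
    linarith
  | zero => exact ⟨0, 0, le_rfl, by simp⟩
  | add F G _ _ h1 h2 =>
    obtain ⟨C, K, hC, hF⟩ := h1
    obtain ⟨C', K', hC', hG⟩ := h2
    refine ⟨C + C', K + K', add_nonneg hC hC', fun x hx l => ?_⟩
    have h3 : (1 : ℝ) ≤ 1 + ‖l‖ := by linarith [norm_nonneg l]
    calc ‖F (x, l) + G (x, l)‖ ≤ C * ‖x‖ ^ k * (1 + ‖l‖) ^ K + C' * ‖x‖ ^ k * (1 + ‖l‖) ^ K' :=
          norm_add_le_of_le (hF x hx l) (hG x hx l)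
      _ ≤ C * ‖x‖ ^ k * (1 + ‖l‖) ^ (K + K') + C' * ‖x‖ ^ k * (1 + ‖l‖) ^ (K + K') := by
          gcongr <;> first | exact h3 | omega
      _ = (C + C') * ‖x‖ ^ k * (1 + ‖l‖) ^ (K + K') := by ring
  | smul c F _ h =>
    obtain ⟨C, K, hC, hF⟩ := h
    refine ⟨‖c‖ * C, K, by positivity, fun x hx l => ?_⟩
    rw [Pi.smul_apply, smul_eq_mul, norm_mul, mul_assoc, mul_assoc, ← mul_assoc C]
    gcongr
    exact hF x hx l

theorem eventually_norm_le_one : ∀ᶠ x in 𝓝 (0 : Fin n → ℂ), ‖x‖ ≤ 1 := by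
  have := continuous_norm.tendsto (0 : Fin n → ℂ)
  rw [norm_zero] at this
  exact (this.eventually_lt_const zero_lt_one).mono fun x hx => le_of_lt hx

theorem polySpan_le_errSpan (M : Fin n → ℕ) (N : ℕ) : polySpan n N ≤ errSpan M N := by
  intro F hF
  obtain ⟨C, K, hC, h⟩ := norm_le_of_mem_polySpan hF
  refine ⟨C, K, hC, ?_⟩
  filter_upwards [eventually_norm_le_one] with x hx _ l
  exact h x hx l

theorem mon_mul_monSpan_mem {γ : Fin n → ℕ} {p : (Fin n → ℂ) → ℂ} (hp : p ∈ monSpan n) (j : ℕ) :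
    (fun y : (Fin n → ℂ) × ℂ => mon γ y.1 * (p y.1 * y.2 ^ j)) ∈ polySpan n (∑ i, γ i + 1) := by
  induction hp using Submodule.span_induction with
  | mem p hp =>
    obtain ⟨ν, hν, rfl⟩ := hp
    refine Submodule.subset_span ⟨γ + ν, j, ?_, ?_⟩
    · simp only [Pi.add_apply, Finset.sum_add_distrib]
      omega
    · ext y
      rw [logMon, mon_add, mul_assoc]
  | zero =>
    convert! Submodule.zero_mem (polySpan n (∑ i, γ i + 1)) using 1
    ext y
    simp
  | add p q _ _ h1 h2 =>
    convert! Submodule.add_mem _ h1 h2 using 1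
    ext y
    simp only [Pi.add_apply]
    ring
  | smul c p _ h =>
    convert! Submodule.smul_mem _ c h using 1
    ext y
    simp only [Pi.smul_apply, smul_eq_mul]
    ring

/-- Coefficients vanishing at 0 have Taylor polynomials without constant term, so they raise the
order in x by at least one; the Taylor remainder goes into the error. -/
theorem mon_mul_analyticSpan_mem (M γ : Fin n → ℕ) (N : ℕ) {F : (Fin n → ℂ) × ℂ → ℂ}
    (hF : F ∈ analyticSpan n) :
    (fun y => mon γ y.1 * F y) ∈ polySpan n (∑ i, γ i + 1) ⊔ errSpan M N := by
  induction hF using Submodule.span_induction with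
  | mem F hF =>
    obtain ⟨h, j, hh, h0, rfl⟩ := hF
    obtain ⟨p, hp, hO⟩ := exists_taylor hh h0 N
    have h1 : (fun y : (Fin n → ℂ) × ℂ => mon γ y.1 * (h y.1 * y.2 ^ j))
        = (fun y => mon γ y.1 * (p y.1 * y.2 ^ j))
          + fun y => mon γ y.1 * ((h y.1 - p y.1) * y.2 ^ j) := by
      ext y
      simp only [Pi.add_apply]
      ring
    rw [h1]
    refine Submodule.add_mem_sup (mon_mul_monSpan_mem hp j) ?_
    obtain ⟨C, hC, hO⟩ := hO.exists_pos
    refine ⟨C, j, hC.le, ?_⟩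
    filter_upwards [hO.bound, eventually_norm_le_one] with x hx1 hx2 _ l
    rw [norm_pow, norm_norm] at hx1
    have h2 : ‖mon γ x‖ ≤ 1 := (norm_mon_le γ x).trans (pow_le_one₀ (norm_nonneg _) hx2)
    rw [norm_mul, norm_mul, norm_pow]
    calc ‖mon γ x‖ * (‖h x - p x‖ * ‖l‖ ^ j) ≤ 1 * (C * ‖x‖ ^ N * (1 + ‖l‖) ^ j) := by
          gcongr
          linarith
      _ = _ := one_mul _
  | zero =>
    convert! Submodule.zero_mem (polySpan n (∑ i, γ i + 1) ⊔ errSpan M N) using 1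
    ext y
    simp
  | add p q _ _ h1 h2 =>
    convert! Submodule.add_mem _ h1 h2 using 1
    ext y
    simp only [Pi.add_apply]
    ring
  | smul c p _ h =>
    convert! Submodule.smul_mem _ c h using 1
    ext y
    simp only [Pi.smul_apply, smul_eq_mul]
    ring

theorem mul_analyticSpan_mem {h : (Fin n → ℂ) → ℂ} (hh : AnalyticAt ℂ h 0) (j : ℕ)
    {F : (Fin n → ℂ) × ℂ → ℂ} (hF : F ∈ analyticSpan n) :
    (fun y => h y.1 * y.2 ^ j * F y) ∈ analyticSpan n := by
  induction hF using Submodule.span_induction with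
  | mem F hF =>
    obtain ⟨h', j', hh', h0, rfl⟩ := hF
    refine Submodule.subset_span ⟨fun x => h x * h' x, j + j', hh.mul hh', by simp [h0], ?_⟩
    ext y
    rw [pow_add]
    ring
  | zero =>
    convert! Submodule.zero_mem (analyticSpan n) using 1
    ext y
    simp
  | add p q _ _ h1 h2 =>
    convert! Submodule.add_mem _ h1 h2 using 1
    ext y
    simp only [Pi.add_apply]
    ring
  | smul c p _ h =>
    convert! Submodule.smul_mem _ c h using 1
    ext y
    simp only [Pi.smul_apply, smul_eq_mul]
    ring

/-- The operator `F ↦ (Z F) ∘ f - Z F`, where the logarithm of `Z` is an independent variable. -/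
noncomputable def abelOp (β : ℂ) (M : Fin n → ℕ) (b : Fin n → (Fin n → ℂ) → ℂ) :
    ((Fin n → ℂ) × ℂ → ℂ) →ₗ[ℂ] ((Fin n → ℂ) × ℂ → ℂ) where
  toFun F y := zc β M (expMap M b y.1) * F (expMap M b y.1, y.2 + lam M b y.1)
    - zc β M y.1 * F y
  map_add' F G := by
    ext y
    simp only [Pi.add_apply]
    ring
  map_smul' c F := by
    ext y
    simp only [Pi.smul_apply, smul_eq_mul, RingHom.id_apply]
    ring

/-- The entire function `(exp z - 1) / z`. -/
noncomputable def expQuot : ℂ → ℂ := dslope Complex.exp 0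

theorem expQuot_zero : expQuot 0 = 1 := by
  rw [expQuot, dslope_same, Complex.deriv_exp, Complex.exp_zero]

theorem mul_expQuot (z : ℂ) : z * expQuot z = Complex.exp z - 1 := by
  have := sub_smul_dslope Complex.exp 0 z
  rwa [sub_zero, smul_eq_mul, Complex.exp_zero] at this

theorem analyticAt_dslope {f : ℂ → ℂ} {z : ℂ} (hf : AnalyticAt ℂ f z) :
    AnalyticAt ℂ (dslope f z) z := by
  obtain ⟨p, hp⟩ := hf
  exact hp.has_fpower_series_dslope_fslope.analyticAt

variable {M : Fin n → ℕ} {β : ℂ} {α : Fin n → ℂ} {b : Fin n → (Fin n → ℂ) → ℂ}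

theorem analyticAt_mon (M : Fin n → ℕ) (x : Fin n → ℂ) : AnalyticAt ℂ (mon M) x := by
  unfold mon
  refine Finset.analyticAt_fun_prod _ fun i _ => ?_
  exact ((ContinuousLinearMap.proj (R := ℂ) (φ := fun _ : Fin n => ℂ) i).analyticAt x).pow (M i)

theorem analyticAt_pairing (hb : ∀ i, AnalyticAt ℂ (b i) 0) (γ : Fin n → ℕ) :
    AnalyticAt ℂ (fun x => pairing (fun i => b i x) γ) 0 := by
  unfold pairing
  exact Finset.analyticAt_fun_sum _ fun i _ => (hb i).mul analyticAt_const

theorem mon_zero (hM : M ≠ 0) : mon M (0 : Fin n → ℂ) = 0 := by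
  by_contra h
  rw [← ne_eq, mon_ne_zero_iff] at h
  exact hM (funext fun i => by_contra fun hi => h i hi rfl)

theorem ne_zero_of_pairing (hα : pairing α M = 1) : M ≠ 0 := by
  rintro rfl
  simp [pairing] at hα

theorem pairing_zero_eq (hb0 : ∀ i, b i 0 = β * α i) (γ : Fin n → ℕ) :
    pairing (fun i => b i 0) γ = β * pairing α γ := by
  simp only [hb0]
  exact pairing_mul_left γ β α

/-- Since x^M and λ vanish at the origin, exp(…)(l + λ)^j is l^j up to coefficients that vanish
there. This feeds the induction on j in `exists_abelOp_logMon`. -/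
theorem exp_mul_pow_sub_mem (hα : pairing α M = 1) (hb : ∀ i, AnalyticAt ℂ (b i) 0)
    (γ : Fin n → ℕ) (j : ℕ) :
    (fun y : (Fin n → ℂ) × ℂ => Complex.exp (mon M y.1 *
      (pairing (fun i => b i y.1) γ - pairing (fun i => b i y.1) M)) * (y.2 + lam M b y.1) ^ j
        - y.2 ^ j) ∈ analyticSpan n := by
  have hM0 : mon M (0 : Fin n → ℂ) = 0 := mon_zero (ne_zero_of_pairing hα)
  have hlam : AnalyticAt ℂ (lam M b) 0 := by
    unfold lam
    exact ((analyticAt_mon M 0).mul (analyticAt_pairing hb M)).neg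
  have hlam0 : lam M b 0 = 0 := by simp [lam, hM0]
  induction j with
  | zero =>
    refine Submodule.subset_span ⟨fun x => Complex.exp (mon M x *
      (pairing (fun i => b i x) γ - pairing (fun i => b i x) M)) - 1, 0, ?_, ?_, ?_⟩
    · exact (((analyticAt_mon M 0).mul ((analyticAt_pairing hb γ).sub
        (analyticAt_pairing hb M))).cexp).sub analyticAt_const
    · simp [hM0]
    · ext y
      simp
  | succ j ih =>
    have h1 := mul_analyticSpan_mem analyticAt_const 1 ih (h := fun _ => (1 : ℂ))
    have h2 := mul_analyticSpan_mem hlam 0 ih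
    have h3 : (fun y : (Fin n → ℂ) × ℂ => lam M b y.1 * y.2 ^ j) ∈ analyticSpan n :=
      Submodule.subset_span ⟨_, j, hlam, hlam0, rfl⟩
    convert! Submodule.add_mem _ (Submodule.add_mem _ h1 h2) h3 using 1
    ext y
    simp only [Pi.add_apply]
    ring

/-- The action of `abelOp` on monomials, to leading order. -/
theorem exists_abelOp_logMon (hβ : β ≠ 0) (hα : pairing α M = 1)
    (hb : ∀ i, AnalyticAt ℂ (b i) 0) (hb0 : ∀ i, b i 0 = β * α i) (γ : Fin n → ℕ) (j : ℕ) :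
    ∃ F ∈ analyticSpan n, ∀ y : (Fin n → ℂ) × ℂ, mon M y.1 ≠ 0 →
      zc β M y.1 * (Complex.exp (mon M y.1 * (pairing (fun i => b i y.1) γ -
        pairing (fun i => b i y.1) M)) * (y.2 + lam M b y.1) ^ j - y.2 ^ j)
      = (1 - pairing α γ) * y.2 ^ j + j * y.2 ^ (j - 1) + F y := by
  have hM0 : mon M (0 : Fin n → ℂ) = 0 := mon_zero (ne_zero_of_pairing hα)
  induction j with
  | zero =>
    set c : (Fin n → ℂ) → ℂ := fun x => pairing (fun i => b i x) γ - pairing (fun i => b i x) M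
      with hc
    have hca : AnalyticAt ℂ c 0 := (analyticAt_pairing hb γ).sub (analyticAt_pairing hb M)
    have hc0 : c 0 = β * (pairing α γ - 1) := by
      simp only [hc]
      rw [pairing_zero_eq hb0, pairing_zero_eq hb0, hα]
      ring
    -- Z(exp(x^M c) - 1) equals -β⁻¹ c·(exp(x^M c) - 1)/(x^M c), analytic at 0 with value -β⁻¹c(0) =
    -- 1 - ⟨α,γ⟩.
    refine ⟨fun y => (-β⁻¹ * (c y.1 * expQuot (mon M y.1 * c y.1)) - (1 - pairing α γ)) * y.2 ^ 0,
      Submodule.subset_span ⟨fun x => -β⁻¹ * (c x * expQuot (mon M x * c x)) - (1 - pairing α γ),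
        0, ?_, ?_, rfl⟩, fun y hy => ?_⟩
    · refine (analyticAt_const.mul (hca.mul ?_)).sub analyticAt_const
      refine AnalyticAt.fun_comp ?_ ((analyticAt_mon M 0).mul hca)
      rw [hM0, zero_mul]
      exact analyticAt_dslope analyticAt_cexp
    · simp only []
      rw [hM0, zero_mul, expQuot_zero, hc0]
      field_simp
      ring
    · have h1 := mul_expQuot (mon M y.1 * c y.1)
      simp only [pow_zero, mul_one, Nat.cast_zero, zero_mul, add_zero]
      change zc β M y.1 * (Complex.exp (mon M y.1 * c y.1) - 1) = _
      rw [← h1, zc]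
      field_simp
      ring
  | succ j ih =>
    -- With E the exponential and D_j = E(l + λ)^j - l^j one has D_{j+1} = l D_j + λ D_j + λ l^j.
    -- After multiplication by Z, the product Zλ = β⁻¹⟨b,M⟩ is analytic with value 1 at 0.
    obtain ⟨F, hF, hFy⟩ := ih
    have h1 := mul_analyticSpan_mem analyticAt_const 1 hF (h := fun _ => (1 : ℂ))
    have h2 := mul_analyticSpan_mem (analyticAt_const.mul (analyticAt_pairing hb M)) 0
      (exp_mul_pow_sub_mem hα hb γ j) (h := fun x => β⁻¹ * pairing (fun i => b i x) M)
    have h3 : (fun y : (Fin n → ℂ) × ℂ => (β⁻¹ * pairing (fun i => b i y.1) M - 1) * y.2 ^ j)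
        ∈ analyticSpan n := by
      refine Submodule.subset_span ⟨fun x => β⁻¹ * pairing (fun i => b i x) M - 1, j,
        (analyticAt_const.mul (analyticAt_pairing hb M)).sub analyticAt_const, ?_, rfl⟩
      simp only []
      rw [pairing_zero_eq hb0, hα, mul_one, inv_mul_cancel₀ hβ, sub_self]
    refine ⟨_, Submodule.add_mem _ (Submodule.add_mem _ h1 h2) h3, fun y hy => ?_⟩
    have h4 := hFy y hy
    simp only [Pi.add_apply]
    have h5 : zc β M y.1 * lam M b y.1 = β⁻¹ * pairing (fun i => b i y.1) M := by
      unfold zc lam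
      field_simp
    have h6 : (j : ℂ) * y.2 ^ (j - 1) * y.2 = j * y.2 ^ j := by
      rcases Nat.eq_zero_or_pos j with rfl | hj
      · simp
      · rw [mul_assoc, ← pow_succ, Nat.sub_add_cancel hj]
    generalize Complex.exp (mon M y.1 * (pairing (fun i => b i y.1) γ -
        pairing (fun i => b i y.1) M)) = e at *
    rw [Nat.add_sub_cancel, ← h5]
    push_cast
    linear_combination y.2 * h4 + h6

/-- Heuristically x^γ is Z^(-s) with s = ⟨α,γ⟩ and f is Z ↦ Z + 1, so the operator acts as d/dZ on
Z^(1-s) l^j, giving (1 - s)Z^(-s) l^j + j Z^(-s) l^(j-1). -/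
theorem abelOp_logMon (hβ : β ≠ 0) (hα : pairing α M = 1) (hb : ∀ i, AnalyticAt ℂ (b i) 0)
    (hb0 : ∀ i, b i 0 = β * α i) (N : ℕ) (γ : Fin n → ℕ) (j : ℕ) :
    abelOp β M b (logMon γ j) - ((1 - pairing α γ) • logMon γ j + (j : ℂ) • logMon γ (j - 1))
      ∈ polySpan n (∑ i, γ i + 1) ⊔ errSpan M N := by
  obtain ⟨F, hF, hFy⟩ := exists_abelOp_logMon hβ hα hb hb0 γ j
  have h1 := mon_mul_analyticSpan_mem M γ N hF
  set G := abelOp β M b (logMon γ j)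
    - ((1 - pairing α γ) • logMon γ j + (j : ℂ) • logMon γ (j - 1)) with hG
  have h2 : G - (fun y => mon γ y.1 * F y) ∈ errSpan M N := by
    refine ⟨0, 0, le_rfl, Eventually.of_forall fun x hx l => ?_⟩
    have h3 := hFy (x, l) hx
    have h4 : mon γ (expMap M b x)
        = mon γ x * Complex.exp (mon M x * pairing (fun i => b i x) γ) := by
      unfold expMap
      rw [mon_mul_exp, pairing_mul_left]
    have h5 : (G - fun y => mon γ y.1 * F y) (x, l) = 0 := by
      simp only [hG, Pi.sub_apply, Pi.add_apply, Pi.smul_apply, smul_eq_mul, abelOp, logMon,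
        LinearMap.coe_mk, AddHom.coe_mk]
      have h6 : Complex.exp (mon M x * (pairing (fun i => b i x) γ - pairing (fun i => b i x) M))
          = Complex.exp (lam M b x) * Complex.exp (mon M x * pairing (fun i => b i x) γ) := by
        rw [← Complex.exp_add, lam]
        congr 1
        ring
      rw [h6] at h3
      rw [zc_expMap, h4]
      linear_combination mon γ x * h3
    rw [h5]
    simp
  have := Submodule.add_mem _ h1 (Submodule.mem_sup_right h2)
  rwa [add_sub_cancel] at this

/-- Solvability at leading order. If s = ⟨α,γ⟩ ≠ 1, the leading part is triangular in j with nonzero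
diagonal 1 - s. In the resonant case s = 1 it lowers the power of l, and x^γ l^j comes from x^γ
l^(j+1). -/
theorem polySpan_le_map_abelOp (hβ : β ≠ 0) (hα : pairing α M = 1)
    (hb : ∀ i, AnalyticAt ℂ (b i) 0) (hb0 : ∀ i, b i 0 = β * α i) (N k : ℕ) :
    polySpan n k ≤ (polySpan n k).map (abelOp β M b) ⊔ (polySpan n (k + 1) ⊔ errSpan M N) := by
  conv_lhs => rw [polySpan]
  rw [Submodule.span_le]
  rintro _ ⟨γ, j, hγ, rfl⟩
  rw [SetLike.mem_coe]
  set W := (polySpan n k).map (abelOp β M b) ⊔ (polySpan n (k + 1) ⊔ errSpan M N) with hW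
  have hop : ∀ j, (1 - pairing α γ) • logMon γ j + (j : ℂ) • logMon γ (j - 1) ∈ W := by
    intro j
    have h1 := abelOp_logMon hβ hα hb hb0 N γ j
    have h2 : abelOp β M b (logMon γ j) ∈ W :=
      Submodule.mem_sup_left (Submodule.mem_map_of_mem (logMon_mem hγ j))
    have h3 : polySpan n (∑ i, γ i + 1) ⊔ errSpan M N ≤ W :=
      le_trans (sup_le_sup_right (polySpan_anti (by omega)) _) le_sup_right
    have := Submodule.sub_mem _ h2 (h3 h1)
    rwa [sub_sub_cancel] at this
  by_cases hs : 1 - pairing α γ = 0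
  · have h1 := hop (j + 1)
    rw [hs, zero_smul, zero_add, Nat.add_sub_cancel] at h1
    exact (Submodule.smul_mem_iff _ (Nat.cast_ne_zero.2 (Nat.succ_ne_zero j))).1 h1
  · induction j with
    | zero =>
      have h1 := hop 0
      rw [Nat.cast_zero, zero_smul, add_zero] at h1
      exact (Submodule.smul_mem_iff _ hs).1 h1
    | succ j ih =>
      have h1 := hop (j + 1)
      rw [Nat.add_sub_cancel] at h1
      exact (Submodule.smul_mem_iff _ hs).1
        ((Submodule.add_mem_iff_left _ (Submodule.smul_mem _ _ ih)).1 h1)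

/-- The operator sends 1 to Z∘f - Z = 1 + higher order, and the remaining terms are removed one
order at a time, their preimages being subtracted from P. -/
theorem exists_abelOp_sub_mem (hβ : β ≠ 0) (hα : pairing α M = 1)
    (hb : ∀ i, AnalyticAt ℂ (b i) 0) (hb0 : ∀ i, b i 0 = β * α i) (N k : ℕ) :
    ∃ P ∈ polySpan n 1, abelOp β M b (1 + P) - 1 ∈ polySpan n (k + 1) ⊔ errSpan M N := by
  induction k with
  | zero =>
    refine ⟨0, Submodule.zero_mem _, ?_⟩
    have h1 := abelOp_logMon hβ hα hb hb0 N 0 0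
    have h2 : (logMon 0 0 : (Fin n → ℂ) × ℂ → ℂ) = 1 := by
      ext y
      simp [logMon, mon]
    have h3 : pairing α 0 = 0 := by simp [pairing]
    rw [h2, h3] at h1
    simpa using h1
  | succ k ih =>
    obtain ⟨P, hP, h1⟩ := ih
    obtain ⟨F, hF, e, he, hFe⟩ := Submodule.mem_sup.1 h1
    obtain ⟨G, hG, v, hv, hGv⟩ := Submodule.mem_sup.1
      (polySpan_le_map_abelOp hβ hα hb hb0 N (k + 1) hF)
    obtain ⟨Q, hQ, rfl⟩ := Submodule.mem_map.1 hG
    refine ⟨P - Q, Submodule.sub_mem _ hP (polySpan_anti (by omega) hQ), ?_⟩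
    have h2 : abelOp β M b (1 + (P - Q)) - 1 = v + e := by
      have : (1 + (P - Q) : (Fin n → ℂ) × ℂ → ℂ) = (1 + P) - Q := by abel
      rw [this, map_sub, sub_right_comm, ← hFe, ← hGv]
      abel
    rw [h2]
    exact Submodule.add_mem _ hv (Submodule.mem_sup_right he)

/-- An approximate solution of the Abel equation to any given order. -/
theorem exists_normalization (hβ : β ≠ 0) (hα : pairing α M = 1)
    (hb : ∀ i, AnalyticAt ℂ (b i) 0) (hb0 : ∀ i, b i 0 = β * α i) (N : ℕ) :
    ∃ (P : (Fin n → ℂ) × ℂ → ℂ) (C : ℝ) (K : ℕ), 0 ≤ C ∧ Differentiable ℂ P ∧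
      ∀ᶠ x in 𝓝 (0 : Fin n → ℂ), (∀ l, ‖P (x, l)‖ ≤ C * ‖x‖ * (1 + ‖l‖) ^ K) ∧
        (mon M x ≠ 0 → ∀ l, ‖zc β M (expMap M b x) * (1 + P (expMap M b x, l + lam M b x))
          - zc β M x * (1 + P (x, l)) - 1‖ ≤ C * ‖x‖ ^ N * (1 + ‖l‖) ^ K) := by
  obtain ⟨P, hP, h1⟩ := exists_abelOp_sub_mem hβ hα hb hb0 N N
  have h2 : abelOp β M b (1 + P) - 1 ∈ errSpan M N :=
    (sup_le ((polySpan_anti (Nat.le_succ N)).trans (polySpan_le_errSpan M N)) le_rfl) h1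
  obtain ⟨C, K, hC, hE⟩ := h2
  obtain ⟨C', K', hC', hE'⟩ := norm_le_of_mem_polySpan hP
  refine ⟨P, C + C', K + K', add_nonneg hC hC', differentiable_of_mem_polySpan hP, ?_⟩
  filter_upwards [hE, eventually_norm_le_one] with x hx hx1
  refine ⟨fun l => ?_, fun hM l => ?_⟩
  · have h3 : (1 : ℝ) ≤ 1 + ‖l‖ := by linarith [norm_nonneg l]
    refine (hE' x hx1 l).trans ?_
    rw [pow_one]
    gcongr <;> first | exact h3 | omega | linarith
  · have h3 : (1 : ℝ) ≤ 1 + ‖l‖ := by linarith [norm_nonneg l]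
    refine (hx hM l).trans ?_
    gcongr <;> first | exact h3 | omega | linarith

end Normalization


/-! ### Exponential form of the germ and of its inverse -/

section ExponentialForm

variable {n : ℕ} {M : Fin n → ℕ} {a : Fin n → ℂ}
  {f : OpenPartialHomeomorph (Fin n → ℂ) (Fin n → ℂ)}

/-- The germ of `f` at the origin is `x ↦ (xᵢ exp (x^M bᵢ(x)))ᵢ` with `b` analytic and
`b(0) = a`. -/
def HasExpForm (M : Fin n → ℕ) (a : Fin n → ℂ)
    (f : OpenPartialHomeomorph (Fin n → ℂ) (Fin n → ℂ)) (b : Fin n → (Fin n → ℂ) → ℂ) : Prop :=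
  0 ∈ f.source ∧ (∀ i, AnalyticAt ℂ (b i) 0) ∧ (∀ i, b i 0 = a i) ∧
    ∀ᶠ x in 𝓝 (0 : Fin n → ℂ), f x = expMap M b x

/-- With u = x^M(a_i + A_i), 1 + u = exp(log(1 + u)) and log(1 + u)/u is analytic with value 1 at 0.
Hence b_i = (a_i + A_i)·log(1 + u)/u. -/
theorem HasForm.exists_hasExpForm (hM : M ≠ 0) (hf : HasForm M a f) : ∃ b, HasExpForm M a f b := by
  obtain ⟨A, hA, hA0, hform⟩ := hf.form
  have hu0 : mon M (0 : Fin n → ℂ) = 0 := mon_zero hM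
  set q : ℂ → ℂ := dslope (fun z => Complex.log (1 + z)) 0 with hq
  have hlog : AnalyticAt ℂ (fun z : ℂ => Complex.log (1 + z)) 0 := by
    refine (analyticAt_const.add analyticAt_id).clog ?_
    simp
  have hqa : AnalyticAt ℂ q 0 := analyticAt_dslope hlog
  have hq0 : q 0 = 1 := by
    have h1 : HasDerivAt (fun z : ℂ => Complex.log (1 + z)) (1 / (1 + 0)) 0 :=
      ((hasDerivAt_id (0 : ℂ)).const_add 1).clog (by simp)
    rw [hq, dslope_same, h1.deriv]
    simp
  have hqm : ∀ z, z * q z = Complex.log (1 + z) := by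
    intro z
    have := sub_smul_dslope (fun z : ℂ => Complex.log (1 + z)) 0 z
    simpa using this
  have hc : ∀ i, AnalyticAt ℂ (fun x => a i + A i x) 0 := fun i => analyticAt_const.add (hA i)
  have huc : ∀ i, AnalyticAt ℂ (fun x => mon M x * (a i + A i x)) 0 := fun i =>
    (analyticAt_mon M 0).mul (hc i)
  refine ⟨fun i x => (a i + A i x) * q (mon M x * (a i + A i x)), hf.zero_mem, fun i => ?_,
    fun i => ?_, ?_⟩
  · refine (hc i).mul (AnalyticAt.fun_comp ?_ (huc i))
    rw [hu0, zero_mul]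
    exact hqa
  · simp only []
    rw [hu0, zero_mul, hq0, hA0, mul_one, add_zero]
  · have hne : ∀ᶠ x in 𝓝 (0 : Fin n → ℂ), ∀ i, 1 + mon M x * (a i + A i x) ≠ 0 := by
      rw [eventually_all]
      intro i
      refine (continuousAt_const.add (huc i).continuousAt).eventually_ne ?_
      simp [hu0]
    filter_upwards [hform, hne] with x h1 h2
    ext i
    rw [h1 i, expMap, ← mul_assoc, hqm, Complex.exp_log (h2 i)]

theorem analyticAt_expMap {b : Fin n → (Fin n → ℂ) → ℂ} (hb : ∀ i, AnalyticAt ℂ (b i) 0) :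
    AnalyticAt ℂ (expMap M b) 0 := by
  rw [analyticAt_pi_iff]
  intro i
  refine AnalyticAt.mul ?_ (((analyticAt_mon M 0).mul (hb i)).cexp)
  exact (ContinuousLinearMap.proj (R := ℂ) (φ := fun _ : Fin n => ℂ) i).analyticAt 0

theorem expMap_zero (M : Fin n → ℕ) (b : Fin n → (Fin n → ℂ) → ℂ) : expMap M b 0 = 0 := by
  ext i
  simp [expMap]

theorem fderiv_expMap (hM : M ≠ 0) {b : Fin n → (Fin n → ℂ) → ℂ}
    (hb : ∀ i, AnalyticAt ℂ (b i) 0) :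
    HasFDerivAt (expMap M b) (ContinuousLinearMap.id ℂ (Fin n → ℂ)) 0 := by
  rw [hasFDerivAt_pi']
  intro i
  have h1 : HasFDerivAt (fun x : Fin n → ℂ => x i)
      (ContinuousLinearMap.proj (R := ℂ) (φ := fun _ : Fin n => ℂ) i) 0 := hasFDerivAt_apply i 0
  have h2 : DifferentiableAt ℂ (fun x => Complex.exp (mon M x * b i x)) 0 :=
    ((analyticAt_mon M 0).mul (hb i)).cexp.differentiableAt
  have h3 := h1.mul h2.hasFDerivAt
  convert! h3 using 1
  ext v
  simp [mon_zero hM]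

theorem HasExpForm.apply_zero {b : Fin n → (Fin n → ℂ) → ℂ} (hf : HasExpForm M a f b) :
    f 0 = 0 := by
  rw [hf.2.2.2.self_of_nhds, expMap_zero]

theorem HasExpForm.analyticAt_symm (hM : M ≠ 0) {b : Fin n → (Fin n → ℂ) → ℂ}
    (hf : HasExpForm M a f b) : AnalyticAt ℂ f.symm 0 := by
  obtain ⟨h0, hb, -, hform⟩ := id hf
  have h1 : AnalyticAt ℂ f 0 := (analyticAt_expMap hb).congr (hform.mono fun x hx => hx.symm)
  have h2 : fderiv ℂ f 0
      = ((ContinuousLinearEquiv.refl ℂ (Fin n → ℂ) : (Fin n → ℂ) ≃L[ℂ] (Fin n → ℂ)) :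
        (Fin n → ℂ) →L[ℂ] (Fin n → ℂ)) :=
    ((fderiv_expMap hM hb).congr_of_eventuallyEq hform).fderiv
  have h3 := f.analyticAt_symm' h0 h1 h2
  rwa [hf.apply_zero] at h3

/-- If y = f(x), then x_i = y_i exp(-x^M b_i(x)) and x^M = y^M exp(λ(x)). So f⁻¹ has the exponents
-exp(λ(x)) b_i(x), where x = f⁻¹(y). -/
theorem HasExpForm.symm (hM : M ≠ 0) {b : Fin n → (Fin n → ℂ) → ℂ} (hf : HasExpForm M a f b) :
    ∃ b', HasExpForm M (-a) f.symm b' := by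
  obtain ⟨h0, hb, hb0, hform⟩ := id hf
  have hsa := hf.analyticAt_symm hM
  have hs0 : f.symm 0 = 0 := by
    conv_lhs => rw [← hf.apply_zero]
    exact f.left_inv h0
  have ht0 : (0 : Fin n → ℂ) ∈ f.target := by
    have := f.map_source h0
    rwa [hf.apply_zero] at this
  have hlam : AnalyticAt ℂ (lam M b) 0 := by
    unfold lam
    exact ((analyticAt_mon M 0).mul (analyticAt_pairing hb M)).neg
  refine ⟨fun i y => -(Complex.exp (lam M b (f.symm y)) * b i (f.symm y)), ht0, fun i => ?_,
    fun i => ?_, ?_⟩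
  · have h1 : AnalyticAt ℂ (fun x => -(Complex.exp (lam M b x) * b i x)) (f.symm 0) := by
      rw [hs0]
      exact (hlam.cexp.mul (hb i)).neg
    exact h1.fun_comp hsa
  · simp only []
    rw [hs0, hb0, lam, mon_zero hM]
    simp
  · have h1 : Tendsto f.symm (𝓝 0) (𝓝 0) := by
      have := hsa.continuousAt.tendsto
      rwa [hs0] at this
    filter_upwards [h1.eventually hform, f.open_target.mem_nhds ht0] with y hy1 hy2
    rw [f.right_inv hy2] at hy1
    ext i
    have h2 : mon M y = mon M (f.symm y) * Complex.exp (-lam M b (f.symm y)) := by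
      conv_lhs => rw [hy1, mon_expMap]
    have h3 : y i = f.symm y i * Complex.exp (mon M (f.symm y) * b i (f.symm y)) := congrFun hy1 i
    have h4 : mon M y * Complex.exp (lam M b (f.symm y)) = mon M (f.symm y) := by
      rw [h2, mul_assoc, ← Complex.exp_add, neg_add_cancel, Complex.exp_zero, mul_one]
    rw [expMap, mul_neg, ← mul_assoc, h4, h3, mul_assoc, ← Complex.exp_add, add_neg_cancel,
      Complex.exp_zero, mul_one]

end ExponentialForm

/-! ### The constants of the wide and of the narrow sector -/

section Constants

theorem one_sub_le_cos {c t : ℝ} (ht : 0 ≤ t) (h1 : c ^ 2 + t ^ 2 = 1) (h2 : 0 < c + t) :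
    1 - 3 * t ≤ c := by
  rcases le_or_gt 0 c with hc | hc
  · nlinarith
  · nlinarith

theorem sq_sin_le_mul_sin {θ : ℝ} (hθ : |θ| ≤ Real.pi) : |Real.sin θ| ^ 2 ≤ θ * Real.sin θ := by
  have h1 : θ * Real.sin θ = |θ| * |Real.sin θ| := by
    rw [Real.abs_sin_eq_sin_abs_of_abs_le_pi hθ]
    rcases le_or_gt 0 θ with h | h
    · rw [abs_of_nonneg h]
    · rw [abs_of_neg h, Real.sin_neg]
      ring
  have h2 : |Real.sin θ| ≤ |θ| := Real.abs_sin_le_abs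
  rw [h1, sq]
  gcongr

/-- The constant `B` in the definition of the attracting domains. -/
theorem exists_turn_const {A K : ℝ} (hA : 0 < A) :
    ∃ B : ℝ, 0 ≤ B ∧ ∀ α : ℂ, A ≤ α.re → ‖α‖ ≤ K → ∀ θ, |θ| ≤ Real.pi →
      0 < Real.cos θ + |Real.sin θ| →
      A / 2 ≤ α.re * Real.cos θ + α.im * Real.sin θ + B * (θ * Real.sin θ) := by
  -- With t = |sin θ|, the first two terms are at least A - 4Kt and θ sin θ ≥ t². The value of B
  -- makes A/2 - 4Kt + Bt² the perfect square (A - 4Kt)²/(2A).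
  refine ⟨8 * K ^ 2 / A, by positivity, fun α hα hαK θ hθ hpos => ?_⟩
  have hc2 : Real.cos θ ^ 2 + |Real.sin θ| ^ 2 = 1 := by
    rw [sq_abs]
    exact Real.cos_sq_add_sin_sq θ
  have h1 := one_sub_le_cos (abs_nonneg (Real.sin θ)) hc2 hpos
  have h2 := sq_sin_le_mul_sin hθ
  have h3 : -(K * |Real.sin θ|) ≤ α.im * Real.sin θ := by
    have h4 : |α.im * Real.sin θ| ≤ K * |Real.sin θ| := by
      rw [abs_mul]
      gcongr
      exact (Complex.abs_im_le_norm α).trans hαK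
    exact (abs_le.1 h4).1
  have h5 : α.re ≤ K := (Complex.re_le_norm α).trans hαK
  set t := |Real.sin θ| with ht
  have ht0 : 0 ≤ t := abs_nonneg _
  have h6 : 8 * K ^ 2 / A * t ^ 2 ≤ 8 * K ^ 2 / A * (θ * Real.sin θ) := by gcongr
  have h7 : α.re * (1 - 3 * t) ≤ α.re * Real.cos θ :=
    mul_le_mul_of_nonneg_left h1 (by linarith)
  have h8 : α.re * t ≤ K * t := by gcongr
  have h9 : A / 2 - 4 * K * t + 8 * K ^ 2 / A * t ^ 2 = (A - 4 * K * t) ^ 2 / (2 * A) := by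
    field_simp
    ring
  have h10 : 0 ≤ (A - 4 * K * t) ^ 2 / (2 * A) := by positivity
  nlinarith

/-- The opening `κ` of the narrow sector. -/
theorem exists_sector_const {A K : ℝ} (hA : 0 < A) (hK : 0 ≤ K) :
    ∃ κ : ℝ, 0 < κ ∧ κ ≤ 1 ∧ ∀ α : ℂ, A ≤ α.re → ‖α‖ ≤ K → ∀ c s : ℝ, 0 ≤ c → |s| ≤ κ * c →
      c ^ 2 + s ^ 2 = 1 → A / 4 ≤ (α.re - A / 4) * c + α.im * s := by
  -- The bound by 1 forces c ≥ 1/2; the other gives |Im α · s| ≤ (A/4)c. What remains is at least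
  -- (3A/4 - A/4)c ≥ A/4.
  refine ⟨min 1 (A / (4 * (K + 1))), by positivity, min_le_left _ _, ?_⟩
  intro α hα hαK c s hc hs hcs
  have h1 : |s| ≤ c := hs.trans (mul_le_of_le_one_left hc (min_le_left _ _))
  have h2 : |s| ≤ A / (4 * (K + 1)) * c :=
    hs.trans (mul_le_mul_of_nonneg_right (min_le_right _ _) hc)
  have h3 : 1 / 2 ≤ c := by
    have : s ^ 2 ≤ c ^ 2 := by
      rw [← sq_abs]
      gcongr
    nlinarith
  have h4 : |α.im * s| ≤ A / 4 * c := by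
    rw [abs_mul]
    calc |α.im| * |s| ≤ (K + 1) * (A / (4 * (K + 1)) * c) := by
          gcongr
          linarith [(Complex.abs_im_le_norm α).trans hαK]
      _ = A / 4 * c := by field_simp
  have h5 := (abs_le.1 h4).1
  have h6 : 3 * A / 4 * c ≤ (α.re - A / 4) * c := by
    gcongr
    linarith
  nlinarith

end Constants

/-! ### Existence of the normal form with all its constants -/

section Existence

variable {n : ℕ} {M : Fin n → ℕ} {a : Fin n → ℂ}
  {f : OpenPartialHomeomorph (Fin n → ℂ) (Fin n → ℂ)}

theorem pairing_div (h : pairing a M ≠ 0) : pairing (fun i => a i / pairing a M) M = 1 := by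
  have h1 : (fun i => a i / pairing a M) = fun i => (pairing a M)⁻¹ * a i := by
    ext i
    rw [div_eq_inv_mul]
  rw [h1, pairing_mul_left, inv_mul_cancel₀ h]

theorem exponent_ne_zero (h : pairing a M ≠ 0) : M ≠ 0 := by
  rintro rfl
  simp [pairing] at h

theorem expGcd_pos (hM : M ≠ 0) : 0 < expGcd M := by
  refine Nat.pos_of_ne_zero fun h => hM (funext fun i => ?_)
  exact Finset.gcd_eq_zero_iff.1 h i (Finset.mem_univ i)

theorem eq_expGcd_mul_redExp (M : Fin n → ℕ) (i : Fin n) : M i = expGcd M * redExp M i :=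
  (Nat.mul_div_cancel' (Finset.gcd_dvd (Finset.mem_univ i))).symm

theorem gcd_redExp (hM : M ≠ 0) : Finset.univ.gcd (redExp M) = 1 := by
  obtain ⟨i, hi⟩ := Function.ne_iff.1 hM
  exact Finset.gcd_div_eq_one (Finset.mem_univ i) hi

/-- The estimates near the origin that enter in the definition of a `Petal`. -/
theorem eventually_estimates {β : ℂ} {α : Fin n → ℂ} {b : Fin n → (Fin n → ℂ) → ℂ} (hβ : β ≠ 0)
    (hα : pairing α M = 1) (hb : ∀ i, AnalyticAt ℂ (b i) 0) (hb0 : ∀ i, b i 0 = β * α i)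
    {η : ℝ} (hη : 0 < η) :
    ∀ᶠ x in 𝓝 (0 : Fin n → ℂ), mon M x ≠ 0 →
      ‖lam M b x - (zc β M x)⁻¹‖ ≤ η * ‖zc β M x‖⁻¹ ∧
      (∀ i, ‖mon M x * b i x + α i * (zc β M x)⁻¹‖ ≤ η * ‖zc β M x‖⁻¹) ∧
      ‖zc β M x * Complex.exp (lam M b x) - (zc β M x + 1)‖ ≤ η ∧ ‖zc β M x‖⁻¹ ≤ η := by
  have hu0 : mon M (0 : Fin n → ℂ) = 0 := mon_zero (ne_zero_of_pairing hα)
  have hpos : 0 < η * ‖β‖ := mul_pos hη (norm_pos_iff.2 hβ)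
  have hpair := analyticAt_pairing hb M
  have hlam : AnalyticAt ℂ (lam M b) 0 := by
    unfold lam
    exact ((analyticAt_mon M 0).mul hpair).neg
  have hlam0 : lam M b 0 = 0 := by simp [lam, hu0]
  have small : ∀ {F : (Fin n → ℂ) → ℂ} {e : ℝ}, ContinuousAt F 0 → F 0 = 0 → 0 < e →
      ∀ᶠ x in 𝓝 (0 : Fin n → ℂ), ‖F x‖ ≤ e := by
    intro F e hF hF0 he
    have h1 : Tendsto (fun x => ‖F x‖) (𝓝 0) (𝓝 0) := by
      have := hF.norm.tendsto
      rwa [hF0, norm_zero] at this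
    exact (h1.eventually_lt_const he).mono fun x hx => le_of_lt hx
  have e1 := small (hpair.continuousAt.sub (continuousAt_const (y := β)))
    (by rw [Pi.sub_apply, pairing_zero_eq hb0, hα, mul_one, sub_self]) hpos
  have e2 : ∀ᶠ x in 𝓝 (0 : Fin n → ℂ), ∀ i, ‖b i x - β * α i‖ ≤ η * ‖β‖ := by
    rw [eventually_all]
    intro i
    exact small ((hb i).continuousAt.sub continuousAt_const) (by simp [hb0]) hpos
  have e3 : ∀ᶠ x in 𝓝 (0 : Fin n → ℂ),
      ‖β⁻¹ * pairing (fun i => b i x) M * expQuot (lam M b x) - 1‖ ≤ η := by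
    refine small ?_ ?_ hη
    · refine ContinuousAt.sub (ContinuousAt.mul (continuousAt_const.mul hpair.continuousAt) ?_)
        continuousAt_const
      refine ContinuousAt.comp (g := expQuot) ?_ hlam.continuousAt
      rw [hlam0]
      exact (analyticAt_dslope analyticAt_cexp).continuousAt
    · rw [hlam0, expQuot_zero, pairing_zero_eq hb0, hα, mul_one, mul_one, inv_mul_cancel₀ hβ,
        sub_self]
  have e4 := small (F := fun x => β * mon M x)
    (continuousAt_const.mul (analyticAt_mon M 0).continuousAt) (by simp [hu0]) hη
  filter_upwards [e1, e2, e3, e4] with x h1 h2 h3 h4 hx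
  have hinv : (zc β M x)⁻¹ = -(β * mon M x) := by rw [zc, inv_neg, inv_inv]
  have hinvn : ‖zc β M x‖⁻¹ = ‖β‖ * ‖mon M x‖ := by rw [← norm_inv, hinv, norm_neg, norm_mul]
  rw [hinvn, hinv]
  refine ⟨?_, fun i => ?_, ?_, ?_⟩
  · have h5 : lam M b x - -(β * mon M x) = -(mon M x * (pairing (fun i => b i x) M - β)) := by
      rw [lam]
      ring
    rw [h5, norm_neg, norm_mul, ← mul_assoc, mul_comm]
    gcongr
    exact h1
  · have h5 : mon M x * b i x + α i * -(β * mon M x) = mon M x * (b i x - β * α i) := by ring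
    rw [h5, norm_mul, ← mul_assoc, mul_comm]
    gcongr
    exact h2 i
  · have h5 : zc β M x * Complex.exp (lam M b x) - (zc β M x + 1)
        = β⁻¹ * pairing (fun i => b i x) M * expQuot (lam M b x) - 1 := by
      have h6 := mul_expQuot (lam M b x)
      have h7 : zc β M x * lam M b x = β⁻¹ * pairing (fun i => b i x) M := by
        unfold zc lam
        field_simp
      rw [← h7]
      linear_combination -zc β M x * h6
    rw [h5]
    exact h3
  · rw [← norm_mul]
    exact h4

variable [NeZero n]

theorem pairing_ne_zero (ha : ∀ i, 0 < (a i / pairing a M).re) : pairing a M ≠ 0 := by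
  intro h
  have := ha 0
  rw [h, div_zero, Complex.zero_re] at this
  exact lt_irrefl _ this

/-- Order of choices: A = min Re α_i and δ = A/4, then B and κ, then N and the approximate Abel
solution P, then η, and ε last, so small that every estimate holds on the ball and the ball lies in
U and in the source of f. -/
theorem exists_petal {b : Fin n → (Fin n → ℂ) → ℂ} (hf : HasExpForm M a f b)
    (ha : ∀ i, 0 < (a i / pairing a M).re) {U : Set (Fin n → ℂ)} (hU : U ∈ 𝓝 0) :
    ∃ D : Petal n, D.M = M ∧ D.m = redExp M ∧ D.d = expGcd M ∧ D.β = pairing a M ∧ D.g = f ∧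
      ∀ x, ‖x‖ < D.ε → x ∈ U ∧ x ∈ f.source := by
  obtain ⟨h0, hb, hb0, hform⟩ := id hf
  have hβ := pairing_ne_zero ha
  have hM := exponent_ne_zero hβ
  set β := pairing a M with hβdef
  set α : Fin n → ℂ := fun i => a i / β with hα
  have hα1 : pairing α M = 1 := pairing_div hβ
  have hb0' : ∀ i, b i 0 = β * α i := fun i => by rw [hb0, hα, mul_div_cancel₀ _ hβ]
  obtain ⟨i₀, -, hi₀⟩ := Finset.exists_min_image Finset.univ (fun i => (α i).re)
    ⟨0, Finset.mem_univ _⟩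
  set A : ℝ := (α i₀).re with hA
  have hA0 : 0 < A := ha i₀
  have hAle : ∀ i, A ≤ (α i).re := fun i => hi₀ i (Finset.mem_univ i)
  obtain ⟨B, hB0, hB⟩ := exists_turn_const hA0
  obtain ⟨κ, hκ0, hκ1, hκ⟩ := exists_sector_const hA0 (norm_nonneg α)
  obtain ⟨N, hN⟩ := exists_nat_ge ((1 + 2 * (A / 4)) / (A / 4))
  rw [div_le_iff₀ (by positivity)] at hN
  obtain ⟨P, C₁, K, hC₁, hPd, hP⟩ := exists_normalization hβ hα1 hb hb0' N
  set η : ℝ := min (κ / 4) (min (A / 2 / (1 + 6 * B)) (A / 4 / (1 + A / 4))) with hη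
  have hη0 : 0 < η := by positivity
  have hη1 : η ≤ κ / 4 := min_le_left _ _
  have hη2 : η ≤ A / 2 / (1 + 6 * B) := (min_le_right _ _).trans (min_le_left _ _)
  have hη3 : η ≤ A / 4 / (1 + A / 4) := (min_le_right _ _).trans (min_le_right _ _)
  rw [le_div_iff₀ (by positivity)] at hη2 hη3
  have hdiff : DifferentiableAt ℂ (fun x i => b i x) 0 :=
    differentiableAt_pi.2 fun i => (hb i).differentiableAt
  obtain ⟨C₂, hC₂, hO⟩ := hdiff.isBigO_sub.exists_pos
  have hbsub : ∀ᶠ x in 𝓝 (0 : Fin n → ℂ), ∀ i, ‖b i x - β * α i‖ ≤ C₂ * ‖x‖ := by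
    filter_upwards [hO.bound] with x hx i
    rw [sub_zero] at hx
    rw [← hb0' i]
    exact (norm_le_pi_norm ((fun i => b i x) - fun i => b i 0) i).trans hx
  have hbd : ∀ᶠ x in 𝓝 (0 : Fin n → ℂ), ∀ i, DifferentiableAt ℂ (b i) x := by
    rw [eventually_all]
    exact fun i => (hb i).eventually_analyticAt.mono fun x hx => hx.differentiableAt
  have hcont : Tendsto f (𝓝 0) (𝓝 0) := by
    have := f.continuousAt h0
    rwa [ContinuousAt, hf.apply_zero] at this
  have hsymm : ∀ᶠ x in 𝓝 (0 : Fin n → ℂ), AnalyticAt ℂ f.symm (f x) :=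
    hcont.eventually (hf.analyticAt_symm hM).eventually_analyticAt
  have hest := eventually_estimates hβ hα1 hb hb0' hη0
  obtain ⟨ε, hε, hball⟩ := Metric.eventually_nhds_iff_ball.1
    (hP.and (hform.and (hbsub.and (hbd.and (hsymm.and (hest.and
      ((eventually_mem_set.2 hU).and (f.open_source.eventually_mem h0))))))))
  have hball' : ∀ x : Fin n → ℂ, ‖x‖ < ε → x ∈ Metric.ball 0 ε := fun x hx =>
    mem_ball_zero_iff.2 hx
  refine ⟨{
    M := M, m := redExp M, d := expGcd M, β := β, α := α, b := b, g := f, h := f.symm, P := P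
    ε := ε, A := A, B := B, κ := κ, δ := A / 4, η := η, C := C₁ + C₂, N := N, K := K
    d_pos := expGcd_pos hM
    M_eq := eq_expGcd_mul_redExp M
    β_ne := hβ
    sum_α := hα1
    ε_pos := hε
    B_nonneg := hB0
    κ_pos := hκ0
    κ_le := hκ1
    δ_pos := by positivity
    δ_le := fun i => by linarith [hAle i]
    η_pos := hη0
    η_le := hη1
    η_le_turn := hη2
    η_le_sector := hη3
    C_nonneg := by positivity
    N_ge := hN
    turn := fun i θ => hB (α i) (hAle i) (norm_le_pi_norm α i) θ
    sector := fun i c s => hκ (α i) (hAle i) (norm_le_pi_norm α i) c s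
    diff_P := hPd
    diff_b := fun x hx => (hball x (hball' x hx)).2.2.2.1
    g_eq := fun x hx => (hball x (hball' x hx)).2.1
    h_g := fun x hx => f.left_inv (hball x (hball' x hx)).2.2.2.2.2.2.2
    h_near := fun x hx => ?_
    norm_b_sub := fun x hx i => ?_
    norm_lam_sub := fun x hx hm => ((hball x (hball' x hx)).2.2.2.2.2.1 hm).1
    norm_mon_mul_b := fun x hx hm => ((hball x (hball' x hx)).2.2.2.2.2.1 hm).2.1
    norm_zc_sub := fun x hx hm => ((hball x (hball' x hx)).2.2.2.2.2.1 hm).2.2.1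
    norm_zc_inv := fun x hx hm => ((hball x (hball' x hx)).2.2.2.2.2.1 hm).2.2.2
    norm_P := fun x hx l => ?_
    norm_abel := fun x hx hm l => ?_ }, rfl, rfl, rfl, rfl, rfl, fun x hx => ?_⟩
  · obtain ⟨-, -, -, -, h1, -, -, h2⟩ := hball x (hball' x hx)
    filter_upwards [h1.eventually_analyticAt, f.open_target.mem_nhds (f.map_source h2)]
      with z hz1 hz2
    exact ⟨hz1.differentiableAt, f.right_inv hz2⟩
  · refine ((hball x (hball' x hx)).2.2.1 i).trans ?_
    gcongr
    linarith
  · refine ((hball x (hball' x hx)).1.1 l).trans ?_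
    gcongr
    linarith
  · refine ((hball x (hball' x hx)).1.2 hm l).trans ?_
    gcongr
    linarith
  · exact (hball x (hball' x hx)).2.2.2.2.2.2

end Existence


/-! ### Logarithmic coordinates: connectedness, disjointness and covering -/

theorem exists_sum_mul_eq_one {n : ℕ} {m : Fin n → ℕ} (hg : Finset.univ.gcd m = 1) :
    ∃ k : Fin n → ℤ, ∑ i, (m i : ℤ) * k i = 1 := by
  rcases n with _ | n
  · simp at hg
  · obtain ⟨-, e, -, he, -⟩ := exists_linearEquiv_of_gcd_eq_one Finset.univ _ m rfl (by simp) hg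
    exact ⟨e.symm (Pi.single 0 1), by rw [← he, e.apply_symm_apply, Pi.single_eq_same]⟩

theorem pos_of_abs_arg_lt {z : ℂ} (h0 : z ≠ 0) (hz : |z.arg| < 3 * Real.pi / 4) :
    0 < z.re + |z.im| := by
  have h1 : 0 < ‖z‖ := norm_pos_iff.2 h0
  have hr : z.re = ‖z‖ * Real.cos |z.arg| := by rw [Real.cos_abs, Complex.norm_mul_cos_arg]
  have hi : |z.im| = ‖z‖ * Real.sin |z.arg| := by
    rw [← Complex.norm_mul_sin_arg, abs_mul, abs_norm,
      Real.abs_sin_eq_sin_abs_of_abs_le_pi (Complex.abs_arg_le_pi z)]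
  have h2 : 0 < Real.sin (|z.arg| + Real.pi / 4) :=
    Real.sin_pos_of_pos_of_lt_pi (by positivity) (by linarith)
  rw [Real.sin_add, Real.cos_pi_div_four, Real.sin_pi_div_four, ← add_mul] at h2
  have h3 := (mul_pos_iff_of_pos_right (by positivity)).1 h2
  rw [hr, hi, ← mul_add]
  exact mul_pos h1 (by linarith)

namespace Petal

variable {n : ℕ} {D : Petal n} {ω : ℂ} {x ξ : Fin n → ℂ}

/-- The branch of `log Z`, up to a real summand, in the logarithmic coordinates `ξ`. -/
noncomputable def logZ (D : Petal n) (ω : ℂ) (ξ : Fin n → ℂ) : ℂ :=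
  -(D.d * Complex.log ω) - pairing ξ D.M

/-- The passage from logarithmic coordinates to the attracting domain. -/
noncomputable def ofLog (D : Petal n) (ω : ℂ) (ξ : Fin n → ℂ) (i : Fin n) : ℂ :=
  if D.M i = 0 then ξ i * Complex.exp (-(D.B * (D.logZ ω ξ).im ^ 2 / 2 : ℝ))
  else Complex.exp (ξ i + -(D.B * (D.logZ ω ξ).im ^ 2 / 2 : ℝ))

/-- The attracting domain in logarithmic coordinates. -/
def logDomain (D : Petal n) (ω : ℂ) : Set (Fin n → ℂ) :=
  {ξ | (∀ i, if D.M i = 0 then ‖ξ i‖ < D.ε else (ξ i).re < Real.log D.ε) ∧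
    |(D.logZ ω ξ).im| < 3 * Real.pi / 4}

theorem pairing_add_const (m : Fin n → ℕ) (ξ : Fin n → ℂ) (c : ℂ) :
    pairing (fun i => ξ i + c) m = pairing ξ m + c * ∑ i, (m i : ℂ) := by
  unfold pairing
  rw [Finset.mul_sum, ← Finset.sum_add_distrib]
  exact Finset.sum_congr rfl fun i _ => add_mul _ _ _

theorem mon_ofLog {m : Fin n → ℕ} (hm : ∀ i, D.M i = 0 → m i = 0) :
    mon m (D.ofLog ω ξ) = Complex.exp (pairing ξ m +
      -(D.B * (D.logZ ω ξ).im ^ 2 / 2 : ℝ) * ∑ i, (m i : ℂ)) := by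
  rw [← pairing_add_const]
  unfold mon pairing ofLog
  rw [Complex.exp_sum]
  refine Finset.prod_congr rfl fun i _ => ?_
  split_ifs with h
  · simp [hm i h]
  · rw [← Complex.exp_nat_mul, mul_comm]

theorem continuous_logZ : Continuous (D.logZ ω) := by
  unfold logZ pairing
  fun_prop

theorem continuous_ofLog : Continuous (D.ofLog ω) := by
  have h : Continuous fun ξ => (-(D.B * (D.logZ ω ξ).im ^ 2 / 2 : ℝ) : ℂ) :=
    (Complex.continuous_ofReal.comp ((((Complex.continuous_im.comp continuous_logZ).pow
      2).const_mul _).div_const 2)).neg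
  refine continuous_pi fun i => ?_
  unfold ofLog
  split_ifs
  · exact (continuous_apply i).mul (Complex.continuous_exp.comp h)
  · exact Complex.continuous_exp.comp ((continuous_apply i).add h)

/-- `logZ` is affine in ξ, so the conditions cut out discs, half-planes and a strip. -/
theorem convex_logDomain : Convex ℝ (D.logDomain ω) := by
  intro ξ hξ ζ hζ s t hs ht hst
  refine ⟨fun i => ?_, ?_⟩
  · have h1 := hξ.1 i
    have h2 := hζ.1 i
    split_ifs at h1 h2 ⊢ with h
    · have := convex_ball (0 : ℂ) D.ε (mem_ball_zero_iff.2 h1) (mem_ball_zero_iff.2 h2) hs ht hst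
      exact mem_ball_zero_iff.1 this
    · have := convex_halfSpace_re_lt (Real.log D.ε) h1 h2 hs ht hst
      exact this
  · have h1 : D.logZ ω (s • ξ + t • ζ) = s • D.logZ ω ξ + t • D.logZ ω ζ := by
      have h2 : pairing (s • ξ + t • ζ) D.M = s * pairing ξ D.M + t * pairing ζ D.M := by
        unfold pairing
        rw [Finset.mul_sum, Finset.mul_sum, ← Finset.sum_add_distrib]
        refine Finset.sum_congr rfl fun i _ => ?_
        simp only [Pi.add_apply, Pi.smul_apply, Complex.real_smul]
        ring
      have h3 : (s : ℂ) + t = 1 := by exact_mod_cast hst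
      unfold logZ
      rw [h2, Complex.real_smul, Complex.real_smul]
      linear_combination (D.d * Complex.log ω) * h3
    rw [h1, Complex.add_im, Complex.smul_im, Complex.smul_im]
    have := convex_Ioo (-(3 * Real.pi / 4)) (3 * Real.pi / 4) (abs_lt.1 hξ.2) (abs_lt.1 hζ.2)
      hs ht hst
    exact abs_lt.2 this

theorem ω_ne_zero (hω : ω ^ D.d = -D.β) : ω ≠ 0 := by
  rintro rfl
  rw [zero_pow D.d_pos.ne'] at hω
  exact D.β_ne (neg_eq_zero.1 hω.symm)

/-- The weight is removed from the coordinates through a real factor, which changes log Z by a real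
number only. The imaginary part stays in (-3π/4, 3π/4), so this is the principal logarithm. -/
theorem logZ_add_eq_log (hω : ω ^ D.d = -D.β) (hξ : ξ ∈ D.logDomain ω) :
    D.L (D.ofLog ω ξ) = D.logZ ω ξ +
      (D.B * (D.logZ ω ξ).im ^ 2 / 2 : ℝ) * ∑ i, (D.M i : ℂ) := by
  have h1 : D.Z (D.ofLog ω ξ) = Complex.exp (D.logZ ω ξ +
      (D.B * (D.logZ ω ξ).im ^ 2 / 2 : ℝ) * ∑ i, (D.M i : ℂ)) := by
    have h2 : -D.β = Complex.exp (D.d * Complex.log ω) := by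
      rw [← hω, Complex.exp_nat_mul, Complex.exp_log (ω_ne_zero hω)]
    rw [Z, zc, ← inv_neg, ← neg_mul, h2, mon_ofLog fun i h => h, ← Complex.exp_add,
      ← Complex.exp_neg]
    congr 1
    simp only [logZ]
    ring
  have h3 : ((D.B * (D.logZ ω ξ).im ^ 2 / 2 : ℝ) * ∑ i, (D.M i : ℂ) : ℂ).im = 0 := by
    have : (∑ i, (D.M i : ℂ)) = ((∑ i, (D.M i : ℝ) : ℝ) : ℂ) := by push_cast; rfl
    rw [this, ← Complex.ofReal_mul, Complex.ofReal_im]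
  have h4 := abs_lt.1 hξ.2
  have hpi := Real.pi_pos
  rw [L, h1, Complex.log_exp]
  · rw [Complex.add_im, h3]
    linarith
  · rw [Complex.add_im, h3]
    linarith

theorem arg_Z_ofLog (hω : ω ^ D.d = -D.β) (hξ : ξ ∈ D.logDomain ω) :
    (D.Z (D.ofLog ω ξ)).arg = (D.logZ ω ξ).im := by
  have h1 := congrArg Complex.im (logZ_add_eq_log hω hξ)
  have : (∑ i, (D.M i : ℂ)) = ((∑ i, (D.M i : ℝ) : ℝ) : ℂ) := by push_cast; rfl
  rwa [L, Complex.log_im, this, ← Complex.ofReal_mul, Complex.add_im, Complex.ofReal_im,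
    add_zero] at h1

theorem pairing_M (D : Petal n) (v : Fin n → ℂ) : pairing v D.M = D.d * pairing v D.m :=
  (D.d_mul_pairing v).symm

theorem sum_M (D : Petal n) : ∑ i, (D.M i : ℂ) = D.d * ∑ i, (D.m i : ℂ) := by
  rw [Finset.mul_sum]
  refine Finset.sum_congr rfl fun i _ => ?_
  rw [D.M_eq, Nat.cast_mul]

theorem ofLog_mem_Ω (hω : ω ^ D.d = -D.β) (hξ : ξ ∈ D.logDomain ω) : D.ofLog ω ξ ∈ D.Ω ω := by
  have hmon : mon D.M (D.ofLog ω ξ) ≠ 0 := by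
    rw [mon_ofLog fun i h => h]
    exact Complex.exp_ne_zero _
  have harg := arg_Z_ofLog hω hξ
  refine ⟨hmon, pos_of_abs_arg_lt (D.Z_ne hmon) (harg ▸ hξ.2), fun i => ?_, ?_⟩
  · rw [harg]
    have h1 := hξ.1 i
    rw [ofLog]
    split_ifs at h1 ⊢ with h
    · rwa [norm_mul, Complex.norm_exp, ← Complex.ofReal_neg, Complex.ofReal_re, mul_assoc,
        ← Real.exp_add, neg_add_cancel, Real.exp_zero, mul_one]
    · rw [Complex.norm_exp, Complex.add_re, ← Complex.ofReal_neg, Complex.ofReal_re,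
        ← Real.exp_add, neg_add_cancel_right]
      exact (Real.lt_log_iff_exp_lt D.ε_pos).1 h1
  · have hd : (D.d : ℂ) ≠ 0 := Nat.cast_ne_zero.2 D.d_pos.ne'
    have hm : ∀ i, D.M i = 0 → D.m i = 0 := fun i h => by
      rw [D.M_eq] at h
      exact (Nat.mul_eq_zero.1 h).resolve_left D.d_pos.ne'
    have h2 : ω = Complex.exp (Complex.log ω) := (Complex.exp_log (ω_ne_zero hω)).symm
    rw [logZ_add_eq_log hω hξ, mon_ofLog hm]
    conv_lhs => enter [1, 1]; rw [h2]
    rw [← Complex.exp_add, ← Complex.exp_add, Complex.exp_eq_one_iff]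
    refine ⟨0, ?_⟩
    generalize (D.B * (D.logZ ω ξ).im ^ 2 / 2 : ℝ) = c
    rw [logZ, sum_M, pairing_M]
    field_simp
    push_cast
    ring

/-- The principal logarithms of the x_i satisfy the branch condition only modulo 2πi. As gcd m = 1,
Bézout coefficients k distribute the discrepancy 2πiN among them without changing x. -/
theorem exists_ofLog_eq (hg : Finset.univ.gcd D.m = 1) (hω : ω ^ D.d = -D.β) (hx : x ∈ D.Ω ω) :
    ∃ ξ ∈ D.logDomain ω, D.ofLog ω ξ = x := by
  have hd : (D.d : ℂ) ≠ 0 := Nat.cast_ne_zero.2 D.d_pos.ne'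
  obtain ⟨k, hk⟩ := exists_sum_mul_eq_one hg
  have hx0 := mon_ne_zero_iff.1 hx.1
  set c : ℝ := D.B * (D.Z x).arg ^ 2 / 2 with hc
  have hmon : mon D.m x = Complex.exp (pairing (fun i => Complex.log (x i)) D.m) := by
    unfold mon pairing
    rw [Complex.exp_sum]
    refine Finset.prod_congr rfl fun i _ => ?_
    by_cases h : D.m i = 0
    · simp [h]
    · rw [mul_comm, Complex.exp_nat_mul, Complex.exp_log (apply_ne_zero hx h)]
  have h1 := hx.2.2.2
  have h2 : ω = Complex.exp (Complex.log ω) := (Complex.exp_log (ω_ne_zero hω)).symm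
  rw [hmon, h2, ← Complex.exp_add, ← Complex.exp_add, Complex.exp_eq_one_iff] at h1
  obtain ⟨N, hN⟩ := h1
  set ξ : Fin n → ℂ := fun i => if D.M i = 0 then x i * Complex.exp c
    else Complex.log (x i) + -(N * (2 * Real.pi * Complex.I)) * k i + c with hξ
  have hpair : pairing ξ D.m = pairing (fun i => Complex.log (x i)) D.m
      - N * (2 * Real.pi * Complex.I) + c * ∑ i, (D.m i : ℂ) := by
    have h3 : pairing ξ D.m = pairing (fun i => Complex.log (x i) +
        -(N * (2 * Real.pi * Complex.I)) * k i + c) D.m := by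
      refine Finset.sum_congr rfl fun i _ => ?_
      by_cases h : D.M i = 0
      · rw [D.M_eq] at h
        simp [(Nat.mul_eq_zero.1 h).resolve_left D.d_pos.ne']
      · simp only [hξ, if_neg h]
    have h4 : ∑ i, (D.m i : ℂ) * (k i : ℂ) = 1 := by exact_mod_cast hk
    rw [h3, pairing_add_const]
    congr 1
    unfold pairing
    have h5 : (N * (2 * Real.pi * Complex.I) : ℂ)
        = ∑ i, (N * (2 * Real.pi * Complex.I)) * ((D.m i : ℂ) * (k i : ℂ)) := by
      rw [← Finset.mul_sum, h4, mul_one]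
    conv_rhs => rw [h5]
    rw [← Finset.sum_sub_distrib]
    refine Finset.sum_congr rfl fun i _ => ?_
    ring
  have hlogZ : D.logZ ω ξ = D.L x - c * ∑ i, (D.M i : ℂ) := by
    have h5 : D.L x = D.d * (D.L x / D.d) := (mul_div_cancel₀ _ hd).symm
    rw [logZ, pairing_M, hpair, sum_M, h5]
    linear_combination (-D.d : ℂ) * hN
  have him : (D.logZ ω ξ).im = (D.Z x).arg := by
    have : (∑ i, (D.M i : ℂ)) = ((∑ i, (D.M i : ℝ) : ℝ) : ℂ) := by push_cast; rfl
    rw [hlogZ, this, ← Complex.ofReal_mul, Complex.sub_im, Complex.ofReal_im, sub_zero, L,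
      Complex.log_im]
  refine ⟨ξ, ⟨fun i => ?_, ?_⟩, ?_⟩
  · have h6 := hx.2.2.1 i
    split_ifs with h
    · simp only [hξ, if_pos h]
      rwa [norm_mul, Complex.norm_exp, Complex.ofReal_re]
    · simp only [hξ, if_neg h]
      have h7 : (-(N * (2 * Real.pi * Complex.I)) * k i : ℂ).re = 0 := by simp
      rw [Complex.add_re, Complex.add_re, h7, add_zero, Complex.log_re, Complex.ofReal_re]
      have h8 : 0 < ‖x i‖ := norm_pos_iff.2 (hx0 i h)
      rwa [Real.lt_log_iff_exp_lt D.ε_pos, Real.exp_add, Real.exp_log h8]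
  · rw [him]
    exact abs_arg_lt_of_pos hx.2.1
  · ext i
    rw [ofLog, him, ← hc]
    split_ifs with h
    · simp only [hξ, if_pos h]
      rw [mul_assoc, ← Complex.exp_add, add_neg_cancel, Complex.exp_zero, mul_one]
    · simp only [hξ, if_neg h]
      rw [add_neg_cancel_right, Complex.exp_add, Complex.exp_log (hx0 i h)]
      have : Complex.exp (-(N * (2 * Real.pi * Complex.I)) * k i) = 1 := by
        rw [Complex.exp_eq_one_iff]
        refine ⟨-(N * k i), ?_⟩
        push_cast
        ring
      rw [this, mul_one]

theorem isPreconnected_Ω (hg : Finset.univ.gcd D.m = 1) (hω : ω ^ D.d = -D.β) :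
    IsPreconnected (D.Ω ω) := by
  have : D.Ω ω = D.ofLog ω '' D.logDomain ω := by
    refine Subset.antisymm (fun x hx => exists_ofLog_eq hg hω hx) ?_
    rintro _ ⟨ξ, hξ, rfl⟩
    exact ofLog_mem_Ω hω hξ
  rw [this]
  exact convex_logDomain.isPreconnected.image _ continuous_ofLog.continuousOn

theorem disjoint_Ω {ω' : ℂ} (h : ω ≠ ω') : Disjoint (D.Ω ω) (D.Ω ω') := by
  rw [Set.disjoint_left]
  intro x hx hx'
  have h1 := hx.2.2.2.trans hx'.2.2.2.symm
  have h2 : mon D.m x * Complex.exp (D.L x / D.d) ≠ 0 := by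
    intro h0
    have := hx.2.2.2
    rw [mul_assoc, h0, mul_zero] at this
    exact zero_ne_one this
  rw [mul_assoc, mul_assoc] at h1
  exact h (mul_right_cancel₀ h2 h1)

/-- The point determines the root: ω is the inverse of x^m Z^(1/d). The ball radius ε exp(-Bπ²/2)
absorbs the largest possible weight. -/
theorem eventually_mem_Ω (D : Petal n) : ∀ᶠ x in 𝓝 (0 : Fin n → ℂ), mon D.M x ≠ 0 →
    0 < (D.Z x).re + |(D.Z x).im| → ∃ ω, ω ^ D.d = -D.β ∧ x ∈ D.Ω ω := by
  have hr : 0 < D.ε * Real.exp (-(D.B * Real.pi ^ 2 / 2)) := mul_pos D.ε_pos (Real.exp_pos _)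
  filter_upwards [Metric.ball_mem_nhds 0 hr] with x hx hmon hpos
  rw [mem_ball_zero_iff] at hx
  have hd : (D.d : ℂ) ≠ 0 := Nat.cast_ne_zero.2 D.d_pos.ne'
  have h1 : (mon D.m x * Complex.exp (D.L x / D.d)) ^ D.d = (-D.β)⁻¹ := by
    rw [mul_pow, ← Complex.exp_nat_mul, mul_div_cancel₀ _ hd, ← mon_mul_pow D.M_eq, L,
      Complex.exp_log (D.Z_ne hmon), Z, zc, mul_neg, mul_inv, mul_left_comm, mul_inv_cancel₀ hmon,
      mul_one, inv_neg]
  have h2 : mon D.m x * Complex.exp (D.L x / D.d) ≠ 0 := by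
    intro h0
    rw [h0, zero_pow D.d_pos.ne', eq_comm, inv_eq_zero, neg_eq_zero] at h1
    exact D.β_ne h1
  refine ⟨(mon D.m x * Complex.exp (D.L x / D.d))⁻¹, ?_, hmon, hpos, fun i => ?_, ?_⟩
  · rw [inv_pow, h1, inv_inv]
  · have hB := D.B_nonneg
    have h3 : (D.Z x).arg ^ 2 ≤ Real.pi ^ 2 := by
      rw [← sq_abs]
      gcongr
      exact Complex.abs_arg_le_pi _
    calc ‖x i‖ * Real.exp (D.B * (D.Z x).arg ^ 2 / 2)
        ≤ ‖x‖ * Real.exp (D.B * Real.pi ^ 2 / 2) := by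
          gcongr
          exact norm_le_pi_norm x i
      _ < D.ε * Real.exp (-(D.B * Real.pi ^ 2 / 2)) * Real.exp (D.B * Real.pi ^ 2 / 2) := by
          gcongr
      _ = D.ε := by
          rw [mul_assoc, ← Real.exp_add, neg_add_cancel, Real.exp_zero, mul_one]
  · rw [mul_assoc, inv_mul_cancel₀ h2]

theorem exists_roots (D : Petal n) : ∃ r : Fin D.d → ℂ, Function.Injective r ∧
    (∀ k, r k ^ D.d = -D.β) ∧ ∀ ω, ω ^ D.d = -D.β → ∃ k, r k = ω := by
  obtain ⟨ω₀, h0⟩ := IsAlgClosed.exists_pow_nat_eq (-D.β) D.d_pos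
  have hne := ω_ne_zero h0
  have hζ := Complex.isPrimitiveRoot_exp D.d D.d_pos.ne'
  set ζ := Complex.exp (2 * Real.pi * Complex.I / D.d)
  refine ⟨fun k => ω₀ * ζ ^ (k : ℕ), fun k l h => ?_, fun k => ?_, fun ω hω => ?_⟩
  · exact Fin.ext (hζ.pow_inj k.2 l.2 (mul_left_cancel₀ hne h))
  · rw [mul_pow, h0, ← pow_mul, mul_comm (k : ℕ), pow_mul, hζ.pow_eq_one, one_pow, mul_one]
  · have hq : (ω / ω₀) ^ D.d = 1 := by
      rw [div_pow, hω, h0, div_self (neg_ne_zero.2 D.β_ne)]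
    have : NeZero D.d := ⟨D.d_pos.ne'⟩
    obtain ⟨i, hi, h⟩ := hζ.eq_pow_of_pow_eq_one hq
    refine ⟨⟨i, hi⟩, ?_⟩
    simp only []
    rw [h, mul_div_cancel₀ _ hne]

end Petal


/-! ### Attracting domains of a germ in exponential form -/

section Domains

variable {n : ℕ} {M : Fin n → ℕ} {a : Fin n → ℂ}
  {f : OpenPartialHomeomorph (Fin n → ℂ) (Fin n → ℂ)}

theorem Petal.isAttractingDomain_Ω {D : Petal n} {ω : ℂ} (hg : Finset.univ.gcd D.m = 1)
    (hω : ω ^ D.d = -D.β) (hne : (D.Ω ω).Nonempty) {S : Set (Fin n → ℂ)} (hS : D.Ω ω ⊆ S) :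
    IsAttractingDomain D.g S (D.Ω ω) where
  isOpen := isOpen_Ω hω
  isConnected := ⟨hne, isPreconnected_Ω hg hω⟩
  subset_dom := hS
  -- 0 is a limit of an orbit in the domain, but x^M vanishes there.
  zero_mem_frontier := by
    rw [(isOpen_Ω hω).frontier_eq]
    obtain ⟨x, hx⟩ := hne
    refine ⟨?_, fun h0 => h0.1 (mon_zero (ne_zero_of_pairing D.sum_α))⟩
    have h1 := tendsto_iterate_uniformly hω (singleton_subset_iff.2 hx) isCompact_singleton
    exact mem_closure_of_tendsto (h1.tendsto_at (mem_singleton x))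
      (Eventually.of_forall fun j => iterate_mem hx j)
  invariant := mapsTo_Ω
  tendsto_zero := fun _ hK hc => tendsto_iterate_uniformly hω hK hc

variable [NeZero n]

/-- The one-sided result, applied to both f and f⁻¹; the covering is stated through the sector of Z
so that the two applications can be combined. -/
theorem HasExpForm.exists_attractingDomains {b : Fin n → (Fin n → ℂ) → ℂ}
    (hf : HasExpForm M a f b) (ha : ∀ i, 0 < (a i / pairing a M).re) {U : Set (Fin n → ℂ)}
    (hU : U ∈ 𝓝 0) :
    ∃ Ω : Fin (expGcd M) → Set (Fin n → ℂ), (∀ k, Ω k ⊆ U) ∧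
      Pairwise (fun k l => Disjoint (Ω k) (Ω l)) ∧
      (∀ k, IsAttractingDomain f f.source (Ω k)) ∧
      (∀ᶠ x in 𝓝 (0 : Fin n → ℂ), mon M x ≠ 0 →
        0 < (zc (pairing a M) M x).re + |(zc (pairing a M) M x).im| → x ∈ ⋃ k, Ω k) ∧
      ∀ k, ∃ φ : (Fin n → ℂ) → (Fin n → ℂ), IsBiholomorphism φ (Ω k) (φ '' Ω k) ∧
        (∀ x ∈ Ω k, φ (f x) = shift (φ x)) ∧
        (⋃ j : ℕ, T (j : ℤ) '' (φ '' Ω k)) = model n (numZero M) := by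
  obtain ⟨D, hDM, hDm, hDd, hDβ, hDg, hDε⟩ := exists_petal hf ha hU
  have hg : Finset.univ.gcd D.m = 1 := by
    rw [hDm]
    exact gcd_redExp (exponent_ne_zero (pairing_ne_zero ha))
  obtain ⟨μ, ν, hμ⟩ := exists_monomialChart hg
  obtain ⟨r, hrinj, hr, hrsurj⟩ := D.exists_roots
  have hunion : ∀ {ω : ℂ}, ω ^ D.d = -D.β →
      (⋃ j : ℕ, T (j : ℤ) '' (D.Φ μ '' D.Ω ω)) = model n (numZero M) := fun hω => by
    rw [Petal.iUnion_T_image hμ hω, hDm]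
    rfl
  -- Nonemptiness comes for free: the translates of the image fill the model, which contains (1, …,
  -- 1).
  have hne : ∀ {ω : ℂ}, ω ^ D.d = -D.β → (D.Ω ω).Nonempty := fun hω => by
    have h1 : (fun _ => 1 : Fin n → ℂ) ∈ model n (numZero M) := fun i _ _ => one_ne_zero
    rw [← hunion hω, mem_iUnion] at h1
    obtain ⟨j, _, ⟨x, hx, -⟩, -⟩ := h1
    exact ⟨x, hx⟩
  subst hDM
  rw [← hDβ, ← hDg, ← hDd]
  refine ⟨fun k => D.Ω (r k), fun k x hx => (hDε x (Petal.norm_lt hx)).1,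
    fun k l hkl => Petal.disjoint_Ω (hrinj.ne hkl), fun k => ?_, ?_, fun k => ?_⟩
  · exact Petal.isAttractingDomain_Ω hg (hr k) (hne (hr k))
      fun x hx => (hDε x (Petal.norm_lt hx)).2
  · filter_upwards [D.eventually_mem_Ω] with x hx h1 h2
    obtain ⟨ω, hω, hxω⟩ := hx h1 h2
    obtain ⟨k, rfl⟩ := hrsurj ω hω
    exact mem_iUnion.2 ⟨k, hxω⟩
  · exact ⟨D.Φ μ, Petal.isBiholomorphism_Φ hμ (hr k), fun x hx => Petal.Φ_g hx, hunion (hr k)⟩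

end Domains

/-! ### Reversing the sign of the Fatou coordinate for the inverse map -/

section Reflection

variable {n : ℕ} [NeZero n]

/-- The involution `(z, w) ↦ (-z, w)`. -/
def negFirst (z : Fin n → ℂ) : Fin n → ℂ := Function.update z 0 (-z 0)

theorem negFirst_negFirst (z : Fin n → ℂ) : negFirst (negFirst z) = z := by
  simp [negFirst]

theorem negFirst_involutive : Function.Involutive (negFirst (n := n)) := negFirst_negFirst

theorem differentiable_negFirst : Differentiable ℂ (negFirst (n := n)) := fun z =>
  differentiableAt_update 0 differentiableAt_id (differentiableAt_apply 0 z).neg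

/-- The construction for f⁻¹ yields φ∘f⁻¹ = φ + 1, whereas φ = φ∘f⁻¹ + 1 is wanted; changing the
sign of the first coordinate converts one into the other. -/
theorem shift_negFirst_shift (z : Fin n → ℂ) : shift (negFirst (shift z)) = negFirst z := by
  simp [shift, negFirst]

theorem T_neg_negFirst (j : ℤ) (z : Fin n → ℂ) : T (-j) (negFirst z) = negFirst (T j z) := by
  simp only [T, negFirst, Function.update_idem, Function.update_self, Int.cast_neg]
  congr 1
  ring

theorem negFirst_image_model (m : ℕ) : negFirst '' model n m = model n m := by
  have h : ∀ z : Fin n → ℂ, z ∈ model n m → negFirst z ∈ model n m := by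
    intro z hz i hi him
    have : i ≠ 0 := by
      rintro rfl
      simp at hi
    rw [negFirst, Function.update_of_ne this]
    exact hz i hi him
  refine Subset.antisymm (image_subset_iff.2 h) fun z hz => ⟨_, h z hz, negFirst_negFirst z⟩

theorem IsBiholomorphism.negFirst_comp {φ : (Fin n → ℂ) → (Fin n → ℂ)} {Ω W : Set (Fin n → ℂ)}
    (h : IsBiholomorphism φ Ω W) : IsBiholomorphism (negFirst ∘ φ) Ω (negFirst '' W) := by
  obtain ⟨h1, h2, h3, h4, ψ, h5, h6⟩ := h
  have hW : negFirst '' W = negFirst ⁻¹' W :=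
    congrFun (image_eq_preimage_of_inverse negFirst_negFirst negFirst_negFirst) W
  refine ⟨h1, ?_, differentiable_negFirst.comp_differentiableOn h3,
    (negFirst_involutive.injective.injOn.bijOn_image).comp h4, ψ ∘ negFirst, ?_, ?_⟩
  · rw [hW]
    exact h2.preimage differentiable_negFirst.continuous
  · refine h5.comp differentiable_negFirst.differentiableOn ?_
    rw [hW]
    exact fun z hz => hz
  · refine ⟨fun x hx => ?_, ?_⟩
    · simp only [Function.comp_apply, negFirst_negFirst]
      exact h6.1 hx
    · rintro _ ⟨z, hz, rfl⟩
      simp only [Function.comp_apply, negFirst_negFirst]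
      rw [h6.2 hz]

end Reflection

/-! ### Fixed points near the origin -/

section FixedPoints

variable {n : ℕ} {M : Fin n → ℕ} {a : Fin n → ℂ}
  {f : OpenPartialHomeomorph (Fin n → ℂ) (Fin n → ℂ)}

theorem HasForm.eventually_fixed_iff (hM : M ≠ 0) (hf : HasForm M a f) :
    ∀ᶠ x in 𝓝 (0 : Fin n → ℂ), f x = x ↔ mon M x = 0 := by
  obtain ⟨A, hA, hA0, hform⟩ := hf.form
  -- One coordinate occurring in x^M suffices: x_i ≠ 0 whenever x^M ≠ 0, so fixing x_i forces
  -- x^M(a_i + A_i) = 0.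
  obtain ⟨i, hi⟩ := Function.ne_iff.1 hM
  have hne : ∀ᶠ x in 𝓝 (0 : Fin n → ℂ), a i + A i x ≠ 0 := by
    refine (continuousAt_const.add (hA i).continuousAt).eventually_ne ?_
    simpa [hA0 i] using hf.coeff_ne_zero i
  filter_upwards [hform, hne] with x h1 h2
  refine ⟨fun hx => ?_, fun hx => funext fun k => by rw [h1, hx, zero_mul, add_zero, mul_one]⟩
  by_contra h
  have h3 := h1 i
  rw [hx, mul_add, mul_one, left_eq_add] at h3
  exact mul_ne_zero (mon_ne_zero_iff.1 h i hi) (mul_ne_zero h h2) h3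

end FixedPoints

theorem re_add_abs_im_pos_or {z : ℂ} (hz : z ≠ 0) :
    0 < z.re + |z.im| ∨ 0 < (-z).re + |(-z).im| := by
  rw [Complex.neg_re, Complex.neg_im, abs_neg]
  by_contra! h
  have h1 := abs_nonneg z.im
  refine hz (Complex.ext (by simp; linarith) ?_)
  exact abs_eq_zero.1 (by linarith)

end ParabolicGerm

/-! ### Assembly of the attracting and repelling sides -/

theorem theoremA {n : ℕ} [NeZero n] (M : Fin n → ℕ) (a : Fin n → ℂ)
    (f : OpenPartialHomeomorph (Fin n → ℂ) (Fin n → ℂ)) (hf : HasForm M a f)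
    (ha : ∀ i, 0 < (a i / pairing a M).re) :
    (∀ᶠ x in 𝓝 (0 : Fin n → ℂ), f x = x ↔ mon M x = 0) ∧
    ∀ U ∈ 𝓝 (0 : Fin n → ℂ),
      ∃ Ωp Ωm : Fin (expGcd M) → Set (Fin n → ℂ),
        (∀ k, Ωp k ⊆ U ∧ Ωm k ⊆ U) ∧
        Pairwise (fun k l => Disjoint (Ωp k) (Ωp l)) ∧
        Pairwise (fun k l => Disjoint (Ωm k) (Ωm l)) ∧
        (∀ k, IsAttractingDomain f f.source (Ωp k)) ∧
        (∀ k, IsAttractingDomain f.symm f.target (Ωm k)) ∧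
        ((⋃ k, Ωp k) ∪ (⋃ k, Ωm k) ∪ {x | mon M x = 0}) ∈ 𝓝 (0 : Fin n → ℂ) ∧
        (∀ k, ∃ (φ : (Fin n → ℂ) → (Fin n → ℂ)) (W : Set (Fin n → ℂ)),
          IsBiholomorphism φ (Ωp k) W ∧
          (∀ x ∈ Ωp k, φ (f x) = shift (φ x)) ∧
          (⋃ j : ℕ, T (j : ℤ) '' W) = model n (numZero M)) ∧
        (∀ k, ∃ (φ : (Fin n → ℂ) → (Fin n → ℂ)) (W : Set (Fin n → ℂ)),
          IsBiholomorphism φ (Ωm k) W ∧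
          (∀ x ∈ Ωm k, φ x = shift (φ (f.symm x))) ∧
          (⋃ j : ℕ, T (-(j : ℤ)) '' W) = model n (numZero M)) := by
  have hβ := pairing_ne_zero ha
  have hM := exponent_ne_zero hβ
  have hneg : pairing (-a) M = -pairing a M := by
    simpa [Pi.neg_def] using pairing_mul_left M (-1) a
  obtain ⟨b, hb⟩ := hf.exists_hasExpForm hM
  obtain ⟨b', hb'⟩ := hb.symm hM
  -- The ratios a_i/⟨a,M⟩ are the same for f⁻¹, so the positivity hypothesis passes to the inverse.
  have ha' : ∀ i, 0 < ((-a) i / pairing (-a) M).re := fun i => by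
    rw [hneg, Pi.neg_apply, neg_div_neg_eq]
    exact ha i
  refine ⟨hf.eventually_fixed_iff hM, fun U hU => ?_⟩
  obtain ⟨Ωp, hpU, hpd, hpa, hpc, hpφ⟩ := hb.exists_attractingDomains ha hU
  obtain ⟨Ωm, hmU, hmd, hma, hmc, hmφ⟩ := hb'.exists_attractingDomains ha' hU
  refine ⟨Ωp, Ωm, fun k => ⟨hpU k, hmU k⟩, hpd, hmd, hpa, hma, ?_, fun k => ?_, fun k => ?_⟩
  · filter_upwards [hpc, hmc] with x h1 h2
    by_cases hx : mon M x = 0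
    · exact Or.inr hx
    · left
      have hz : zc (pairing a M) M x ≠ 0 := neg_ne_zero.2 (inv_ne_zero (mul_ne_zero hβ hx))
      have hz' : zc (pairing (-a) M) M x = -zc (pairing a M) M x := by
        rw [hneg, zc, zc, neg_mul, inv_neg]
      rcases re_add_abs_im_pos_or hz with h | h
      · exact Or.inl (h1 hx h)
      · exact Or.inr (h2 hx (hz' ▸ h))
  · obtain ⟨φ, h1, h2, h3⟩ := hpφ k
    exact ⟨φ, _, h1, h2, h3⟩
  · obtain ⟨φ, h1, h2, h3⟩ := hmφ k
    refine ⟨negFirst ∘ φ, _, h1.negFirst_comp, fun x hx => ?_, ?_⟩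
    · rw [Function.comp_apply, Function.comp_apply, h2 x hx, shift_negFirst_shift]
    · rw [← negFirst_image_model, ← h3, image_iUnion]
      refine iUnion_congr fun j => ?_
      rw [image_image, image_image negFirst]
      simp only [T_neg_negFirst]
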